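/- Let $G$ be a compact Lie group and $K\subset G$ a closed subgroup such that $G/K$ is connected and $G$ acts effectively on $G/K$. Let $Q$ be a bi-invariant scalar product on $\mathfrak g$, and write $\mathfrak g=\mathfrak k\oplus\mathfrak p$ with $\mathfrak p$ the $Q$-orthogonal complement of $\mathfrak k$. Suppose that $K$ is maximal in $G$, in the sense that there is no $\mathrm{Ad}(K)$-invariant Lie subalgebra strictly between $\mathfrak k$ and $\mathfrak g$, and that $\mathfrak p=\mathfrak p_1\oplus\mathfrak p_2$ with $\mathfrak p_1,\mathfrak p_2$ irreducible, inequivalent $\mathrm{Ad}(K)$-invariant subspaces. $G$-invariant metrics on $G/K$ are identified with $\mathrm{Ad}(K)$-invariant scalar products on $\mathfrak p$; they are exactly the forms $g=x_1Q|_{\mathfrak p_1}\oplus x_2Q|_{\mathfrak p_2}$ with $x_1,x_2>0$. Put $y=x_1/x_2$. Let $d_i=\dim\mathfrak p_i$, let $b_i$ be defined by $-B|_{\mathfrak p_i}=b_iQ|_{\mathfrak p_i}$ ($B$ the Killing form of $\mathfrak g$), let $[ijk]=\sum Q([e_\alpha,e_\beta],e_\gamma)^2$ over $Q$-orthonormal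 bases $(e_\alpha),(e_\beta),(e_\gamma)$ of $\mathfrak p_i,\mathfrak p_j,\mathfrak p_k$, and let $$A_1=b_1-\tfrac{[111]}{2d_1}-\tfrac{[122]}{d_1},\quad B_1=\tfrac{[112]}{d_1},\quad C_1=\tfrac{[122]}{2d_1},\qquad A_2=b_2-\tfrac{[222]}{2d_2}-\tfrac{[112]}{d_2},\quad B_2=\tfrac{[122]}{d_2},\quad C_2=\tfrac{[112]}{2d_2}.$$ Suppose that the cubic $-(B_2+C_1)y^3+A_2y^2-A_1y+B_1+C_2$ has a simple real root $y_1$ and a double real root $y_2\ne y_1$. Then invariant metrics with $y=y_1$ and with $y=y_2$ exist, and an invariant metric is Einstein if and only if $y\in\{y_1,y_2\}$. Moreover, let $g_0$ be an invariant metric with ratio $y(0)$, and consider the homogeneous Ricci flow $\partial_tg=-2\operatorname{Ric}(g)$ through invariant metrics with $g(0)=g_0$. 1. If $y(0)<\min(y_1,y_2)$, there is $0<T<\infty$ and a unique solution $g(t)$ on the maximal interval $[0,T)$; $T$ is a type I singularity ($|\mathrm{Rm}|$ is unbounded and $(T-t)|\mathrm{Rm}|$ is bounded on $[0,T)$), $G/K$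 shrinks to a point as $t\to T$ (that is, $g(t)\to0$), and $y(t)\to\min(y_1,y_2)$ as $t\to T$. There is no ancient solution, i.e. no solution on any interval $(-\infty,T')$, $T'>0$, with $g(0)=g_0$. 2. If $\min(y_1,y_2)<y(0)<\max(y_1,y_2)$, there is $0<T<\infty$ and a unique solution, whose maximal interval is $(-\infty,T)$; it is an ancient solution of type I ($\lim_{t\to-\infty}|t|\,|\mathrm{Rm}(g(t))|$ exists and is finite), $T$ is a type I singularity, $G/K$ shrinks to a point as $t\to T$, $y(t)\to y_2$ as $t\to-\infty$, and $y(t)\to y_1$ as $t\to T$. 3. If $y(0)>\max(y_1,y_2)$, the conclusions of 1 hold with $y(t)\to\max(y_1,y_2)$ as $t\to T$. -/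

import Mathlib

open Set Filter Topology
open scoped Manifold ContDiff

noncomputable section

namespace HRF

/-! ### Scalar products -/

/-- A scalar product (symmetric positive definite bilinear form) on a real vector space. -/
@[ext]
structure ScalarProduct (V : Type*) [AddCommGroup V] [Module ℝ V] where
  form : LinearMap.BilinForm ℝ V
  symm : ∀ X Y, form X Y = form Y X
  pos : ∀ X, X ≠ 0 → 0 < form X X

theorem ScalarProduct.nondegenerate {V : Type*} [AddCommGroup V] [Module ℝ V]
    (g : ScalarProduct V) : g.form.Nondegenerate := by
  refine ⟨fun X hX => ?_, fun X hX => ?_⟩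
  · by_contra h
    exact (g.pos X h).ne' (hX X)
  · by_contra h
    exact (g.pos X h).ne' (hX X)

/-! ### Curvature of an invariant metric on a homogeneous space

A homogeneous space `G / K` enters through a decomposition `𝔤 = 𝔨 ⊕ 𝔭`, where `𝔭` is identified
with the tangent space of `G / K` at the base point `eK`; a `G`-invariant Riemannian metric on
`G / K` is the same as an `Ad(K)`-invariant scalar product on `𝔭`. Its Levi-Civita connection and
its curvature tensor at `eK` are computed by the classical (Nomizu) formulas. -/

/-- A subalgebra `𝔨` of a Lie algebra `L` with a linear complement `𝔭`. -/
structure Decomposition (L : Type*) [LieRing L] [LieAlgebra ℝ L] where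
  k : LieSubalgebra ℝ L
  p : Submodule ℝ L
  isCompl : IsCompl k.toSubmodule p

section Curvature

variable {L : Type*} [LieRing L] [LieAlgebra ℝ L] (D : Decomposition L)

/-- The projection of `L = 𝔨 ⊕ 𝔭` onto `𝔭`, written `X ↦ X_𝔭`. -/
def projP : L →ₗ[ℝ] D.p := D.p.projectionOnto D.k.toSubmodule D.isCompl.symm

/-- The projection of `L = 𝔨 ⊕ 𝔭` onto `𝔨`, written `X ↦ X_𝔨`. -/
def projK : L →ₗ[ℝ] D.k.toSubmodule := D.k.toSubmodule.projectionOnto D.p D.isCompl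

/-- The operation `(X, Y) ↦ [X, Y]_𝔭` on `𝔭`. -/
def bracketP : D.p →ₗ[ℝ] D.p →ₗ[ℝ] D.p :=
  LinearMap.mk₂ ℝ (fun X Y => projP D ⁅(X : L), (Y : L)⁆)
    (by intros; simp) (by intros; simp) (by intros; simp) (by intros; simp)

/-- The isotropy action `Z ↦ [W, Z]` of `W ∈ 𝔨` on `𝔭`. (When `𝔭` is `ad(𝔨)`-invariant the
projection onto `𝔭` does nothing.) -/
def isotropyAction (W : L) : D.p →ₗ[ℝ] D.p :=
  projP D ∘ₗ (LieAlgebra.ad ℝ L W : L →ₗ[ℝ] L) ∘ₗ D.p.subtype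

variable [FiniteDimensional ℝ L]

/-- The right-hand side of the Koszul formula,
`Z ↦ ½ (g([X,Y]_𝔭, Z) + g([Z,X]_𝔭, Y) + g(X, [Z,Y]_𝔭))`. -/
def koszul (g : ScalarProduct D.p) (X Y : D.p) : Module.Dual ℝ D.p :=
  (1 / 2 : ℝ) • (g.form (bracketP D X Y) + (g.form Y) ∘ₗ (bracketP D).flip X
    + (g.form X) ∘ₗ (bracketP D).flip Y)

/-- The Levi-Civita connection of the invariant metric `g`, as its Nomizu map: `Λ(X)Y` is the
vector with `g(Λ(X)Y, Z) = ½ (g([X,Y]_𝔭, Z) + g([Z,X]_𝔭, Y) + g(X, [Z,Y]_𝔭))` for all `Z`.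
It is the unique bilinear map with each `Λ(X)` skew for `g` and
`Λ(X)Y - Λ(Y)X = [X, Y]_𝔭`. -/
def leviCivita (g : ScalarProduct D.p) : D.p →ₗ[ℝ] D.p →ₗ[ℝ] D.p :=
  LinearMap.mk₂ ℝ (fun X Y => (g.form.toDual g.nondegenerate).symm (koszul D g X Y))
    (by
      intro X X' Y
      rw [← map_add]; congr 1; ext Z
      simp [koszul]; ring)
    (by
      intro c X Y
      rw [← map_smul]; congr 1; ext Z
      simp [koszul]; ring)
    (by
      intro X Y Y'
      rw [← map_add]; congr 1; ext Z
      simp [koszul]; ring)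
    (by
      intro c X Y
      rw [← map_smul]; congr 1; ext Z
      simp [koszul]; ring)

/-- The curvature tensor of the invariant metric `g` at the base point:
`R(X, Y) = [Λ(X), Λ(Y)] - Λ([X, Y]_𝔭) - ad([X, Y]_𝔨)`. -/
def curvature (g : ScalarProduct D.p) (X Y : D.p) : D.p →ₗ[ℝ] D.p :=
  leviCivita D g X ∘ₗ leviCivita D g Y - leviCivita D g Y ∘ₗ leviCivita D g X
    - leviCivita D g (bracketP D X Y) - isotropyAction D (projK D ⁅(X : L), (Y : L)⁆ : L)

/-- The Ricci tensor `Ric(X, Y) = tr (Z ↦ R(Z, X) Y)`. -/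
def ricci (g : ScalarProduct D.p) (X Y : D.p) : ℝ :=
  LinearMap.trace ℝ D.p
    { toFun := fun Z => curvature D g Z X Y
      map_add' := by
        intro Z Z'
        simp [curvature, isotropyAction]; abel
      map_smul' := by
        intro c Z
        simp [curvature, isotropyAction, smul_sub] }

/-- The norm `|Rm(g)|_g` of the curvature tensor: `|Rm|² = R_{ijkl} R^{ijkl}`, computed with a basis
of `𝔭` and its `g`-dual basis (the value does not depend on the basis). By homogeneity it is the
same at every point of `G / K`. -/
def curvatureNorm (g : ScalarProduct D.p) : ℝ :=
  let b := Module.finBasis ℝ D.p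
  let b' := g.form.dualBasis g.nondegenerate b
  Real.sqrt (∑ i, ∑ j, ∑ k, ∑ l,
    g.form (curvature D g (b i) (b j) (b k)) (b l) *
      g.form (curvature D g (b' i) (b' j) (b' k)) (b' l))

end Curvature

/-! ### Lie groups -/

section LieGroup

variable {E : Type*} [NormedAddCommGroup E] [NormedSpace ℝ E] {H : Type*} [TopologicalSpace H]
  (I : ModelWithCorners ℝ E H) {G : Type*} [TopologicalSpace G] [ChartedSpace H G] [Group G]

instance instLieGroupMinSmoothness [LieGroup I ∞ G] : LieGroup I (minSmoothness ℝ 3) G := by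
  rw [minSmoothness_of_isRCLikeNormedField]
  infer_instance

instance instFiniteDimensionalGroupLieAlgebra [FiniteDimensional ℝ E] :
    FiniteDimensional ℝ (GroupLieAlgebra I G) :=
  inferInstanceAs (FiniteDimensional ℝ E)

/-- The adjoint action of `a : G` on the Lie algebra of `G`: the derivative at `1` of
`x ↦ a x a⁻¹`. -/
def Ad (a : G) : GroupLieAlgebra I G →L[ℝ] GroupLieAlgebra I G :=
  mfderiv I I (fun x : G => a * x * a⁻¹) 1

/-- `X` lies in the Lie algebra of the subgroup `K`: it is the velocity at `0` of a one-parameter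
subgroup of `G` contained in `K`. -/
def IsTangentTo (K : Subgroup G) (X : GroupLieAlgebra I G) : Prop :=
  ∃ γ : ℝ → G, (∀ s t, γ (s + t) = γ s * γ t) ∧ (∀ t, γ t ∈ K) ∧
    HasMFDerivAt 𝓘(ℝ, ℝ) I γ 0 (ContinuousLinearMap.toSpanSingleton ℝ (X : E))

/-- `W` is stable under the adjoint action of `K`. -/
def AdInvariant (K : Subgroup G) (W : Submodule ℝ (GroupLieAlgebra I G)) : Prop :=
  ∀ a ∈ K, ∀ X ∈ W, Ad I a X ∈ W

/-- `W` is an irreducible `Ad(K)`-invariant subspace. -/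
def AdIrreducible (K : Subgroup G) (W : Submodule ℝ (GroupLieAlgebra I G)) : Prop :=
  AdInvariant I K W ∧ W ≠ ⊥ ∧
    ∀ V : Submodule ℝ (GroupLieAlgebra I G), V ≤ W → AdInvariant I K V → V = ⊥ ∨ V = W

/-- `V` and `W` are equivalent as representations of `K`. -/
def AdEquivalent (K : Subgroup G) (V W : Submodule ℝ (GroupLieAlgebra I G)) : Prop :=
  ∃ φ : V ≃ₗ[ℝ] W, ∀ a ∈ K, ∀ X Y : V,
    (Y : GroupLieAlgebra I G) = Ad I a (X : GroupLieAlgebra I G) →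
      (φ Y : GroupLieAlgebra I G) = Ad I a (φ X : GroupLieAlgebra I G)

variable [LieGroup I ∞ G]

/-- `K` is maximal in `G`: there is no `Ad(K)`-invariant Lie subalgebra strictly between the Lie
algebra `𝔨` of `K` and the Lie algebra of `G`. -/
def IsMaximalIsotropy [CompleteSpace E] (K : Subgroup G)
    (𝔨 : LieSubalgebra ℝ (GroupLieAlgebra I G)) : Prop :=
  ∀ 𝔥 : LieSubalgebra ℝ (GroupLieAlgebra I G), 𝔨 ≤ 𝔥 → AdInvariant I K 𝔥.toSubmodule →
    𝔥 = 𝔨 ∨ 𝔥 = ⊤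

variable [CompleteSpace E] [FiniteDimensional ℝ E]

/-- `G`-invariant Riemannian metrics on `G / K`: scalar products `g` on `𝔭` with
`g(Ad(a)X, Ad(a)Y) = g(X, Y)` for `a ∈ K`. -/
@[ext]
structure InvariantMetric (K : Subgroup G) (D : Decomposition (GroupLieAlgebra I G)) extends
    ScalarProduct D.p where
  invariant : ∀ a ∈ K, ∀ X Y X' Y' : D.p,
    (X' : GroupLieAlgebra I G) = Ad I a (X : GroupLieAlgebra I G) →
    (Y' : GroupLieAlgebra I G) = Ad I a (Y : GroupLieAlgebra I G) → form X' Y' = form X Y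

variable {I} {K : Subgroup G} {D : Decomposition (GroupLieAlgebra I G)}

/-- `g` is an Einstein metric: `Ric(g) = c g` for a constant `c`. -/
def IsEinstein (g : InvariantMetric I K D) : Prop :=
  ∃ c : ℝ, ∀ X Y : D.p, ricci D g.toScalarProduct X Y = c * g.form X Y

/-- The family `g(t)` of invariant metrics solves the Ricci flow `∂g/∂t = -2 Ric(g)` for `t ∈ J`
(one-sided derivatives at end points of `J`). Values `g(t)` with `t ∉ J` play no role. -/
def IsHRFOn (J : Set ℝ) (g : ℝ → InvariantMetric I K D) : Prop :=
  ∀ t ∈ J, ∀ X Y : D.p,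
    HasDerivWithinAt (fun s => (g s).form X Y) (-2 * ricci D (g t).toScalarProduct X Y) J t

/-- `g` is the unique solution of the homogeneous Ricci flow with `g(0) = g₀`, and `[0, T)` is its
maximal (forward) interval of existence. -/
def IsMaximalHRF (g₀ : InvariantMetric I K D) (T : ℝ) (g : ℝ → InvariantMetric I K D) : Prop :=
  0 < T ∧ IsHRFOn (Ico 0 T) g ∧ g 0 = g₀ ∧
    ∀ (T' : ℝ) (h : ℝ → InvariantMetric I K D), IsHRFOn (Ico 0 T') h → h 0 = g₀ →
      T' ≤ T ∧ EqOn h g (Ico 0 T')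

/-- `g` is an ancient solution of the homogeneous Ricci flow with `g(0) = g₀`, defined on
`(-∞, T)`, where `T > 0`. -/
def IsAncientHRF (g₀ : InvariantMetric I K D) (T : ℝ) (g : ℝ → InvariantMetric I K D) : Prop :=
  0 < T ∧ IsHRFOn (Iio T) g ∧ g 0 = g₀

/-- `g` is the unique solution with `g(0) = g₀`, it is ancient, and `(-∞, T)` is its maximal
interval of existence: every solution through `g₀` on an interval `J` containing `0` is a
restriction of `g`. -/
def IsMaximalAncientHRF (g₀ : InvariantMetric I K D) (T : ℝ)
    (g : ℝ → InvariantMetric I K D) : Prop :=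
  IsAncientHRF g₀ T g ∧
    ∀ (J : Set ℝ) (h : ℝ → InvariantMetric I K D), J.OrdConnected → (0 : ℝ) ∈ J → IsHRFOn J h →
      h 0 = g₀ → J ⊆ Iio T ∧ EqOn h g J

/-- `T` is a type I singularity of `g(t)`, `t ∈ [0, T)`: `|Rm|` is unbounded and `(T - t) |Rm|` is
bounded on `[0, T)`. -/
def IsTypeISingularity (T : ℝ) (g : ℝ → InvariantMetric I K D) : Prop :=
  ¬ BddAbove ((fun t => curvatureNorm D (g t).toScalarProduct) '' Ico 0 T) ∧
    BddAbove ((fun t => (T - t) * curvatureNorm D (g t).toScalarProduct) '' Ico 0 T)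

/-- An ancient solution is of type I: `|t| |Rm(g(t))|` has a finite limit as `t → -∞`. -/
def IsTypeIAncient (g : ℝ → InvariantMetric I K D) : Prop :=
  ∃ ℓ : ℝ, Tendsto (fun t => |t| * curvatureNorm D (g t).toScalarProduct) atBot (𝓝 ℓ)

/-- The whole space shrinks to a point as `t → T`: the metrics `g(t)` tend to zero. -/
def ShrinksToPoint (T : ℝ) (g : ℝ → InvariantMetric I K D) : Prop :=
  ∀ X Y : D.p, Tendsto (fun t => (g t).form X Y) (𝓝[<] T) (𝓝 0)

/-- `g = x₁ Q|𝔭₁ ⊕ x₂ Q|𝔭₂` with `x₁, x₂ > 0` and `x₁ / x₂ = y`. -/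
def HasRatio (Q : ScalarProduct (GroupLieAlgebra I G)) (p₁ p₂ : Submodule ℝ (GroupLieAlgebra I G))
    (g : InvariantMetric I K D) (y : ℝ) : Prop :=
  ∃ x₁ x₂ : ℝ, 0 < x₁ ∧ 0 < x₂ ∧ y = x₁ / x₂ ∧
    ∀ X Y : D.p, ∀ X₁ ∈ p₁, ∀ Y₁ ∈ p₁, ∀ X₂ ∈ p₂, ∀ Y₂ ∈ p₂,
      (X : GroupLieAlgebra I G) = X₁ + X₂ → (Y : GroupLieAlgebra I G) = Y₁ + Y₂ →
        g.form X Y = x₁ * Q.form X₁ Y₁ + x₂ * Q.form X₂ Y₂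

/-- Along `g(t)`, `t ∈ J`, the ratio `y(t) = x₁(t) / x₂(t)` tends to `c` along the filter `l`. -/
def RatioTendsto (Q : ScalarProduct (GroupLieAlgebra I G))
    (p₁ p₂ : Submodule ℝ (GroupLieAlgebra I G)) (J : Set ℝ) (g : ℝ → InvariantMetric I K D)
    (l : Filter ℝ) (c : ℝ) : Prop :=
  ∃ y : ℝ → ℝ, (∀ t ∈ J, HasRatio Q p₁ p₂ (g t) (y t)) ∧ Tendsto y l (𝓝 c)

end LieGroup

/-! ### Structure constants -/

/-- `[ijk] = ∑ Q([e_α, e_β], e_γ)²` for bases `e`, `e'`, `e''` of `𝔭_i`, `𝔭_j`, `𝔭_k`. -/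
def structureConstant {L : Type*} [LieRing L] [LieAlgebra ℝ L] (Q : ScalarProduct L)
    {V V' V'' : Submodule ℝ L} {ι ι' ι'' : Type*} [Fintype ι] [Fintype ι'] [Fintype ι'']
    (e : Module.Basis ι ℝ V) (e' : Module.Basis ι' ℝ V') (e'' : Module.Basis ι'' ℝ V'') : ℝ :=
  ∑ α, ∑ β, ∑ γ, Q.form ⁅(e α : L), (e' β : L)⁆ (e'' γ : L) ^ 2

/-- A basis of a subspace that is orthonormal for `Q`. -/
def IsOrthonormalBasis {L : Type*} [AddCommGroup L] [Module ℝ L] (Q : ScalarProduct L)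
    {V : Submodule ℝ L} {ι : Type*} [DecidableEq ι] (e : Module.Basis ι ℝ V) : Prop :=
  ∀ i j, Q.form (e i : L) (e j : L) = if i = j then 1 else 0

/-- The cubic `-(B₂ + C₁) y³ + A₂ y² - A₁ y + B₁ + C₂`, where, in terms of the dimensions `dᵢ`, the
constants `bᵢ` and the structure constants `cᵢⱼₖ = [ijk]`,
`A₁ = b₁ - [111]/(2d₁) - [122]/d₁`, `B₁ = [112]/d₁`, `C₁ = [122]/(2d₁)`,
`A₂ = b₂ - [222]/(2d₂) - [112]/d₂`, `B₂ = [122]/d₂`, `C₂ = [112]/(2d₂)`. -/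
def einsteinCubic (d₁ d₂ b₁ b₂ c₁₁₁ c₁₁₂ c₁₂₂ c₂₂₂ : ℝ) : Polynomial ℝ :=
  let A₁ := b₁ - c₁₁₁ / (2 * d₁) - c₁₂₂ / d₁
  let B₁ := c₁₁₂ / d₁
  let C₁ := c₁₂₂ / (2 * d₁)
  let A₂ := b₂ - c₂₂₂ / (2 * d₂) - c₁₁₂ / d₂
  let B₂ := c₁₂₂ / d₂
  let C₂ := c₁₁₂ / (2 * d₂)
  Polynomial.C (-(B₂ + C₁)) * Polynomial.X ^ 3 + Polynomial.C A₂ * Polynomial.X ^ 2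
    - Polynomial.C A₁ * Polynomial.X + Polynomial.C (B₁ + C₂)

end HRF

end

open HRF

/-! By Schur's lemma an invariant metric is a pair `(x₁, x₂)` of positive numbers. The Nomizu
formulas in a `Q`-orthonormal basis, with the Killing form used to eliminate the contribution of 𝔨,
show that its Ricci tensor is diagonal with entries depending only on `y = x₁ / x₂`
(`TwoSummands.ricci_weights`). So the Ricci flow is the planar system x₁' = -f₁(y), x₂' = -f₂(1/y),
where f₁(y) = A₁ - B₁/y + C₁y² and f₂(z) = A₂ - B₂/z + C₂z². The ratio satisfies y' = q(y)/x₂ with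
q(y) = y f₂(1/y) - f₁(y), and y q(y) is exactly the given cubic, that is a(y₁ - y)(y - y₂)² with a =
B₂ + C₁. Einstein metrics are the zeros of q, and the sign of q gives the direction in which y
moves.

Maximality of K forces [112] > 0, since otherwise 𝔨 ⊕ 𝔭₁ would be an intermediate subalgebra. Having
three roots forces a ≠ 0, hence [122] > 0. The Killing identity gives A₁ ≥ 2B₁ and A₂ ≥ 2B₂, so the
cubic is positive on y ≤ 0, its roots are positive, and both speeds f₁(y), f₂(1/y) are positive at
the roots (`exists_doubleRootFlow`).

Where q > 0 the trajectory is found by taking y as the parameter: d log x₂/dy = -f₂(1/y)/q and dt/dy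
= x₂/q. Inverting t(y) gives a solution whose ratio sweeps out a whole interval (lo, r)
(`IsRatioFlow.exists_of_ratioField_pos`). As f₂ is increasing and y < r, x₂ decreases at rate at
least f₂(1/r) > 0, so the final time T is finite and x₂ ≥ f₂(1/r)(T - t). Since q vanishes at least
linearly at r, comparing log x₂ with log(r - y) gives x₂ → 0. The curvature norm is 1/x₂ times a
continuous function of y, positive at the root, so the singularity is of type I.

If lo is also a zero of q, the same comparison at lo makes x₂ unbounded as y → lo; its speed being
bounded, this takes infinite backward time (`IsSweep.not_bddBelow`). The solution is then ancient,
with x₂/|t| → f₂(1/lo). If instead y₀ lies below both roots, backward in time y decreases, x₁ grows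
at most linearly, and |y'| = y q(y)/x₁ has divergent integral, so y would become negative in finite
time (`IsRatioFlow.not_ancient`). The remaining cases follow by exchanging the summands, which
replaces y by 1/y (`DoubleRootFlow.swap`). Uniqueness is that of a C¹ planar field.

On the group side one needs that `Ad` preserves brackets and that its derivative is `ad`. The latter
turns `Ad`-invariance of `Q` into `ad`-invariance, and invariance under K into invariance under 𝔨.
-/

open HRF

noncomputable section

namespace HRF

/-! ### The adjoint representation by Lie algebra automorphisms -/

section Adjoint

variable {E : Type*} [NormedAddCommGroup E] [NormedSpace ℝ E] {H : Type*} [TopologicalSpace H]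
  {I : ModelWithCorners ℝ E H} {G : Type*} [TopologicalSpace G] [ChartedSpace H G] [Group G]

-- The derivative is typed as an endomorphism of the model space, so that it can be moved between
-- base points that are only propositionally equal.
omit [Group G] in
theorem hasMFDerivAt_of_eq {f : G → G} {x y : G} (h : x = y) {L : E →L[ℝ] E}
    (hf : HasMFDerivAt I I f x L) : HasMFDerivAt I I f y L := by
  subst h; exact hf

variable [LieGroup I ∞ G]

theorem contMDiff_conj (a : G) : ContMDiff I I ∞ (fun x : G => a * x * a⁻¹) :=
  (contMDiff_const.mul contMDiff_id).mul contMDiff_const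

theorem hasMFDerivAt_conj (a : G) :
    HasMFDerivAt I I (fun x : G => a * x * a⁻¹) (1 : G) (Ad I a : E →L[ℝ] E) :=
  ((contMDiff_conj (I := I) a).mdifferentiable (by simp) 1).hasMFDerivAt

theorem Ad_mul (a b : G) (X : GroupLieAlgebra I G) : Ad I (a * b) X = Ad I a (Ad I b X) := by
  have h1 : HasMFDerivAt I I (fun x : G => a * x * a⁻¹) ((fun x : G => b * x * b⁻¹) 1)
      (Ad I a : E →L[ℝ] E) := hasMFDerivAt_of_eq (by simp) (hasMFDerivAt_conj a)
  have h2 := HasMFDerivAt.comp (1 : G) h1 (hasMFDerivAt_conj (I := I) b)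
  have h3 : (fun x : G => a * x * a⁻¹) ∘ (fun x : G => b * x * b⁻¹)
      = fun x => (a * b) * x * (a * b)⁻¹ := by
    ext x; simp [mul_assoc]
  rw [h3] at h2
  have h4 : (Ad I (a * b) : E →L[ℝ] E) = (Ad I a : E →L[ℝ] E).comp (Ad I b : E →L[ℝ] E) :=
    hasMFDerivAt_unique (hasMFDerivAt_conj (a * b)) h2
  exact congrArg (fun L : E →L[ℝ] E => L X) h4

theorem Ad_one (X : GroupLieAlgebra I G) : Ad I (1 : G) X = X := by
  have h : HasMFDerivAt I I (fun x : G => (1 : G) * x * (1 : G)⁻¹) (1 : G)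
      (ContinuousLinearMap.id ℝ E) := by
    have : (fun x : G => (1 : G) * x * (1 : G)⁻¹) = id := by ext x; simp
    rw [this]; exact hasMFDerivAt_id _
  exact congrArg (fun L : E →L[ℝ] E => L X) (hasMFDerivAt_unique (hasMFDerivAt_conj (1 : G)) h)

theorem Ad_Ad_inv (a : G) (X : GroupLieAlgebra I G) : Ad I a (Ad I a⁻¹ X) = X := by
  rw [← Ad_mul, mul_inv_cancel, Ad_one]

/-- Left-invariant vector fields are related by conjugation. -/
theorem mfderiv_conj_mulInvariantVectorField (a g : G) (X : GroupLieAlgebra I G) :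
    (mfderiv I I (fun x : G => a * x * a⁻¹) g (mulInvariantVectorField X g : E) : E)
      = (mulInvariantVectorField (Ad I a X) (a * g * a⁻¹) : E) := by
  have hL : ∀ g : G, ContMDiff I I ∞ (fun x : G => g * x) := fun g =>
    contMDiff_const.mul contMDiff_id
  have hD : ∀ g h : G, HasMFDerivAt I I (fun x : G => g * x) h
      (mfderiv I I (fun x : G => g * x) h) := fun g h =>
    ((hL g).mdifferentiable (by simp) h).hasMFDerivAt
  have h1 : HasMFDerivAt I I (fun x : G => a * x * a⁻¹) ((fun x : G => g * x) 1)
      (mfderiv I I (fun x : G => a * x * a⁻¹) g : E →L[ℝ] E) :=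
    hasMFDerivAt_of_eq (x := g) (by simp)
      ((contMDiff_conj (I := I) a).mdifferentiable (by simp) g).hasMFDerivAt
  have h2 := HasMFDerivAt.comp (1 : G) h1 (hD g 1)
  have h3 : HasMFDerivAt I I (fun x : G => (a * g * a⁻¹) * x) ((fun x : G => a * x * a⁻¹) 1)
      (mfderiv I I (fun x : G => (a * g * a⁻¹) * x) 1 : E →L[ℝ] E) :=
    hasMFDerivAt_of_eq (x := 1) (by simp) (hD (a * g * a⁻¹) 1)
  have h4 := HasMFDerivAt.comp (1 : G) h3 (hasMFDerivAt_conj (I := I) a)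
  have h5 : (fun x : G => a * x * a⁻¹) ∘ (fun x : G => g * x)
      = (fun x : G => (a * g * a⁻¹) * x) ∘ (fun x : G => a * x * a⁻¹) := by
    ext x; simp [mul_assoc]
  rw [h5] at h2
  exact congrArg (fun L : E →L[ℝ] E => L X) (hasMFDerivAt_unique h2 h4)

variable [CompleteSpace E]

theorem mulInvariantVectorField_one (X : GroupLieAlgebra I G) :
    mulInvariantVectorField X (1 : G) = X := by
  have : (fun x : G => 1 * x) = id := by ext x; simp
  simp only [mulInvariantVectorField]
  rw [this, mfderiv_id]
  rfl

theorem mfderiv_conj_invertible (a g : G) :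
    (mfderiv I I (fun x : G => a * x * a⁻¹) g).IsInvertible := by
  have hc : ∀ a g : G, HasMFDerivAt I I (fun x : G => a * x * a⁻¹) g
      (mfderiv I I (fun x : G => a * x * a⁻¹) g) := fun a g =>
    ((contMDiff_conj (I := I) a).mdifferentiable (by simp) g).hasMFDerivAt
  have key : ∀ a g : G, (mfderiv I I (fun x : G => a * x * a⁻¹) (a⁻¹ * g * a) : E →L[ℝ] E).comp
      (mfderiv I I (fun x : G => a⁻¹ * x * a⁻¹⁻¹) g : E →L[ℝ] E) = ContinuousLinearMap.id ℝ E := by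
    intro a g
    have h1 : HasMFDerivAt I I (fun x : G => a * x * a⁻¹) ((fun x : G => a⁻¹ * x * a⁻¹⁻¹) g)
      (mfderiv I I (fun x : G => a * x * a⁻¹) (a⁻¹ * g * a) : E →L[ℝ] E) :=
        hasMFDerivAt_of_eq (x := a⁻¹ * g * a) (by simp) (hc a _)
    have h2 := HasMFDerivAt.comp g h1 (hc a⁻¹ g)
    have h3 : (fun x : G => a * x * a⁻¹) ∘ (fun x : G => a⁻¹ * x * a⁻¹⁻¹) = id := by
      ext x; simp [mul_assoc]
    rw [h3] at h2
    exact hasMFDerivAt_unique h2 (hasMFDerivAt_id g)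
  have k1 := key a (a * g * a⁻¹)
  have k2 := key a⁻¹ g
  rw [inv_inv] at k2
  have e1 : a⁻¹ * (a * g * a⁻¹) * a = g := by group
  rw [e1, inv_inv] at k1
  exact ContinuousLinearMap.IsInvertible.of_inverse k1 k2

/-- Conjugation is a diffeomorphism relating the left-invariant fields of `X` and `Ad a X`;
invertibility of its derivative turns this relation into a pullback identity. -/
theorem mpullback_conj (a : G) (X : GroupLieAlgebra I G) :
    VectorField.mpullback I I (fun x : G => a * x * a⁻¹) (mulInvariantVectorField (Ad I a X))
      = mulInvariantVectorField X := by
  ext g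
  rw [VectorField.mpullback_apply]
  have h := mfderiv_conj_mulInvariantVectorField (I := I) a g X
  have hi := mfderiv_conj_invertible (I := I) a g
  have h' := congrArg (fun v : E => ((mfderiv I I (fun x : G => a * x * a⁻¹) g).inverse v : E)) h
  refine Eq.trans h'.symm ?_
  exact hi.inverse_apply_self _

/-- Pullback by a diffeomorphism commutes with the bracket of vector fields. Apply this to
conjugation and left-invariant fields, and evaluate at the identity. -/
theorem Ad_lie (a : G) (X Y : GroupLieAlgebra I G) : Ad I a ⁅X, Y⁆ = ⁅Ad I a X, Ad I a Y⁆ := by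
  have h := VectorField.mpullback_mlieBracket (I := I) (I' := I) (n := minSmoothness ℝ 3)
    (f := fun x : G => a * x * a⁻¹) (x₀ := 1)
    (V := mulInvariantVectorField (Ad I a X)) (W := mulInvariantVectorField (Ad I a Y))
    (mdifferentiableAt_mulInvariantVectorField _) (mdifferentiableAt_mulInvariantVectorField _)
    ((contMDiff_conj (I := I) a).contMDiffAt.of_le (by rw [minSmoothness_of_isRCLikeNormedField]; exact WithTop.coe_le_coe.2 le_top))
    (minSmoothness_monotone (by norm_cast))
  -- The bracket of the images is rewritten as `Ad a` of `Ad a⁻¹` of itself, so that the pullback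
  -- formula applies to its left-invariant field as well.
  rw [mpullback_conj, mpullback_conj, ← mulInvariantVector_mlieBracket,
    ← GroupLieAlgebra.bracket_def, ← Ad_Ad_inv a ⁅Ad I a X, Ad I a Y⁆, mpullback_conj,
    ← GroupLieAlgebra.bracket_def, mulInvariantVectorField_one] at h
  rw [← h, Ad_Ad_inv]


/-- The Lie bracket of the Lie algebra of `G`, on the model space. -/
def lieE (I : ModelWithCorners ℝ E H) (G : Type*) [TopologicalSpace G] [ChartedSpace H G]
    [Group G] [LieGroup I ∞ G] (v w : E) : E :=
  Bracket.bracket (L := GroupLieAlgebra I G) (M := GroupLieAlgebra I G) v w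

/-- The adjoint action, on the model space. -/
def AdE (I : ModelWithCorners ℝ E H) (a : G) : E →L[ℝ] E := Ad I a

/-! ### Multiplication in a chart μ at the identity e: the derivative of `Ad` is `ad` -/

section Chart

/-- The group multiplication in the preferred chart at the identity. -/
def chartMul (I : ModelWithCorners ℝ E H) (G : Type*) [TopologicalSpace G] [ChartedSpace H G]
    [Group G] (z : E × E) : E :=
  extChartAt I (1 : G) ((extChartAt I (1 : G)).symm z.1 * (extChartAt I (1 : G)).symm z.2)

variable [I.Boundaryless]

theorem contDiffAt_chartMul :
    ContDiffAt ℝ ∞ (chartMul I G) (extChartAt I (1 : G) 1, extChartAt I (1 : G) 1) := by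
  rw [← contMDiffAt_iff_contDiffAt]
  have hs : ContMDiffAt 𝓘(ℝ, E) I ∞ (extChartAt I (1 : G)).symm (extChartAt I (1 : G) 1) :=
    (contMDiffOn_extChartAt_symm (n := ∞) (1 : G)).contMDiffAt (extChartAt_target_mem_nhds 1)
  have h1 : ContMDiffAt 𝓘(ℝ, E × E) I ∞ (fun z : E × E => (extChartAt I (1 : G)).symm z.1)
      (extChartAt I (1 : G) 1, extChartAt I (1 : G) 1) :=
    ContMDiffAt.comp (I' := 𝓘(ℝ, E)) _ hs contDiff_fst.contMDiff.contMDiffAt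
  have h2 : ContMDiffAt 𝓘(ℝ, E × E) I ∞ (fun z : E × E => (extChartAt I (1 : G)).symm z.2)
      (extChartAt I (1 : G) 1, extChartAt I (1 : G) 1) :=
    ContMDiffAt.comp (I' := 𝓘(ℝ, E)) _ hs contDiff_snd.contMDiff.contMDiffAt
  have h3 := h1.mul h2
  have h4 : ContMDiffAt I 𝓘(ℝ, E) ∞ (extChartAt I (1 : G))
      ((extChartAt I (1 : G)).symm (extChartAt I (1 : G) 1) *
        (extChartAt I (1 : G)).symm (extChartAt I (1 : G) 1)) := by
    have : (extChartAt I (1 : G)).symm (extChartAt I (1 : G) 1) *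
        (extChartAt I (1 : G)).symm (extChartAt I (1 : G) 1) = 1 := by simp
    rw [this]
    exact contMDiffAt_extChartAt
  exact ContMDiffAt.comp (I' := I) _ h4 h3

theorem eventually_differentiableAt_chartMul :
    ∀ᶠ z in 𝓝 (extChartAt I (1 : G) 1, extChartAt I (1 : G) 1),
      DifferentiableAt ℝ (chartMul I G) z := by
  have h := (contDiffAt_chartMul (I := I) (G := G)).of_le (m := 1) (by exact WithTop.coe_le_coe.2 le_top)
  filter_upwards [h.eventually (by simp)] with z hz using hz.differentiableAt (by simp)

omit [CompleteSpace E] in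
theorem hasFDerivAt_of_hasFDerivWithinAt_range {f : E → E} {L : E →L[ℝ] E} {x : E}
    (h : HasFDerivWithinAt f L (range I) x) : HasFDerivAt f L x := by
  rwa [ModelWithCorners.range_eq_univ, hasFDerivWithinAt_univ] at h

theorem hasFDerivAt_writtenInChart {f : G → G} (hf1 : f 1 = 1) {L : E →L[ℝ] E}
    (hf : HasMFDerivAt I I f (1 : G) L) :
    HasFDerivAt (fun y => extChartAt I (1 : G) (f ((extChartAt I (1 : G)).symm y))) L
      (extChartAt I (1 : G) 1) := by
  have h : HasFDerivAt (writtenInExtChartAt I I 1 f) L (extChartAt I (1 : G) 1) :=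
    hasFDerivAt_of_hasFDerivWithinAt_range hf.2
  have h' : writtenInExtChartAt I I 1 f
      = fun y => extChartAt I (1 : G) (f ((extChartAt I (1 : G)).symm y)) := by
    ext y; simp [writtenInExtChartAt, hf1]
  rwa [h'] at h

/-- Differentiate (a y a⁻¹) a = a y in y at the identity, where a is the point with coordinate x:
∂₁μ(e, x) Ad(x)w = ∂₂μ(x, e)w. This determines `Ad` near e from the partial derivatives of μ. -/
theorem fderiv_chartMul_Ad (w : E) :
    ∀ᶠ x in 𝓝 (extChartAt I (1 : G) 1),
      fderiv ℝ (chartMul I G) (extChartAt I (1 : G) 1, x)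
          (AdE I ((extChartAt I (1 : G)).symm x) w, 0)
        = fderiv ℝ (chartMul I G) (x, extChartAt I (1 : G) 1) (0, w) := by
  have hd := eventually_differentiableAt_chartMul (I := I) (G := G)
  have h1 := (Continuous.prodMk_left (extChartAt I (1 : G) 1)).tendsto (extChartAt I (1 : G) 1) |>.eventually hd
  have h2 := (Continuous.prodMk_right (extChartAt I (1 : G) 1)).tendsto (extChartAt I (1 : G) 1) |>.eventually hd
  filter_upwards [h1, h2] with x hx1 hx2
  set e := extChartAt I (1 : G) 1 with he
  set a := (extChartAt I (1 : G)).symm x with ha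
  obtain ⟨A, hAw, hc⟩ : ∃ A : E →L[ℝ] E, (Ad I a : E →L[ℝ] E) w = A w ∧
      HasFDerivAt (fun y => extChartAt I (1 : G) (a * (extChartAt I (1 : G)).symm y * a⁻¹)) A e :=
    ⟨_, rfl, hasFDerivAt_writtenInChart (I := I) (f := fun x : G => a * x * a⁻¹) (by simp)
    (hasMFDerivAt_conj a)⟩
  refine (congrArg (fun u : E => fderiv ℝ (chartMul I G) (e, x) (u, 0)) hAw).trans ?_
  have hc1 : extChartAt I (1 : G) (a * (extChartAt I (1 : G)).symm e * a⁻¹) = e := by simp [he]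
  have hA : HasFDerivAt (fun y => chartMul I G
      (extChartAt I (1 : G) (a * (extChartAt I (1 : G)).symm y * a⁻¹), x))
      ((fderiv ℝ (chartMul I G) (e, x)).comp (A.prod 0)) e := by
    refine HasFDerivAt.comp e (g := chartMul I G) ?_ (hc.prodMk (hasFDerivAt_const x e))
    rw [hc1]; exact hx2.hasFDerivAt
  have hB : HasFDerivAt (fun y => chartMul I G (x, y))
      ((fderiv ℝ (chartMul I G) (x, e)).comp ((0 : E →L[ℝ] E).prod (ContinuousLinearMap.id ℝ E))) e :=
    HasFDerivAt.comp e (g := chartMul I G) hx1.hasFDerivAt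
      ((hasFDerivAt_const x e).prodMk (hasFDerivAt_id e))
  have hEq : (fun y => chartMul I G
      (extChartAt I (1 : G) (a * (extChartAt I (1 : G)).symm y * a⁻¹), x))
      =ᶠ[𝓝 e] fun y => chartMul I G (x, y) := by
    have hcont : ContinuousAt (fun y => a * (extChartAt I (1 : G)).symm y * a⁻¹) e := by
      have : ContinuousAt (extChartAt I (1 : G)).symm e := continuousAt_extChartAt_symm _
      have hg : Continuous (fun g : G => a * g * a⁻¹) := (contMDiff_conj (I := I) a).continuous
      exact hg.continuousAt.comp this
    have hmem : ∀ᶠ y in 𝓝 e, a * (extChartAt I (1 : G)).symm y * a⁻¹ ∈ (extChartAt I (1 : G)).source := by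
      apply hcont
      apply extChartAt_source_mem_nhds'
      simp [he]
    filter_upwards [hmem] with y hy
    simp only [chartMul]
    rw [(extChartAt I (1 : G)).left_inv hy, ← ha]
    simp
  have := (hA.congr_of_eventuallyEq hEq.symm).unique hB
  simpa using congrArg (fun L : E →L[ℝ] E => L w) this

/-- In the chart, the left-invariant field of v is x ↦ ∂₂μ(x, e)v, by the chain rule for left
translation. -/
theorem mpullbackWithin_mulInvariantVectorField (v : E) :
    ∀ᶠ x in 𝓝 (extChartAt I (1 : G) 1),
      (VectorField.mpullbackWithin 𝓘(ℝ, E) I (extChartAt I (1 : G)).symm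
        (mulInvariantVectorField (G := G) (I := I) v) (range I) x : E)
        = fderiv ℝ (chartMul I G) (x, extChartAt I (1 : G) 1) (0, v) := by
  have hd := eventually_differentiableAt_chartMul (I := I) (G := G)
  have h1 := (Continuous.prodMk_left (extChartAt I (1 : G) 1)).tendsto (extChartAt I (1 : G) 1) |>.eventually hd
  filter_upwards [h1, extChartAt_target_mem_nhds (I := I) (1 : G)] with x hx1 hx2
  set e := extChartAt I (1 : G) 1 with he
  set a := (extChartAt I (1 : G)).symm x with ha
  have hsrc : a ∈ (extChartAt I (1 : G)).source := (extChartAt I (1 : G)).map_target hx2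
  have hB : HasFDerivAt (fun y => chartMul I G (x, y))
      ((fderiv ℝ (chartMul I G) (x, e)).comp ((0 : E →L[ℝ] E).prod (ContinuousLinearMap.id ℝ E))) e :=
    HasFDerivAt.comp e (g := chartMul I G) hx1.hasFDerivAt
      ((hasFDerivAt_const x e).prodMk (hasFDerivAt_id e))
  have hL : HasMFDerivAt I I (fun y : G => a * y) 1 (mfderiv I I (fun y : G => a * y) 1) :=
    ((contMDiff_const.mul contMDiff_id : ContMDiff I I ∞ (fun y : G => a * y)).mdifferentiable
      (by simp) 1).hasMFDerivAt
  have hφ : HasMFDerivAt I 𝓘(ℝ, E) (extChartAt I (1 : G)) a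
      (mfderiv I 𝓘(ℝ, E) (extChartAt I (1 : G)) a) :=
    (mdifferentiableAt_extChartAt (by simpa using hsrc)).hasMFDerivAt
  have hφ' : HasMFDerivAt I 𝓘(ℝ, E) (extChartAt I (1 : G)) (a * 1)
      (mfderiv I 𝓘(ℝ, E) (extChartAt I (1 : G)) a : E →L[ℝ] E) := by
    rw [mul_one]; exact hφ
  have hcomp := HasMFDerivAt.comp (1 : G) hφ' hL
  obtain ⟨A, hAw, hA⟩ : ∃ A : E →L[ℝ] E, ((mfderiv I 𝓘(ℝ, E) (extChartAt I (1 : G)) a : E →L[ℝ] E)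
        (mulInvariantVectorField (G := G) (I := I) v a : E)) = A v ∧
      HasFDerivAt (fun y => chartMul I G (x, y)) A e :=
    ⟨_, rfl, hasFDerivAt_of_hasFDerivWithinAt_range hcomp.2⟩
  have hinv : (mfderivWithin 𝓘(ℝ, E) I (extChartAt I (1 : G)).symm (range I) x).inverse
      = (mfderiv I 𝓘(ℝ, E) (extChartAt I (1 : G)) a : E →L[ℝ] E) := by
    refine ContinuousLinearMap.inverse_eq ?_ ?_
    · exact mfderivWithin_extChartAt_symm_comp_mfderiv_extChartAt hx2
    · exact mfderiv_extChartAt_comp_mfderivWithin_extChartAt_symm hx2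
  have h' := congrArg (fun L : E →L[ℝ] E => L (mulInvariantVectorField (G := G) (I := I) v a : E)) hinv
  refine Eq.trans h' (Eq.trans hAw ?_)
  rw [hA.unique hB]
  rfl

theorem fderiv_chartMul_inl (u : E) :
    fderiv ℝ (chartMul I G) (extChartAt I (1 : G) 1, extChartAt I (1 : G) 1) (u, 0) = u := by
  set e := extChartAt I (1 : G) 1 with he
  have hd : DifferentiableAt ℝ (chartMul I G) (e, e) :=
    (contDiffAt_chartMul (I := I) (G := G)).differentiableAt (by simp)
  have hB : HasFDerivAt (fun y => chartMul I G (y, e))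
      ((fderiv ℝ (chartMul I G) (e, e)).comp ((ContinuousLinearMap.id ℝ E).prod (0 : E →L[ℝ] E))) e :=
    HasFDerivAt.comp e (g := chartMul I G) hd.hasFDerivAt
      ((hasFDerivAt_id e).prodMk (hasFDerivAt_const e e))
  have hA : (fun y => chartMul I G (y, e)) =ᶠ[𝓝 e] id := by
    filter_upwards [extChartAt_target_mem_nhds (I := I) (1 : G)] with y hy
    have h1 : (extChartAt I (1 : G)).symm e = 1 := extChartAt_to_inv (1 : G)
    simp only [chartMul, h1, mul_one, id]
    exact (extChartAt I (1 : G)).right_inv hy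
  have := ((hasFDerivAt_id e).congr_of_eventuallyEq hA).unique hB
  exact (congrArg (fun L : E →L[ℝ] E => L u) this).symm

theorem fderiv_chartMul_inr (u : E) :
    fderiv ℝ (chartMul I G) (extChartAt I (1 : G) 1, extChartAt I (1 : G) 1) (0, u) = u := by
  set e := extChartAt I (1 : G) 1 with he
  have hd : DifferentiableAt ℝ (chartMul I G) (e, e) :=
    (contDiffAt_chartMul (I := I) (G := G)).differentiableAt (by simp)
  have hB : HasFDerivAt (fun y => chartMul I G (e, y))
      ((fderiv ℝ (chartMul I G) (e, e)).comp ((0 : E →L[ℝ] E).prod (ContinuousLinearMap.id ℝ E))) e :=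
    HasFDerivAt.comp e (g := chartMul I G) hd.hasFDerivAt
      ((hasFDerivAt_const e e).prodMk (hasFDerivAt_id e))
  have hA : (fun y => chartMul I G (e, y)) =ᶠ[𝓝 e] id := by
    filter_upwards [extChartAt_target_mem_nhds (I := I) (1 : G)] with y hy
    have h1 : (extChartAt I (1 : G)).symm e = 1 := extChartAt_to_inv (1 : G)
    simp only [chartMul, h1, one_mul, id]
    exact (extChartAt I (1 : G)).right_inv hy
  have := ((hasFDerivAt_id e).congr_of_eventuallyEq hA).unique hB
  exact (congrArg (fun L : E →L[ℝ] E => L u) this).symm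

theorem hasFDerivAt_fderiv_chartMul :
    HasFDerivAt (fderiv ℝ (chartMul I G))
      (fderiv ℝ (fderiv ℝ (chartMul I G)) (extChartAt I (1 : G) 1, extChartAt I (1 : G) 1))
      (extChartAt I (1 : G) 1, extChartAt I (1 : G) 1) := by
  have h := (contDiffAt_chartMul (I := I) (G := G)).fderiv_right (m := 1)
    (by exact WithTop.coe_le_coe.2 le_top)
  exact (h.differentiableAt (by simp)).hasFDerivAt

theorem hasFDerivAt_fderiv_chartMul_left (u : E × E) :
    HasFDerivAt (fun x => fderiv ℝ (chartMul I G) (x, extChartAt I (1 : G) 1) u)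
      (((fderiv ℝ (fderiv ℝ (chartMul I G))
        (extChartAt I (1 : G) 1, extChartAt I (1 : G) 1)).flip u).comp (.inl ℝ E E))
      (extChartAt I (1 : G) 1) := by
  have h := hasFDerivAt_fderiv_chartMul (I := I) (G := G)
  have h1 := HasFDerivAt.comp (f := fun x => (x, extChartAt I (1 : G) 1))
    (extChartAt I (1 : G) 1) h
    (hasFDerivAt_prodMk_left (𝕜 := ℝ) (extChartAt I (1 : G) 1) (extChartAt I (1 : G) 1))
  exact h1.clm_apply (hasFDerivAt_const u _) |>.congr_fderiv (by ext v; simp)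

/-- The bracket is that of the fields x ↦ ∂₂μ(x, e)v and x ↦ ∂₂μ(x, e)w at e, where their values are
v and w; what remains is the mixed second derivative of μ, skew-symmetrized. -/
theorem lie_eq_fderiv_chartMul (v w : E) :
    lieE I G v w
      = fderiv ℝ (fderiv ℝ (chartMul I G)) (extChartAt I (1 : G) 1, extChartAt I (1 : G) 1)
          (v, 0) (0, w)
        - fderiv ℝ (fderiv ℝ (chartMul I G)) (extChartAt I (1 : G) 1, extChartAt I (1 : G) 1)
          (w, 0) (0, v) := by
  set e := extChartAt I (1 : G) 1 with he
  have key : ∀ u : E, HasFDerivAt (VectorField.mpullbackWithin 𝓘(ℝ, E) I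
      (extChartAt I (1 : G)).symm (mulInvariantVectorField (G := G) (I := I) u) (range I) : E → E)
      (((fderiv ℝ (fderiv ℝ (chartMul I G)) (e, e)).flip (0, u)).comp (.inl ℝ E E)) e := fun u =>
    (hasFDerivAt_fderiv_chartMul_left (I := I) (G := G) (0, u)).congr_of_eventuallyEq
      (mpullbackWithin_mulInvariantVectorField u)
  have hval : ∀ u : E, VectorField.mpullbackWithin 𝓘(ℝ, E) I
      (extChartAt I (1 : G)).symm (mulInvariantVectorField (G := G) (I := I) u) (range I) e = u :=
    fun u => (mpullbackWithin_mulInvariantVectorField (G := G) u).self_of_nhds.trans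
      (fderiv_chartMul_inr u)
  have h1 : lieE I G v w = VectorField.lieBracketWithin ℝ
      (VectorField.mpullbackWithin 𝓘(ℝ, E) I (extChartAt I (1 : G)).symm
        (mulInvariantVectorField (G := G) (I := I) v) (range I))
      (VectorField.mpullbackWithin 𝓘(ℝ, E) I (extChartAt I (1 : G)).symm
        (mulInvariantVectorField (G := G) (I := I) w) (range I))
      ((extChartAt I (1 : G)).symm ⁻¹' univ ∩ range I) e := by
    have h2 : (mfderiv I 𝓘(ℝ, E) (extChartAt I (1 : G)) 1).inverse = ContinuousLinearMap.id ℝ E := by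
      rw [mfderiv_extChartAt_self]
      exact ContinuousLinearMap.inverse_id
    exact congrArg (fun L : E →L[ℝ] E => L _) h2
  obtain ⟨Vf, hd, hv, h3⟩ : ∃ Vf : E → E → E, (∀ u, HasFDerivAt (Vf u)
      (((fderiv ℝ (fderiv ℝ (chartMul I G)) (e, e)).flip (0, u)).comp (.inl ℝ E E)) e) ∧
      (∀ u, Vf u e = u) ∧ lieE I G v w = VectorField.lieBracketWithin ℝ (Vf v) (Vf w)
        ((extChartAt I (1 : G)).symm ⁻¹' univ ∩ range I) e := ⟨_, key, hval, h1⟩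
  rw [h3, preimage_univ, ModelWithCorners.range_eq_univ, univ_inter,
    VectorField.lieBracketWithin_univ, VectorField.lieBracket, (hd v).fderiv, (hd w).fderiv,
    hv, hv]
  simp

/-- Differentiate ∂₁μ(e, x) Ad(x)w = ∂₂μ(x, e)w at x = e. Since ∂₁μ(e, e) is the identity, the
product rule leaves the derivative of `Ad` as the difference of two mixed second derivatives of μ,
which is the bracket. -/
theorem hasFDerivAt_Ad (w : E) :
    ∃ L : E →L[ℝ] E, (∀ v, L v = lieE I G v w) ∧
      HasFDerivAt (fun x => (AdE I ((extChartAt I (1 : G)).symm x) w)) L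
        (extChartAt I (1 : G) 1) := by
  set e := extChartAt I (1 : G) 1 with he
  set F := fderiv ℝ (chartMul I G) with hF
  set D2 := fderiv ℝ F (e, e) with hD2
  have hsymm : ∀ u v, D2 u v = D2 v u := fun u v => by
    have := (contDiffAt_chartMul (I := I) (G := G)).isSymmSndFDerivAt
      (by rw [minSmoothness_of_isRCLikeNormedField]; exact WithTop.coe_le_coe.2 le_top)
    exact this u v
  have hFd : HasFDerivAt F D2 (e, e) := hasFDerivAt_fderiv_chartMul
  have hP : HasFDerivAt (fun x => (F (e, x)).comp (ContinuousLinearMap.inl ℝ E E))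
      ((ContinuousLinearMap.compL ℝ E (E × E) E).flip (.inl ℝ E E) ∘L D2 ∘L .inr ℝ E E) e :=
    HasFDerivAt.comp e (g := fun L : E × E →L[ℝ] E => L.comp (ContinuousLinearMap.inl ℝ E E))
      (((ContinuousLinearMap.compL ℝ E (E × E) E).flip (.inl ℝ E E)).hasFDerivAt)
      (HasFDerivAt.comp e hFd (hasFDerivAt_prodMk_right (𝕜 := ℝ) e e))
  have hPe : (F (e, e)).comp (ContinuousLinearMap.inl ℝ E E) = ContinuousLinearMap.id ℝ E := by
    ext u; exact fderiv_chartMul_inl u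
  set P := fun x => (F (e, x)).comp (ContinuousLinearMap.inl ℝ E E) with hPdef
  have hQ := hasFDerivAt_fderiv_chartMul_left (I := I) (G := G) (0, w)
  -- ∂₁μ(e, x) is invertible near e because it is the identity at e. Solving for Ad(x)w then gives
  -- the differentiability that the product rule needs.
  have hinv : ∀ᶠ x in 𝓝 e, ∃ A : E ≃L[ℝ] E, (A : E →L[ℝ] E) = P x := by
    have h1 := ContinuousLinearEquiv.nhds (ContinuousLinearEquiv.refl ℝ E)
    have h2 : ContinuousAt P e := hP.continuousAt
    have h3 : P e = (ContinuousLinearEquiv.refl ℝ E : E →L[ℝ] E) := hPe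
    rw [← h3] at h1
    exact h2 h1
  have hA : DifferentiableAt ℝ
      (fun x => (AdE I ((extChartAt I (1 : G)).symm x) w)) e := by
    have h1 : DifferentiableAt ℝ (fun x => ContinuousLinearMap.inverse (P x)
        (F (x, e) (0, w))) e := by
      refine DifferentiableAt.clm_apply ?_ hQ.differentiableAt
      have h2 : DifferentiableAt ℝ (ContinuousLinearMap.inverse : (E →L[ℝ] E) → E →L[ℝ] E) (P e) := by
        have h3 : P e = (ContinuousLinearEquiv.refl ℝ E : E →L[ℝ] E) := hPe
        rw [h3]
        exact (contDiffAt_map_inverse (n := 1) (ContinuousLinearEquiv.refl ℝ E)).differentiableAt (by simp)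
      exact DifferentiableAt.comp e h2 hP.differentiableAt
    refine h1.congr_of_eventuallyEq ?_
    filter_upwards [hinv, fderiv_chartMul_Ad (I := I) (G := G) w] with x ⟨A, hx⟩ hx2
    rw [← hx, ContinuousLinearMap.inverse_equiv]
    change _ = A.symm (F (x, e) (0, w))
    rw [ContinuousLinearEquiv.eq_symm_apply]
    refine Eq.trans ?_ hx2
    exact congrArg (fun L : E →L[ℝ] E => L _) hx
  refine ⟨_, fun v => ?_, hA.hasFDerivAt⟩
  have h1 := hP.clm_apply hA.hasFDerivAt
  have h2 := (h1.congr_of_eventuallyEq (f₁ := fun x => F (x, e) (0, w)) (by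
    filter_upwards [fderiv_chartMul_Ad (I := I) (G := G) w] with x hx using hx.symm)).unique hQ
  have h4 : AdE I ((extChartAt I (1 : G)).symm e) w = w := by
    have : (extChartAt I (1 : G)).symm e = 1 := by simp [he]
    rw [this]; exact Ad_one (I := I) (G := G) w
  have h5 : ∀ u, P e u = u := fun u => congrArg (fun L : E →L[ℝ] E => L u) hPe
  have h3 := congrArg (fun L : E →L[ℝ] E => L v) h2
  rw [lie_eq_fderiv_chartMul]
  simp only [add_apply, ContinuousLinearMap.comp_apply,
    ContinuousLinearMap.flip_apply, h5, h4, ContinuousLinearMap.compL_apply,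
    ContinuousLinearMap.inl_apply, ContinuousLinearMap.inr_apply] at h3
  rw [hsymm (0, v)] at h3
  exact eq_sub_of_add_eq h3

theorem AdE_one (u : E) : AdE I (1 : G) u = u := Ad_one (I := I) (G := G) u

/-- The function x ↦ q(Ad(x)Y, Ad(x)Z) is constant; this is its derivative at the identity. -/
theorem add_lieE_eq_zero (q : E →L[ℝ] E →L[ℝ] ℝ)
    (hq : ∀ (a : G) (Y Z : E), q (AdE I a Y) (AdE I a Z) = q Y Z) (X Y Z : E) :
    q Y (lieE I G X Z) + q (lieE I G X Y) Z = 0 := by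
  obtain ⟨L, hL, hLd⟩ := hasFDerivAt_Ad (I := I) (G := G) Y
  obtain ⟨M, hM, hMd⟩ := hasFDerivAt_Ad (I := I) (G := G) Z
  have h1 := (q.hasFDerivAt.comp (extChartAt I (1 : G) 1) hLd).clm_apply hMd
  simp only [Function.comp, hq] at h1
  have h3 := congrArg (fun L : E →L[ℝ] ℝ => L X)
    (h1.unique (hasFDerivAt_const (q Y Z) (extChartAt I (1 : G) 1)))
  simpa [AdE_one, hL, hM] using h3

/-- Differentiate f(Ad(γ(t))X) = 0 at t = 0. With f vanishing on an invariant subspace, this is how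
invariance passes from K to its Lie algebra. -/
theorem apply_lieE_eq_zero {γ : ℝ → G} (h0 : γ 0 = 1) (hγ : ContinuousAt γ 0) {W : E}
    (hd : HasFDerivAt (fun t => extChartAt I (1 : G) (γ t))
      (ContinuousLinearMap.toSpanSingleton ℝ W) 0) (f : E →L[ℝ] ℝ) (X : E)
    (hf : ∀ t, f (AdE I (γ t) X) = 0) : f (lieE I G W X) = 0 := by
  obtain ⟨L, hL, hLd⟩ := hasFDerivAt_Ad (I := I) (G := G) X
  have hcomp : HasFDerivAt (fun t => f (AdE I ((extChartAt I (1 : G)).symm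
      (extChartAt I (1 : G) (γ t))) X))
      (f.comp (L.comp (ContinuousLinearMap.toSpanSingleton ℝ W))) 0 := by
    refine f.hasFDerivAt.comp 0 (HasFDerivAt.comp (0 : ℝ)
      (g := fun x => AdE I ((extChartAt I (1 : G)).symm x) X) ?_ hd)
    rw [h0]; exact hLd
  have hz : (fun t => f (AdE I ((extChartAt I (1 : G)).symm
      (extChartAt I (1 : G) (γ t))) X)) =ᶠ[𝓝 0] fun _ => 0 := by
    have : ∀ᶠ t in 𝓝 (0 : ℝ), γ t ∈ (extChartAt I (1 : G)).source := by
      apply hγ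
      rw [h0]; exact extChartAt_source_mem_nhds 1
    filter_upwards [this] with t ht
    rw [(extChartAt I (1 : G)).left_inv ht]
    exact hf t
  have h3 := congrArg (fun L : ℝ →L[ℝ] ℝ => L 1)
    ((hcomp.congr_of_eventuallyEq hz.symm).unique (hasFDerivAt_const (0 : ℝ) (0 : ℝ)))
  simpa [hL] using h3

variable [FiniteDimensional ℝ E]

/-- An `Ad`-invariant scalar product is `ad`-invariant. -/
theorem ScalarProduct.form_lie_of_Ad_invariant (Q : ScalarProduct (GroupLieAlgebra I G))
    (hQ : ∀ (a : G) (X Y : GroupLieAlgebra I G), Q.form (Ad I a X) (Ad I a Y) = Q.form X Y)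
    (X Y Z : GroupLieAlgebra I G) : Q.form ⁅X, Y⁆ Z = -Q.form Y ⁅X, Z⁆ := by
  let q' : E →ₗ[ℝ] E →ₗ[ℝ] ℝ := Q.form
  have h : Q.form Y ⁅X, Z⁆ + Q.form ⁅X, Y⁆ Z = 0 :=
    add_lieE_eq_zero (I := I) (G := G) q'.toContinuousBilinearMap (fun a Y Z => hQ a Y Z) X Y Z
  linarith

/-- An `Ad(K)`-invariant subspace is invariant under the Lie algebra of `K`. -/
theorem AdInvariant.lie_mem {K : Subgroup G} {V : Submodule ℝ (GroupLieAlgebra I G)}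
    (hV : AdInvariant I K V) {W X : GroupLieAlgebra I G} (hW : IsTangentTo I K W) (hX : X ∈ V) :
    ⁅W, X⁆ ∈ V := by
  obtain ⟨γ, hγ, hK, hd⟩ := hW
  by_contra hn
  obtain ⟨f, hf, hker⟩ := Submodule.exists_le_ker_of_notMem hn
  have h0 : γ 0 = 1 := by simpa using hγ 0 0
  have hd' : HasFDerivAt (fun t => extChartAt I (1 : G) (γ t))
      (ContinuousLinearMap.toSpanSingleton ℝ (W : E)) 0 := by
    have h : HasFDerivWithinAt (writtenInExtChartAt 𝓘(ℝ, ℝ) I 0 γ)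
      (ContinuousLinearMap.toSpanSingleton ℝ (W : E)) (range 𝓘(ℝ, ℝ)) 0 := hd.2
    have h' : writtenInExtChartAt 𝓘(ℝ, ℝ) I 0 γ = fun t => extChartAt I (1 : G) (γ t) := by
      ext t; simp only [writtenInExtChartAt, h0]; rfl
    rwa [h', ModelWithCorners.range_eq_univ, hasFDerivWithinAt_univ] at h
  exact hf (apply_lieE_eq_zero (I := I) (G := G) h0 hd.continuousAt hd'
    (LinearMap.toContinuousLinearMap (f : E →ₗ[ℝ] ℝ)) X (fun t => hker (hV _ (hK t) X hX)))

end Chart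

end Adjoint


/-! ### Schur's lemma for invariant bilinear forms -/

section Schur

variable {V : Type*} [AddCommGroup V] [Module ℝ V]

theorem IsOrthonormalBasis.form_sum {Q : ScalarProduct V} {W : Submodule ℝ V} {ι : Type*}
    [Fintype ι] [DecidableEq ι] {e : Module.Basis ι ℝ W} (he : ∀ i j,
      Q.form (e i : V) (e j : V) = if i = j then 1 else 0) {X : V} (hX : X ∈ W) :
    X = ∑ i, Q.form X (e i) • (e i : V) := by
  have h := congrArg (fun Y : W => (Y : V)) (e.sum_repr ⟨X, hX⟩)
  simp only [AddSubmonoidClass.coe_finsetSum, SetLike.val_smul] at h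
  have h2 : ∀ j, Q.form X (e j) = e.repr ⟨X, hX⟩ j := by
    intro j
    conv_lhs => rw [← h]
    simp [he]
  simp only [h2]; exact h.symm

theorem IsOrthonormalBasis.parseval {Q : ScalarProduct V} {W : Submodule ℝ V} {ι : Type*}
    [Fintype ι] [DecidableEq ι] {e : Module.Basis ι ℝ W} (he : ∀ i j,
      Q.form (e i : V) (e j : V) = if i = j then 1 else 0) {X Y : V} (hX : X ∈ W) :
    Q.form X Y = ∑ i, Q.form X (e i) * Q.form Y (e i) := by
  conv_lhs => rw [form_sum he hX]
  simp [Q.symm Y]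

variable {Γ : Type*} [Group Γ]

/-- `W` is irreducible for the representation `ρ`. -/
def RepIrreducible (ρ : Representation ℝ Γ V) (W : Submodule ℝ V) : Prop :=
  (∀ a, ∀ X ∈ W, ρ a X ∈ W) ∧ W ≠ ⊥ ∧
    ∀ U : Submodule ℝ V, U ≤ W → (∀ a, ∀ X ∈ U, ρ a X ∈ U) → U = ⊥ ∨ U = W

/-- `W` and `W'` are equivalent subrepresentations of `ρ`. -/
def RepEquivalent (ρ : Representation ℝ Γ V) (W W' : Submodule ℝ V) : Prop :=
  ∃ φ : W ≃ₗ[ℝ] W', ∀ a, ∀ X Y : W, (Y : V) = ρ a X → (φ Y : V) = ρ a (φ X)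

variable {Q : ScalarProduct V} {ρ : Representation ℝ Γ V}

theorem Representation.apply_inv_apply (a : Γ) (X : V) : ρ a (ρ a⁻¹ X) = X := by
  rw [← Module.End.mul_apply, ← map_mul, mul_inv_cancel, map_one, Module.End.one_apply]

theorem Representation.inv_apply_apply (a : Γ) (X : V) : ρ a⁻¹ (ρ a X) = X := by
  rw [← Module.End.mul_apply, ← map_mul, inv_mul_cancel, map_one, Module.End.one_apply]

/-- An invariant symmetric form on an irreducible subspace is a multiple of `Q`. -/
theorem RepIrreducible.exists_eq_mul (hQ : ∀ a X Y, Q.form (ρ a X) (ρ a Y) = Q.form X Y)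
    {W : Submodule ℝ V} (hW : RepIrreducible ρ W) {d : ℕ} {e : Module.Basis (Fin d) ℝ W}
    (he : IsOrthonormalBasis Q e) (β : LinearMap.BilinForm ℝ V)
    (hβ : ∀ X ∈ W, ∀ Y ∈ W, β X Y = β Y X)
    (hinv : ∀ a, ∀ X ∈ W, ∀ Y ∈ W, β (ρ a X) (ρ a Y) = β X Y) :
    ∃ c, ∀ X ∈ W, ∀ Y ∈ W, β X Y = c * Q.form X Y := by
  obtain ⟨hW1, hW2, hW3⟩ := hW
  -- The Gram matrix of β in a `Q`-orthonormal basis is symmetric, hence has a real eigenvalue; this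
  -- is the constant sought.
  let M : Matrix (Fin d) (Fin d) ℝ := Matrix.of fun i j => β (e i) (e j)
  have hM : M.IsHermitian := by
    ext i j
    simp [M, hβ (e j) (e j).2 (e i) (e i).2]
  have hd : Nonempty (Fin d) := by
    by_contra h
    rw [not_nonempty_iff] at h
    apply hW2
    rw [Submodule.eq_bot_iff]
    intro X hX
    rw [IsOrthonormalBasis.form_sum he hX]; simp
  obtain ⟨i0⟩ := hd
  set v : EuclideanSpace ℝ (Fin d) := hM.eigenvectorBasis i0 with hv
  set c := hM.eigenvalues i0
  have hMv : ∀ i, ∑ j, β (e i) (e j) * v j = c * v i := by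
    intro i
    have := congrFun (hM.mulVec_eigenvectorBasis i0) i
    simpa [Matrix.mulVec, dotProduct, M] using this
  have hv0 : v ≠ 0 := hM.eigenvectorBasis.toBasis.ne_zero i0 ∘ by simp [hv]
  refine ⟨c, ?_⟩
  -- The `c`-eigenspace of β relative to `Q`. It is invariant and contains the vector with
  -- coordinates `v`, so by irreducibility it is all of `W`.
  let U : Submodule ℝ V :=
    { carrier := {X | X ∈ W ∧ ∀ Y ∈ W, β Y X = c * Q.form Y X}
      add_mem' := by
        rintro X X' ⟨h1, h2⟩ ⟨h3, h4⟩
        refine ⟨W.add_mem h1 h3, fun Y hY => ?_⟩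
        rw [map_add, map_add, h2 Y hY, h4 Y hY]; ring
      zero_mem' := ⟨W.zero_mem, by simp⟩
      smul_mem' := by
        rintro r X ⟨h1, h2⟩
        refine ⟨W.smul_mem r h1, fun Y hY => ?_⟩
        rw [map_smul, map_smul, h2 Y hY]; simp; ring }
  have hU : U = ⊥ ∨ U = W := by
    refine hW3 U (fun X hX => hX.1) ?_
    rintro a X ⟨h1, h2⟩
    refine ⟨hW1 a X h1, fun Y hY => ?_⟩
    have hY' := hW1 a⁻¹ Y hY
    rw [← Representation.apply_inv_apply (ρ := ρ) a Y, hinv a _ hY' X h1, hQ, h2 _ hY']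
  have hU' : U = W := by
    refine hU.resolve_left fun h => hv0 ?_
    have hX : (∑ j, v j • (e j : V)) ∈ U := by
      refine ⟨W.sum_mem fun j _ => W.smul_mem _ (e j).2, fun Y hY => ?_⟩
      rw [IsOrthonormalBasis.form_sum he hY]
      simp only [map_sum, LinearMap.sum_apply, map_smul, LinearMap.smul_apply, smul_eq_mul,
        Finset.mul_sum]
      rw [Finset.sum_comm]
      conv_rhs => rw [Finset.sum_comm]
      refine Finset.sum_congr rfl fun i _ => ?_
      have h1 := congrArg (fun r => Q.form Y (e i) * r) (hMv i)
      simp only [Finset.mul_sum] at h1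
      calc _ = ∑ j, Q.form Y (e i) * (β (e i) (e j) * v j) :=
            Finset.sum_congr rfl fun j _ => by ring
        _ = _ := by
          rw [h1]
          simp [he i]; ring
    rw [h, Submodule.mem_bot] at hX
    have h2 : ∑ j, v j • e j = 0 := by
      apply Subtype.ext
      simpa using hX
    ext j
    exact Fintype.linearIndependent_iff.1 e.linearIndependent v h2 j
  intro X hX Y hY
  rw [← hU'] at hY
  exact hY.2 X hX

/-- An invariant form pairs inequivalent irreducible subspaces trivially. -/
theorem RepIrreducible.form_eq_zero (hQ : ∀ a X Y, Q.form (ρ a X) (ρ a Y) = Q.form X Y)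
    {W W' : Submodule ℝ V} (hW : RepIrreducible ρ W) (hW' : RepIrreducible ρ W')
    (hne : ¬ RepEquivalent ρ W W') {d : ℕ} {e : Module.Basis (Fin d) ℝ W'}
    (he : IsOrthonormalBasis Q e) (β : LinearMap.BilinForm ℝ V)
    (hinv : ∀ a, ∀ X ∈ W, ∀ Y ∈ W', β (ρ a X) (ρ a Y) = β X Y) :
    ∀ X ∈ W, ∀ Y ∈ W', β X Y = 0 := by
  obtain ⟨hW1, hW2, hW3⟩ := hW
  obtain ⟨hW1', hW2', hW3'⟩ := hW'
  -- The operator into `W'` representing β through `Q`. It commutes with the representation, so its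
  -- kernel in `W` and its image are invariant; if neither forces it to vanish on `W`, it is an
  -- equivalence.
  let φ : V →ₗ[ℝ] V := ∑ j, (β.flip (e j)).smulRight (e j : V)
  have hφ : ∀ X, φ X = ∑ j, β X (e j) • (e j : V) := fun X => by simp [φ, LinearMap.sum_apply]
  have hφmem : ∀ X, φ X ∈ W' := fun X => by
    rw [hφ]; exact W'.sum_mem fun j _ => W'.smul_mem _ (e j).2
  have hφQ : ∀ X, ∀ Y ∈ W', Q.form (φ X) Y = β X Y := by
    intro X Y hY
    rw [hφ]
    conv_rhs => rw [IsOrthonormalBasis.form_sum he hY]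
    simp only [map_sum, LinearMap.sum_apply, map_smul, LinearMap.smul_apply, smul_eq_mul]
    exact Finset.sum_congr rfl fun j _ => by rw [Q.symm Y]; ring
  have hext : ∀ Z ∈ W', (∀ Y ∈ W', Q.form Z Y = 0) → Z = 0 := by
    intro Z hZ h
    by_contra h0
    exact (Q.pos Z h0).ne' (h Z hZ)
  have hequi : ∀ a, ∀ X ∈ W, φ (ρ a X) = ρ a (φ X) := by
    intro a X hX
    have := hext (φ (ρ a X) - ρ a (φ X)) (W'.sub_mem (hφmem _) (hW1' a _ (hφmem _))) (by
      intro Y hY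
      have hY' := hW1' a⁻¹ Y hY
      rw [map_sub, LinearMap.sub_apply, hφQ _ Y hY]
      nth_rw 1 2 [← Representation.apply_inv_apply (ρ := ρ) a Y]
      rw [hQ, hφQ _ _ hY', hinv a X hX _ hY', sub_self])
    exact sub_eq_zero.1 this
  have hker := hW3 (W ⊓ LinearMap.ker φ) inf_le_left (by
    rintro a X ⟨h1, h2⟩
    refine ⟨hW1 a X h1, ?_⟩
    rw [SetLike.mem_coe, LinearMap.mem_ker] at h2 ⊢
    rw [hequi a X h1, h2, map_zero])
  have hrange := hW3' (W.map φ) (by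
    rintro _ ⟨X, _, rfl⟩; exact hφmem X) (by
    rintro a _ ⟨X, hX, rfl⟩
    exact ⟨ρ a X, hW1 a X hX, hequi a X hX⟩)
  intro X hX Y hY
  suffices φ X = 0 by rw [← hφQ X Y hY, this]; simp
  rcases hrange with h | hr
  · have : φ X ∈ W.map φ := ⟨X, hX, rfl⟩
    rwa [h, Submodule.mem_bot] at this
  rcases hker with hk | h
  · exfalso
    apply hne
    let ψ : W →ₗ[ℝ] W' := (φ.domRestrict W).codRestrict W' fun X => hφmem _
    have hψ : Function.Bijective ψ := by
      constructor
      · rw [injective_iff_map_eq_zero]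
        intro Z hZ
        have : (Z : V) ∈ W ⊓ LinearMap.ker φ := ⟨Z.2, congrArg Subtype.val hZ⟩
        rw [hk, Submodule.mem_bot] at this
        exact Subtype.ext this
      · rintro ⟨Z, hZ⟩
        rw [← hr] at hZ
        obtain ⟨X, hX, h⟩ := hZ
        exact ⟨⟨X, hX⟩, Subtype.ext h⟩
    refine ⟨LinearEquiv.ofBijective ψ hψ, fun a X Y h => ?_⟩
    change φ (Y : V) = ρ a (φ (X : V))
    rw [h]; exact hequi a X X.2
  · have : X ∈ W ⊓ LinearMap.ker φ := by rw [h]; exact hX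
    exact this.2

/-- Sums of products of functionals over an orthonormal basis are invariant under isometries. -/
theorem sum_apply_isometry (hQ : ∀ a X Y, Q.form (ρ a X) (ρ a Y) = Q.form X Y)
    {W : Submodule ℝ V} (hW : ∀ a, ∀ X ∈ W, ρ a X ∈ W) {ι : Type*} [Fintype ι] [DecidableEq ι]
    {e : Module.Basis ι ℝ W} (he : ∀ i j, Q.form (e i : V) (e j : V) = if i = j then 1 else 0)
    (f g : V →ₗ[ℝ] ℝ) (a : Γ) :
    ∑ i, f (ρ a (e i)) * g (ρ a (e i)) = ∑ i, f (e i) * g (e i) := by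
  -- On `W` each functional is the `Q`-product with a vector of `W`; both sides of the identity then
  -- become the `Q`-product of two such vectors, by Parseval.
  have h1 : ∀ f : V →ₗ[ℝ] ℝ, ∀ X ∈ W, f X = Q.form (∑ i, f (e i) • (e i : V)) X := by
    intro f X hX
    conv_lhs => rw [IsOrthonormalBasis.form_sum he hX]
    simp only [map_sum, LinearMap.sum_apply, map_smul, LinearMap.smul_apply, smul_eq_mul]
    exact Finset.sum_congr rfl fun j _ => by rw [Q.symm X]; ring
  have hmem : ∀ f : V →ₗ[ℝ] ℝ, (∑ i, f (e i) • (e i : V)) ∈ W := fun f =>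
    W.sum_mem fun j _ => W.smul_mem _ (e j).2
  set u := ∑ i, f (e i) • (e i : V)
  set w := ∑ i, g (e i) • (e i : V)
  have h2 : ∀ u X, Q.form u (ρ a X) = Q.form (ρ a⁻¹ u) X := by
    intro u X
    conv_lhs => rw [← Representation.apply_inv_apply (ρ := ρ) a u, hQ]
  calc _ = ∑ i, Q.form (ρ a⁻¹ u) (e i) * Q.form (ρ a⁻¹ w) (e i) :=
        Finset.sum_congr rfl fun i _ => by
          rw [h1 f _ (hW a _ (e i).2), h1 g _ (hW a _ (e i).2), h2, h2]
    _ = Q.form u w := by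
        rw [← IsOrthonormalBasis.parseval he (hW _ _ (hmem f)), hQ]
    _ = _ := by
        rw [IsOrthonormalBasis.parseval he (hmem f)]
        exact Finset.sum_congr rfl fun i _ => by
          rw [h1 f _ (e i).2, h1 g _ (e i).2]

end Schur


/-! ### Connection, curvature and Ricci tensor of a diagonal metric in structure constants -/

section Structure

variable {L : Type*} [LieRing L] [LieAlgebra ℝ L] {D : Decomposition L} {Q : ScalarProduct L}
  {ι : Type*} [Fintype ι] [DecidableEq ι]

/-- The structure constants `Q([e_i, e_j], e_k)`. -/
def strConst (Q : ScalarProduct L) (e : Module.Basis ι ℝ D.p) (i j k : ι) : ℝ :=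
  Q.form ⁅(e i : L), (e j : L)⁆ (e k)

theorem projP_add_projK (X : L) : (projP D X : L) + (projK D X : L) = X :=
  Submodule.projection_add_projection_eq_self D.isCompl.symm X

theorem projP_of_mem {X : L} (hX : X ∈ D.p) : (projP D X : L) = X :=
  congrArg Subtype.val (Submodule.projectionOnto_apply_left D.isCompl.symm ⟨X, hX⟩)

/-- `Q` is `ad`-invariant and `𝔭` is orthogonal to `𝔨`. -/
structure IsAdapted (D : Decomposition L) (Q : ScalarProduct L) : Prop where
  lie : ∀ X Y Z : L, Q.form ⁅X, Y⁆ Z = -Q.form Y ⁅X, Z⁆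
  orth : ∀ X ∈ D.k, ∀ Y ∈ D.p, Q.form X Y = 0

variable {e : Module.Basis ι ℝ D.p}

omit [Fintype ι] [DecidableEq ι] in
theorem strConst_swap (i j k : ι) : strConst Q e j i k = -strConst Q e i j k := by
  unfold strConst
  rw [← lie_skew, map_neg, LinearMap.neg_apply]

omit [Fintype ι] [DecidableEq ι] in
theorem IsAdapted.strConst_swap' (h : IsAdapted D Q) (i j k : ι) :
    strConst Q e i k j = -strConst Q e i j k := by
  unfold strConst
  rw [h.lie, Q.symm]

theorem IsAdapted.form_projP_left (h : IsAdapted D Q) (X : L) {Y : L} (hY : Y ∈ D.p) :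
    Q.form (projP D X) Y = Q.form X Y := by
  conv_rhs => rw [← projP_add_projK (D := D) X]
  rw [map_add, LinearMap.add_apply, h.orth _ (projK D X).2 Y hY, add_zero]

theorem IsAdapted.form_projK_left (h : IsAdapted D Q) (X : L) {Y : L} (hY : Y ∈ D.k) :
    Q.form (projK D X) Y = Q.form X Y := by
  conv_rhs => rw [← projP_add_projK (D := D) X]
  rw [map_add, LinearMap.add_apply, Q.symm (projP D X), h.orth Y hY _ (projP D X).2, zero_add]

/-- Orthogonality of the two complements makes 𝔭 the full orthogonal complement of 𝔨; this yields
[𝔨, 𝔭] ⊆ 𝔭 below. -/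
theorem IsAdapted.mem_p_iff (h : IsAdapted D Q) (X : L) :
    X ∈ D.p ↔ ∀ Y ∈ D.k, Q.form Y X = 0 := by
  refine ⟨fun hX Y hY => h.orth Y hY X hX, fun hX => ?_⟩
  have h1 : Q.form (projK D X) (projK D X) = 0 := by
    rw [h.form_projK_left _ (projK D X).2, Q.symm, hX _ (projK D X).2]
  have h2 : (projK D X : L) = 0 := by
    by_contra h0
    exact (Q.pos _ h0).ne' h1
  rw [← projP_add_projK (D := D) X, h2, add_zero]
  exact (projP D X).2

theorem IsAdapted.lie_mem_p (h : IsAdapted D Q) {W X : L} (hW : W ∈ D.k) (hX : X ∈ D.p) :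
    ⁅W, X⁆ ∈ D.p := by
  rw [h.mem_p_iff]
  intro Y hY
  rw [Q.symm, h.lie, Q.symm, h.orth _ (D.k.lie_mem hW hY) X hX, neg_zero]

variable (he : ∀ i j, Q.form (e i : L) (e j : L) = if i = j then 1 else 0)
include he

theorem repr_eq_form (X : D.p) (i : ι) : e.repr X i = Q.form (X : L) (e i) := by
  conv_rhs => rw [← e.sum_repr X]
  simp [he, -Module.Basis.sum_repr]

theorem IsAdapted.bracketP_basis (h : IsAdapted D Q) (i j k : ι) :
    e.repr (bracketP D (e i) (e j)) k = strConst Q e i j k := by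
  rw [repr_eq_form he]
  exact h.form_projP_left _ (e k).2

variable [FiniteDimensional ℝ L]

omit he in
theorem form_leviCivita (g : ScalarProduct D.p) (X Y Z : D.p) :
    g.form (leviCivita D g X Y) Z = 1 / 2 * (g.form (bracketP D X Y) Z
      + g.form Y (bracketP D Z X) + g.form X (bracketP D Z Y)) := by
  simp only [leviCivita, LinearMap.mk₂_apply, LinearMap.BilinForm.apply_toDual_symm_apply]
  simp [koszul]; ring

/-- `g` is diagonal with entries `x i` in the basis `e`. -/
def IsDiagonal (g : ScalarProduct D.p) (e : Module.Basis ι ℝ D.p) (x : ι → ℝ) : Prop :=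
  ∀ i j, g.form (e i) (e j) = if i = j then x i else 0

omit he [Fintype ι] [FiniteDimensional ℝ L] in
theorem IsDiagonal.pos {g : ScalarProduct D.p} {x : ι → ℝ} (hg : IsDiagonal g e x) (i : ι) :
    0 < x i := by
  have := g.pos (e i) (e.ne_zero i)
  rwa [hg i i, if_pos rfl] at this

omit he [FiniteDimensional ℝ L] in
theorem IsDiagonal.form_right {g : ScalarProduct D.p} {x : ι → ℝ} (hg : IsDiagonal g e x)
    (X : D.p) (i : ι) : g.form X (e i) = e.repr X i * x i := by
  conv_lhs => rw [← e.sum_repr X]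
  simp [hg _ i, -Module.Basis.sum_repr]

/-- The coefficients of the Levi-Civita connection of a diagonal metric. -/
def christoffel (c : ι → ι → ι → ℝ) (x : ι → ℝ) (i j k : ι) : ℝ :=
  1 / 2 * c i j k * (x k + x j - x i) / x k

/-- The structure constants are totally skew by `ad`-invariance, so the three terms of the Koszul
formula are the same constant with weights `x k`, `x j` and `-x i`. -/
theorem IsAdapted.leviCivita_basis (h : IsAdapted D Q) {g : ScalarProduct D.p} {x : ι → ℝ}
    (hg : IsDiagonal g e x) (i j k : ι) :
    e.repr (leviCivita D g (e i) (e j)) k = christoffel (strConst Q e) x i j k := by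
  have hx := (hg.pos k).ne'
  have h1 := form_leviCivita g (e i) (e j) (e k)
  rw [hg.form_right, g.symm (e j), g.symm (e i), hg.form_right, hg.form_right, hg.form_right,
    h.bracketP_basis he, h.bracketP_basis he, h.bracketP_basis he] at h1
  have h2 : strConst Q e k i j = strConst Q e i j k := by
    rw [strConst_swap, h.strConst_swap']; ring
  have h3 : strConst Q e k j i = -strConst Q e i j k := by
    rw [h.strConst_swap', h2]
  rw [h2, h3] at h1
  rw [christoffel, eq_div_iff hx, h1]; ring

/-- The `𝔨`-part of the curvature coefficients. -/
def isotropyConst (Q : ScalarProduct L) (e : Module.Basis ι ℝ D.p) (i j k l : ι) : ℝ :=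
  Q.form ⁅(projK D ⁅(e i : L), (e j : L)⁆ : L), (e k : L)⁆ (e l)

/-- The coefficients of the curvature tensor of a diagonal metric. -/
def curvCoeff (c : ι → ι → ι → ℝ) (κ : ι → ι → ι → ι → ℝ) (x : ι → ℝ) (i j k l : ι) : ℝ :=
  ∑ m, (christoffel c x j k m * christoffel c x i m l
    - christoffel c x i k m * christoffel c x j m l - c i j m * christoffel c x m k l) - κ i j k l

theorem IsAdapted.curvature_basis (h : IsAdapted D Q) {g : ScalarProduct D.p} {x : ι → ℝ}
    (hg : IsDiagonal g e x) (i j k l : ι) :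
    e.repr (curvature D g (e i) (e j) (e k)) l
      = curvCoeff (strConst Q e) (isotropyConst Q e) x i j k l := by
  have hΛ : ∀ (T : D.p →ₗ[ℝ] D.p) (X : D.p), e.repr (T X) l = ∑ m, e.repr X m * e.repr (T (e m)) l := by
    intro T X
    conv_lhs => rw [← e.sum_repr X]
    simp only [map_sum, map_smul, Finsupp.coe_finsetSum, Finset.sum_apply, Finsupp.smul_apply,
      smul_eq_mul]
  have h1 : e.repr (leviCivita D g (bracketP D (e i) (e j)) (e k)) l
      = ∑ m, strConst Q e i j m * christoffel (strConst Q e) x m k l := by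
    have := hΛ ((leviCivita D g).flip (e k)) (bracketP D (e i) (e j))
    simp only [LinearMap.flip_apply] at this
    rw [this]
    simp only [h.bracketP_basis he, h.leviCivita_basis he hg]
  have h2 : e.repr (isotropyAction D (projK D ⁅(e i : L), (e j : L)⁆ : L) (e k)) l
      = isotropyConst Q e i j k l := by
    rw [repr_eq_form he]
    exact h.form_projP_left _ (e l).2
  simp only [curvature, LinearMap.sub_apply, LinearMap.comp_apply, map_sub, Finsupp.sub_apply]
  rw [h1, h2, hΛ (leviCivita D g (e i)), hΛ (leviCivita D g (e j))]
  simp only [h.leviCivita_basis he hg, curvCoeff, Finset.sum_sub_distrib]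

omit he in
theorem ricci_eq_sum (g : ScalarProduct D.p) (e : Module.Basis ι ℝ D.p) (X Y : D.p) :
    ricci D g X Y = ∑ i, e.repr (curvature D g (e i) X Y) i := by
  rw [ricci, LinearMap.trace_eq_matrix_trace ℝ e, Matrix.trace]
  simp [LinearMap.toMatrix_apply]

-- `ricci` is defined as a bare function of two vectors; this makes its values on a basis
-- sufficient.
omit he in
theorem ricci_bilin (g : ScalarProduct D.p) (e : Module.Basis ι ℝ D.p) (X Y : D.p) :
    ricci D g X Y = ∑ a, ∑ b, e.repr X a * e.repr Y b * ricci D g (e a) (e b) := by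
  have h1 : ∀ X Y, ricci D g X Y = ∑ b, e.repr Y b * ricci D g X (e b) := by
    intro X Y
    simp only [ricci_eq_sum g e, Finset.mul_sum]
    rw [Finset.sum_comm]
    refine Finset.sum_congr rfl fun i _ => ?_
    conv_lhs => rw [← e.sum_repr Y]
    simp only [map_sum, map_smul, Finsupp.coe_finsetSum, Finset.sum_apply, Finsupp.smul_apply,
      smul_eq_mul]
  have h2 : ∀ X Y, ricci D g X Y = ∑ a, e.repr X a * ricci D g (e a) Y := by
    intro X Y
    have h3 : ∀ i, ∃ T : D.p →ₗ[ℝ] ℝ, ∀ X, T X = e.repr (curvature D g (e i) X Y) i := by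
      intro i
      refine ⟨⟨⟨fun X => e.repr (curvature D g (e i) X Y) i, ?_⟩, ?_⟩, fun X => rfl⟩
      · intro X X'
        simp [curvature, isotropyAction]; ring
      · intro r X
        simp [curvature, isotropyAction]; ring
    choose T hT using h3
    simp only [ricci_eq_sum g e, Finset.mul_sum, ← hT]
    rw [Finset.sum_comm]
    refine Finset.sum_congr rfl fun i _ => ?_
    conv_lhs => rw [← e.sum_repr X]
    simp [-Module.Basis.sum_repr]
  rw [h2]
  refine Finset.sum_congr rfl fun a _ => ?_
  rw [h1, Finset.mul_sum]
  exact Finset.sum_congr rfl fun b _ => by ring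

/-- The form `∑ Q([e_i, X]_𝔨, [e_i, Y]_𝔨)` on basis vectors. -/
def isotropyForm (Q : ScalarProduct L) (e : Module.Basis ι ℝ D.p) (a b : ι) : ℝ :=
  ∑ i, Q.form (projK D ⁅(e i : L), (e a : L)⁆ : L) (projK D ⁅(e i : L), (e b : L)⁆ : L)

/-- Contract the curvature coefficients. Skewness kills the terms with Λ(e_i)e_m along e_i, and
turns every other product into the same pair of structure constants. The 𝔨-part becomes
`isotropyForm` by `ad`-invariance. -/
theorem IsAdapted.ricci_basis (h : IsAdapted D Q) {g : ScalarProduct D.p} {x : ι → ℝ}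
    (hg : IsDiagonal g e x) (a b : ι) :
    ricci D g (e a) (e b) = isotropyForm Q e a b + ∑ i, ∑ m, strConst Q e i a m * strConst Q e i b m
      * (1 / 2 * (x i + x b - x m) / x i
        - 1 / 4 * (x m + x b - x i) * (x i + x m - x a) / (x m * x i)) := by
  rw [ricci_eq_sum g e, isotropyForm, ← Finset.sum_add_distrib]
  refine Finset.sum_congr rfl fun i _ => ?_
  rw [h.curvature_basis he hg, curvCoeff, sub_eq_neg_add]
  congr 1
  · rw [isotropyConst, ← lie_skew, map_neg, LinearMap.neg_apply, h.lie, neg_neg, neg_eq_iff_eq_neg,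
      Q.symm, ← h.form_projK_left _ (projK D _).2, Q.symm, ← lie_skew (e i : L) (e b : L), map_neg, NegMemClass.coe_neg, map_neg, neg_neg]
  · refine Finset.sum_congr rfl fun m _ => ?_
    have hxi := (hg.pos i).ne'
    have hxm := (hg.pos m).ne'
    have h0 : strConst Q e i m i = 0 := by
      have h1 : strConst Q e i i m = 0 := by simp [strConst]
      rw [h.strConst_swap', h1, neg_zero]
    have h1 : strConst Q e a m i = strConst Q e i a m := by
      rw [h.strConst_swap', strConst_swap]; ring
    have h2 : strConst Q e m b i = -strConst Q e i b m := by
      rw [h.strConst_swap', strConst_swap, h.strConst_swap']; ring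
    simp only [christoffel, h0, h1, h2]
    field_simp
    ring

end Structure


/-! ### The Killing form in structure constants -/

section Killing

variable {L : Type*} [LieRing L] [LieAlgebra ℝ L] {D : Decomposition L} {Q : ScalarProduct L}
  {ι : Type*} [Fintype ι] [DecidableEq ι] {e : Module.Basis ι ℝ D.p} [FiniteDimensional ℝ L]

omit [FiniteDimensional ℝ L] in
theorem IsAdapted.form_eq_sum (h : IsAdapted D Q)
    (he : ∀ i j, Q.form (e i : L) (e j : L) = if i = j then 1 else 0) (X Y : L) :
    Q.form X Y = ∑ m, Q.form X (e m) * Q.form Y (e m)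
      + Q.form (projK D X : L) (projK D Y : L) := by
  conv_lhs => rw [← projP_add_projK (D := D) X]
  rw [map_add, LinearMap.add_apply, IsOrthonormalBasis.parseval he (projP D X).2, Q.symm _ Y,
    ← h.form_projK_left Y (projK D X).2, Q.symm (projK D Y : L)]
  congr 1
  exact Finset.sum_congr rfl fun m _ => by rw [h.form_projP_left _ (e m).2]

/-- Split the trace of ad(e_a) ad(e_b) along 𝔭 ⊕ 𝔨. As ad(e_b) maps 𝔨 into 𝔭, cyclicity turns the
𝔨-part into a trace over 𝔭, equal to minus the isotropy form. The 𝔭-part contributes the isotropy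
form once more, which explains the factor 2. -/
theorem IsAdapted.killingForm_basis (h : IsAdapted D Q)
    (he : ∀ i j, Q.form (e i : L) (e j : L) = if i = j then 1 else 0) (a b : ι) :
    -killingForm ℝ L (e a) (e b)
      = ∑ i, ∑ m, strConst Q e i a m * strConst Q e i b m + 2 * isotropyForm Q e a b := by
  let P : L →ₗ[ℝ] L := D.p.subtype ∘ₗ projP D
  let N : L →ₗ[ℝ] L := D.k.toSubmodule.subtype ∘ₗ projK D
  have hPN : ∀ X, P X + N X = X := fun X => projP_add_projK X
  have htr : ∀ T : L →ₗ[ℝ] L, LinearMap.trace ℝ L (T ∘ₗ P) = ∑ i, Q.form (T (e i)) (e i) := by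
    intro T
    have h1 : T ∘ₗ P = (T ∘ₗ D.p.subtype) ∘ₗ projP D := rfl
    rw [h1, LinearMap.trace_comp_comm', LinearMap.trace_eq_matrix_trace ℝ e, Matrix.trace]
    refine Finset.sum_congr rfl fun i _ => ?_
    simp only [Matrix.diag_apply, LinearMap.toMatrix_apply]
    rw [repr_eq_form he]
    exact h.form_projP_left _ (e i).2
  let A : L →ₗ[ℝ] L := LieAlgebra.ad ℝ L (e a : L)
  let B : L →ₗ[ℝ] L := LieAlgebra.ad ℝ L (e b : L)
  have hBN : B ∘ₗ N = P ∘ₗ (B ∘ₗ N) := by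
    ext X
    have : ⁅(e b : L), N X⁆ ∈ D.p := by
      rw [← lie_skew]
      exact D.p.neg_mem (h.lie_mem_p (projK D X).2 (e b).2)
    exact (projP_of_mem this).symm
  have hsplit : A ∘ₗ B = (A ∘ₗ B) ∘ₗ P + (A ∘ₗ P) ∘ₗ (B ∘ₗ N) := by
    have h2 : (A ∘ₗ P) ∘ₗ (B ∘ₗ N) = A ∘ₗ (B ∘ₗ N) := by
      conv_rhs => rw [hBN]
      rfl
    rw [h2]
    ext X
    conv_lhs => rw [← hPN X]
    simp
  have hk : killingForm ℝ L (e a) (e b) = LinearMap.trace ℝ L (A ∘ₗ B) := rfl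
  rw [hk, hsplit, map_add, htr, LinearMap.trace_comp_comm']
  have h3 : (B ∘ₗ N) ∘ₗ (A ∘ₗ P) = (B ∘ₗ N ∘ₗ A) ∘ₗ P := rfl
  rw [h3, htr, isotropyForm, ← Finset.sum_add_distrib, ← Finset.sum_neg_distrib, Finset.mul_sum,
    ← Finset.sum_add_distrib]
  refine Finset.sum_congr rfl fun i _ => ?_
  have e1 : Q.form (A (B (e i))) (e i) = -Q.form ⁅(e i : L), (e b : L)⁆ ⁅(e i : L), (e a : L)⁆ := by
    change Q.form ⁅(e a : L), ⁅(e b : L), (e i : L)⁆⁆ (e i) = _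
    rw [h.lie, ← lie_skew (e i : L) (e b : L), ← lie_skew (e i : L) (e a : L)]
    simp only [map_neg, LinearMap.neg_apply, neg_neg]
  have e2 : Q.form (B (N (A (e i)))) (e i)
      = -Q.form (projK D ⁅(e i : L), (e a : L)⁆ : L) (projK D ⁅(e i : L), (e b : L)⁆ : L) := by
    change Q.form ⁅(e b : L), (projK D ⁅(e a : L), (e i : L)⁆ : L)⁆ (e i) = _
    rw [h.lie, ← lie_skew (e a : L) (e i : L), ← lie_skew (e b : L) (e i : L)]
    simp only [map_neg, NegMemClass.coe_neg, LinearMap.neg_apply, neg_neg]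
    rw [Q.symm, ← h.form_projK_left _ (projK D _).2, Q.symm]
  have e3 := h.form_eq_sum he ⁅(e i : L), (e b : L)⁆ ⁅(e i : L), (e a : L)⁆
  simp only [LinearMap.comp_apply]
  rw [e1, e2, e3, Q.symm (projK D ⁅(e i : L), (e b : L)⁆ : L)]
  simp only [strConst]
  rw [Finset.sum_congr rfl fun m _ => mul_comm (Q.form ⁅(e i : L), (e b : L)⁆ (e m)) _]
  ring

end Killing

/-! ### The curvature norm of a diagonal metric, its scaling and continuity -/

section CurvatureNorm

variable {V : Type*} [AddCommGroup V] [Module ℝ V]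

/-- The contraction of two covectors with g does not depend on the basis; in a g-orthogonal basis
the dual vectors are `e j / x j`. -/
theorem sum_dualBasis_eq {g : ScalarProduct V} {ι κ : Type*} [Fintype ι] [DecidableEq ι] [Fintype κ]
    [DecidableEq κ] [FiniteDimensional ℝ V] {e : Module.Basis ι ℝ V} {x : ι → ℝ} (hx : ∀ i, x i ≠ 0)
    (hg : ∀ i j, g.form (e i) (e j) = if i = j then x i else 0) (b : Module.Basis κ ℝ V)
    {f h : V → ℝ} (hf : IsLinearMap ℝ f) (hh : IsLinearMap ℝ h) :
    ∑ i, f (b i) * h (g.form.dualBasis g.nondegenerate b i) = ∑ j, f (e j) * h (e j) / x j := by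
  set b' := g.form.dualBasis g.nondegenerate b
  obtain ⟨f, rfl⟩ : ∃ F : V →ₗ[ℝ] ℝ, ⇑F = f := ⟨hf.mk' f, rfl⟩
  obtain ⟨h, rfl⟩ : ∃ F : V →ₗ[ℝ] ℝ, ⇑F = h := ⟨hh.mk' h, rfl⟩
  have h1 : ∀ X j, g.form X (e j) = e.repr X j * x j := by
    intro X j
    conv_lhs => rw [← e.sum_repr X]
    simp [hg, -Module.Basis.sum_repr]
  have h2 : ∀ X i, g.form (b' i) X = b.repr X i := by
    intro X i
    conv_lhs => rw [← b.sum_repr X]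
    simp [b', -Module.Basis.sum_repr, LinearMap.BilinForm.apply_dualBasis_left]
  have h3 : ∀ i, h (b' i) = ∑ j, b.repr (e j) i * h (e j) / x j := by
    intro i
    conv_lhs => rw [← e.sum_repr (b' i)]
    simp only [map_sum, map_smul, smul_eq_mul]
    refine Finset.sum_congr rfl fun j _ => ?_
    have := h1 (b' i) j
    rw [h2] at this
    rw [this]
    field_simp [hx j]
  simp only [h3, Finset.mul_sum]
  rw [Finset.sum_comm]
  refine Finset.sum_congr rfl fun j _ => ?_
  conv_rhs => rw [← b.sum_repr (e j)]
  have h4 : f (∑ i, b.repr (e j) i • b i) = ∑ i, b.repr (e j) i * f (b i) := by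
    simp [-Module.Basis.sum_repr]
  rw [h4, b.sum_repr, Finset.sum_mul, Finset.sum_div]
  exact Finset.sum_congr rfl fun i _ => by ring

/-- The single contraction applied to the four slots in turn, with the sums reordered so that the
current slot is innermost. -/
theorem sum_dualBasis_four {g : ScalarProduct V} {ι κ : Type*} [Fintype ι] [DecidableEq ι]
    [Fintype κ] [DecidableEq κ] [FiniteDimensional ℝ V] {e : Module.Basis ι ℝ V} {x : ι → ℝ}
    (hx : ∀ i, x i ≠ 0) (hg : ∀ i j, g.form (e i) (e j) = if i = j then x i else 0)
    (b : Module.Basis κ ℝ V) {T : V → V → V → V → ℝ}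
    (h1 : ∀ Y Z W, IsLinearMap ℝ fun X => T X Y Z W) (h2 : ∀ X Z W, IsLinearMap ℝ fun Y => T X Y Z W)
    (h3 : ∀ X Y W, IsLinearMap ℝ fun Z => T X Y Z W) (h4 : ∀ X Y Z, IsLinearMap ℝ fun W => T X Y Z W) :
    let b' := g.form.dualBasis g.nondegenerate b
    ∑ i, ∑ j, ∑ k, ∑ l, T (b i) (b j) (b k) (b l) * T (b' i) (b' j) (b' k) (b' l)
      = ∑ i, ∑ j, ∑ k, ∑ l, T (e i) (e j) (e k) (e l) ^ 2 / (x i * x j * x k * x l) := by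
  intro b'
  have s1 : ∀ X Y Z X' Y' Z', ∑ l, T X Y Z (b l) * T X' Y' Z' (b' l)
      = ∑ l, T X Y Z (e l) * T X' Y' Z' (e l) / x l := fun X Y Z X' Y' Z' =>
    sum_dualBasis_eq hx hg b (h4 X Y Z) (h4 X' Y' Z')
  have s2 : ∀ X Y X' Y', ∑ k, ∑ l, T X Y (b k) (b l) * T X' Y' (b' k) (b' l)
      = ∑ k, ∑ l, T X Y (e k) (e l) * T X' Y' (e k) (e l) / (x k * x l) := by
    intro X Y X' Y'
    simp only [s1]
    rw [Finset.sum_comm]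
    conv_rhs => rw [Finset.sum_comm]
    refine Finset.sum_congr rfl fun l _ => ?_
    rw [← Finset.sum_div, sum_dualBasis_eq hx hg b (h3 X Y (e l)) (h3 X' Y' (e l)), Finset.sum_div]
    exact Finset.sum_congr rfl fun k _ => by rw [div_div]
  have s3 : ∀ X X', ∑ j, ∑ k, ∑ l, T X (b j) (b k) (b l) * T X' (b' j) (b' k) (b' l)
      = ∑ j, ∑ k, ∑ l, T X (e j) (e k) (e l) * T X' (e j) (e k) (e l) / (x j * x k * x l) := by
    intro X X'
    simp only [s2]
    rw [Finset.sum_comm]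
    conv_rhs => rw [Finset.sum_comm]
    refine Finset.sum_congr rfl fun k _ => ?_
    rw [Finset.sum_comm]
    conv_rhs => rw [Finset.sum_comm]
    refine Finset.sum_congr rfl fun l _ => ?_
    rw [← Finset.sum_div, sum_dualBasis_eq hx hg b (h2 X (e k) (e l)) (h2 X' (e k) (e l)),
      Finset.sum_div]
    exact Finset.sum_congr rfl fun j _ => by rw [div_div, ← mul_assoc]
  simp only [s3]
  rw [Finset.sum_comm]
  conv_rhs => rw [Finset.sum_comm]
  refine Finset.sum_congr rfl fun j _ => ?_
  rw [Finset.sum_comm]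
  conv_rhs => rw [Finset.sum_comm]
  refine Finset.sum_congr rfl fun k _ => ?_
  rw [Finset.sum_comm]
  conv_rhs => rw [Finset.sum_comm]
  refine Finset.sum_congr rfl fun l _ => ?_
  rw [← Finset.sum_div, sum_dualBasis_eq hx hg b (h1 (e j) (e k) (e l)) (h1 (e j) (e k) (e l)),
    Finset.sum_div]
  exact Finset.sum_congr rfl fun i _ => by rw [div_div, ← mul_assoc, ← mul_assoc, sq]

variable {L : Type*} [LieRing L] [LieAlgebra ℝ L] {D : Decomposition L} {Q : ScalarProduct L}
  {ι : Type*} [Fintype ι] [DecidableEq ι] {e : Module.Basis ι ℝ D.p} [FiniteDimensional ℝ L]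

/-- The norm of the curvature tensor of a diagonal metric in terms of its coefficients. -/
def curvNormCoeff (c : ι → ι → ι → ℝ) (κ : ι → ι → ι → ι → ℝ) (x : ι → ℝ) : ℝ :=
  Real.sqrt (∑ i, ∑ j, ∑ k, ∑ l, (curvCoeff c κ x i j k l * x l) ^ 2 / (x i * x j * x k * x l))

theorem IsAdapted.curvatureNorm_eq (h : IsAdapted D Q)
    (he : ∀ i j, Q.form (e i : L) (e j : L) = if i = j then 1 else 0) {g : ScalarProduct D.p}
    {x : ι → ℝ} (hg : IsDiagonal g e x) :
    curvatureNorm D g = curvNormCoeff (strConst Q e) (isotropyConst Q e) x := by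
  have h1 := sum_dualBasis_four (g := g) (fun i => (hg.pos i).ne') hg (Module.finBasis ℝ D.p)
    (T := fun X Y Z W => g.form (curvature D g X Y Z) W)
    (fun Y Z W => ⟨fun X X' => by simp [curvature, isotropyAction]; ring,
      fun r X => by simp [curvature, isotropyAction]; ring⟩)
    (fun X Z W => ⟨fun X X' => by simp [curvature, isotropyAction]; ring,
      fun r X => by simp [curvature, isotropyAction]; ring⟩)
    (fun X Y W => ⟨fun X X' => by simp, fun r X => by simp⟩)
    (fun X Y Z => ⟨fun X X' => by simp, fun r X => by simp⟩)
  simp only [hg.form_right, h.curvature_basis he hg] at h1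
  rw [curvatureNorm, curvNormCoeff, ← h1]

omit [Fintype ι] [DecidableEq ι] in
theorem christoffel_smul (c : ι → ι → ι → ℝ) (x : ι → ℝ) {r : ℝ} (hr : 0 < r) (i j k : ι) :
    christoffel c (fun i => r * x i) i j k = christoffel c x i j k := by
  simp only [christoffel]
  rw [show 1 / 2 * c i j k * (r * x k + r * x j - r * x i)
    = r * (1 / 2 * c i j k * (x k + x j - x i)) by ring, mul_div_mul_left _ _ hr.ne']

-- The curvature coefficients with one index raised are invariant under scaling, so |Rm| is
-- homogeneous of degree -1 in the metric.
omit [DecidableEq ι] in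
theorem curvNormCoeff_smul (c : ι → ι → ι → ℝ) (κ : ι → ι → ι → ι → ℝ) (x : ι → ℝ) {r : ℝ}
    (hr : 0 < r) : curvNormCoeff c κ (fun i => r * x i) = curvNormCoeff c κ x / r := by
  rw [curvNormCoeff, curvNormCoeff, ← Real.sqrt_sq hr.le, ← Real.sqrt_div' _ (by positivity),
    Real.sqrt_sq hr.le]
  congr 1
  simp only [Finset.sum_div]
  refine Finset.sum_congr rfl fun i _ => Finset.sum_congr rfl fun j _ =>
    Finset.sum_congr rfl fun k _ => Finset.sum_congr rfl fun l _ => ?_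
  have : curvCoeff c κ (fun i => r * x i) i j k l = curvCoeff c κ x i j k l := by
    simp only [curvCoeff, christoffel_smul c x hr]
  rw [this, div_div, show (curvCoeff c κ x i j k l * (r * x l)) ^ 2
    = r ^ 2 * (curvCoeff c κ x i j k l * x l) ^ 2 by ring,
    show r * x i * (r * x j) * (r * x k) * (r * x l)
    = r ^ 2 * (x i * x j * x k * x l * r ^ 2) by ring, mul_div_mul_left _ _ (by positivity)]

omit [DecidableEq ι] in
theorem continuousOn_curvNormCoeff (c : ι → ι → ι → ℝ) (κ : ι → ι → ι → ι → ℝ) {x : ℝ → ι → ℝ}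
    {s : Set ℝ} (hx : ∀ i, ContinuousOn (fun y => x y i) s) (hpos : ∀ y ∈ s, ∀ i, x y i ≠ 0) :
    ContinuousOn (fun y => curvNormCoeff c κ (x y)) s := by
  have h1 : ∀ i j k, ContinuousOn (fun y => christoffel c (x y) i j k) s := by
    intro i j k
    simp only [christoffel]
    exact (continuousOn_const.mul (((hx k).add (hx j)).sub (hx i))).div (hx k)
      fun y hy => hpos y hy k
  have h2 : ∀ i j k l, ContinuousOn (fun y => curvCoeff c κ (x y) i j k l) s := by
    intro i j k l
    simp only [curvCoeff]
    exact (continuousOn_finsetSum _ fun m _ => (((h1 _ _ _).mul (h1 _ _ _)).sub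
      ((h1 _ _ _).mul (h1 _ _ _))).sub (continuousOn_const.mul (h1 _ _ _))).sub continuousOn_const
  refine Real.continuous_sqrt.comp_continuousOn ?_
  refine continuousOn_finsetSum _ fun i _ => continuousOn_finsetSum _ fun j _ =>
    continuousOn_finsetSum _ fun k _ => continuousOn_finsetSum _ fun l _ => ?_
  refine (((h2 i j k l).mul (hx l)).pow 2).div ((((hx i).mul (hx j)).mul (hx k)).mul (hx l)) ?_
  intro y hy
  have := hpos y hy
  simp [this]

/-- A diagonal metric whose curvature norm vanishes is Ricci flat. -/
theorem IsAdapted.ricci_eq_zero_of_curvatureNorm (h : IsAdapted D Q)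
    (he : ∀ i j, Q.form (e i : L) (e j : L) = if i = j then 1 else 0) {g : ScalarProduct D.p}
    {x : ι → ℝ} (hg : IsDiagonal g e x)
    (h0 : curvNormCoeff (strConst Q e) (isotropyConst Q e) x = 0) (X Y : D.p) :
    ricci D g X Y = 0 := by
  have hpos : ∀ i j k l, 0 < x i * x j * x k * x l := fun i j k l =>
    mul_pos (mul_pos (mul_pos (hg.pos i) (hg.pos j)) (hg.pos k)) (hg.pos l)
  have hnn : ∀ i j k l, 0 ≤ (curvCoeff (strConst Q e) (isotropyConst Q e) x i j k l * x l) ^ 2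
      / (x i * x j * x k * x l) := fun i j k l => div_nonneg (sq_nonneg _) (hpos i j k l).le
  rw [curvNormCoeff, Real.sqrt_eq_zero (Finset.sum_nonneg fun i _ => Finset.sum_nonneg fun j _ =>
    Finset.sum_nonneg fun k _ => Finset.sum_nonneg fun l _ => hnn i j k l)] at h0
  have hz : ∀ i j k l, curvCoeff (strConst Q e) (isotropyConst Q e) x i j k l = 0 := by
    intro i j k l
    have h1 := (Finset.sum_eq_zero_iff_of_nonneg fun i _ => Finset.sum_nonneg fun j _ =>
      Finset.sum_nonneg fun k _ => Finset.sum_nonneg fun l _ => hnn i j k l).1 h0 i (Finset.mem_univ _)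
    have h2 := (Finset.sum_eq_zero_iff_of_nonneg fun j _ =>
      Finset.sum_nonneg fun k _ => Finset.sum_nonneg fun l _ => hnn i j k l).1 h1 j (Finset.mem_univ _)
    have h3 := (Finset.sum_eq_zero_iff_of_nonneg fun k _ =>
      Finset.sum_nonneg fun l _ => hnn i j k l).1 h2 k (Finset.mem_univ _)
    have h4 := (Finset.sum_eq_zero_iff_of_nonneg fun l _ => hnn i j k l).1 h3 l (Finset.mem_univ _)
    rw [div_eq_zero_iff] at h4
    have h5 := h4.resolve_right (hpos i j k l).ne'
    exact (mul_eq_zero.1 (pow_eq_zero_iff two_ne_zero |>.1 h5)).resolve_right (hg.pos l).ne'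
  rw [ricci_bilin g e]
  refine Finset.sum_eq_zero fun a _ => Finset.sum_eq_zero fun b _ => ?_
  rw [ricci_eq_sum g e, Finset.sum_eq_zero, mul_zero]
  intro i _
  rw [h.curvature_basis he hg, hz]

end CurvatureNorm


/-! ### Two inequivalent irreducible summands: the Ricci tensor and the constants -/

section TwoSummands

variable {L : Type*} [LieRing L] [LieAlgebra ℝ L] {Γ : Type*} [Group Γ]

/-- The isotropy representation of a homogeneous space with two inequivalent irreducible summands. -/
structure TwoSummands (ρ : Representation ℝ Γ L) (D : Decomposition L) (Q : ScalarProduct L)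
    {p₁ p₂ : Submodule ℝ L} {d₁ d₂ : ℕ} (e₁ : Module.Basis (Fin d₁) ℝ p₁)
    (e₂ : Module.Basis (Fin d₂) ℝ p₂) : Prop where
  adapted : IsAdapted D Q
  form_rep : ∀ a X Y, Q.form (ρ a X) (ρ a Y) = Q.form X Y
  rep_lie : ∀ a X Y, ρ a ⁅X, Y⁆ = ⁅ρ a X, ρ a Y⁆
  sup_eq : p₁ ⊔ p₂ = D.p
  irr₁ : RepIrreducible ρ p₁
  irr₂ : RepIrreducible ρ p₂
  inequiv : ¬ RepEquivalent ρ p₁ p₂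
  on₁ : IsOrthonormalBasis Q e₁
  on₂ : IsOrthonormalBasis Q e₂

/-- The weights of the metric `x₁ Q|𝔭₁ ⊕ x₂ Q|𝔭₂`. -/
def weights (d₁ d₂ : ℕ) (x₁ x₂ : ℝ) : Fin d₁ ⊕ Fin d₂ → ℝ :=
  Sum.elim (fun _ => x₁) (fun _ => x₂)

/-- The form `∑ Q([X, e_i], e_m) Q([Y, e_i], e_m)`. -/
def bracketForm (Q : ScalarProduct L) {W W' : Submodule ℝ L} {ι κ : Type*} [Fintype ι] [Fintype κ]
    (e : Module.Basis ι ℝ W) (e' : Module.Basis κ ℝ W') : LinearMap.BilinForm ℝ L :=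
  LinearMap.mk₂ ℝ (fun X Y => ∑ i, ∑ m, Q.form ⁅X, (e i : L)⁆ (e' m) * Q.form ⁅Y, (e i : L)⁆ (e' m))
    (by intros; simp [add_mul, Finset.sum_add_distrib])
    (by intros; simp [mul_assoc, Finset.mul_sum])
    (by intros; simp [mul_add, Finset.sum_add_distrib])
    (by intros; simp [mul_left_comm, Finset.mul_sum])

theorem bracketForm_apply (Q : ScalarProduct L) {W W' : Submodule ℝ L} {ι κ : Type*} [Fintype ι]
    [Fintype κ] (e : Module.Basis ι ℝ W) (e' : Module.Basis κ ℝ W') (X Y : L) :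
    bracketForm Q e e' X Y
      = ∑ i, ∑ m, Q.form ⁅X, (e i : L)⁆ (e' m) * Q.form ⁅Y, (e i : L)⁆ (e' m) := rfl

theorem bracketForm_comm (Q : ScalarProduct L) {W W' : Submodule ℝ L} {ι κ : Type*} [Fintype ι]
    [Fintype κ] (e : Module.Basis ι ℝ W) (e' : Module.Basis κ ℝ W') (X Y : L) :
    bracketForm Q e e' X Y = bracketForm Q e e' Y X := by
  simp only [bracketForm_apply]
  exact Finset.sum_congr rfl fun _ _ => Finset.sum_congr rfl fun _ _ => mul_comm _ _

theorem bracketForm_swap {D : Decomposition L} {Q : ScalarProduct L} (h : IsAdapted D Q)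
    {W W' : Submodule ℝ L} {ι κ : Type*} [Fintype ι]
    [Fintype κ] (e : Module.Basis ι ℝ W) (e' : Module.Basis κ ℝ W') (X Y : L) :
    bracketForm Q e e' X Y = bracketForm Q e' e X Y := by
  simp only [bracketForm_apply]
  rw [Finset.sum_comm]
  refine Finset.sum_congr rfl fun m _ => Finset.sum_congr rfl fun i _ => ?_
  rw [h.lie X (e i), h.lie Y (e i), Q.symm (e i), Q.symm (e i)]; ring

/-- Trace of a `bracketForm` over an orthonormal basis, as a structure constant. -/
theorem sum_bracketForm (Q : ScalarProduct L) {W W' W'' : Submodule ℝ L} {ι ι' ι'' : Type*}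
    [Fintype ι] [Fintype ι'] [Fintype ι''] (e : Module.Basis ι ℝ W) (e' : Module.Basis ι' ℝ W')
    (e'' : Module.Basis ι'' ℝ W'') :
    ∑ a, bracketForm Q e' e'' (e a) (e a) = structureConstant Q e e' e'' := by
  simp only [bracketForm_apply, structureConstant, sq]

theorem structureConstant_swap (Q : ScalarProduct L) {W W' W'' : Submodule ℝ L} {ι ι' ι'' : Type*}
    [Fintype ι] [Fintype ι'] [Fintype ι''] (e : Module.Basis ι ℝ W) (e' : Module.Basis ι' ℝ W')
    (e'' : Module.Basis ι'' ℝ W'') : structureConstant Q e e' e'' = structureConstant Q e' e e'' := by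
  simp only [structureConstant]
  rw [Finset.sum_comm]
  refine Finset.sum_congr rfl fun j _ => Finset.sum_congr rfl fun i _ =>
    Finset.sum_congr rfl fun k _ => ?_
  rw [← lie_skew, map_neg, LinearMap.neg_apply, neg_sq]

theorem structureConstant_swap' {D : Decomposition L} {Q : ScalarProduct L} (h : IsAdapted D Q)
    {W W' W'' : Submodule ℝ L} {ι ι' ι'' : Type*}
    [Fintype ι] [Fintype ι'] [Fintype ι''] (e : Module.Basis ι ℝ W) (e' : Module.Basis ι' ℝ W')
    (e'' : Module.Basis ι'' ℝ W'') : structureConstant Q e e' e'' = structureConstant Q e e'' e' := by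
  rw [← sum_bracketForm, ← sum_bracketForm]
  exact Finset.sum_congr rfl fun a _ => bracketForm_swap h _ _ _ _

theorem structureConstant_nonneg (Q : ScalarProduct L) {W W' W'' : Submodule ℝ L} {ι ι' ι'' : Type*}
    [Fintype ι] [Fintype ι'] [Fintype ι''] (e : Module.Basis ι ℝ W) (e' : Module.Basis ι' ℝ W')
    (e'' : Module.Basis ι'' ℝ W'') : 0 ≤ structureConstant Q e e' e'' :=
  Finset.sum_nonneg fun _ _ => Finset.sum_nonneg fun _ _ => Finset.sum_nonneg fun _ _ => sq_nonneg _

/-- Moving the group element off `X` and `Y` rotates both orthonormal bases, and sums over an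
orthonormal basis do not see the rotation. -/
theorem bracketForm_rep {ρ : Representation ℝ Γ L} {Q : ScalarProduct L}
    (hQ : ∀ a X Y, Q.form (ρ a X) (ρ a Y) = Q.form X Y)
    (hlie : ∀ a X Y, ρ a ⁅X, Y⁆ = ⁅ρ a X, ρ a Y⁆) {W W' : Submodule ℝ L}
    (hW : ∀ a, ∀ X ∈ W, ρ a X ∈ W) (hW' : ∀ a, ∀ X ∈ W', ρ a X ∈ W') {ι κ : Type*} [Fintype ι]
    [DecidableEq ι] [Fintype κ] [DecidableEq κ] {e : Module.Basis ι ℝ W} {e' : Module.Basis κ ℝ W'}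
    (he : ∀ i j, Q.form (e i : L) (e j : L) = if i = j then 1 else 0)
    (he' : ∀ i j, Q.form (e' i : L) (e' j : L) = if i = j then 1 else 0) (a : Γ) (X Y : L) :
    bracketForm Q e e' (ρ a X) (ρ a Y) = bracketForm Q e e' X Y := by
  simp only [bracketForm_apply]
  have h1 : ∀ X Y Z, Q.form ⁅ρ a X, Y⁆ Z = Q.form ⁅X, ρ a⁻¹ Y⁆ (ρ a⁻¹ Z) := by
    intro X Y Z
    rw [← hQ a ⁅X, ρ a⁻¹ Y⁆, hlie, Representation.apply_inv_apply, Representation.apply_inv_apply]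
  simp only [h1]
  have h2 : ∀ i, ∑ m, Q.form ⁅X, ρ a⁻¹ (e i)⁆ (ρ a⁻¹ (e' m)) * Q.form ⁅Y, ρ a⁻¹ (e i)⁆ (ρ a⁻¹ (e' m))
      = ∑ m, Q.form ⁅X, ρ a⁻¹ (e i)⁆ (e' m) * Q.form ⁅Y, ρ a⁻¹ (e i)⁆ (e' m) := fun i =>
    sum_apply_isometry hQ hW' he' (Q.form ⁅X, ρ a⁻¹ (e i)⁆) (Q.form ⁅Y, ρ a⁻¹ (e i)⁆) a⁻¹
  simp only [h2]
  rw [Finset.sum_comm]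
  conv_rhs => rw [Finset.sum_comm]
  refine Finset.sum_congr rfl fun m _ => ?_
  exact sum_apply_isometry hQ hW he ((Q.form.flip (e' m)) ∘ₗ (LieAlgebra.ad ℝ L X : L →ₗ[ℝ] L))
    ((Q.form.flip (e' m)) ∘ₗ (LieAlgebra.ad ℝ L Y : L →ₗ[ℝ] L)) a⁻¹

namespace TwoSummands

variable {ρ : Representation ℝ Γ L} {D : Decomposition L} {Q : ScalarProduct L}
  {p₁ p₂ : Submodule ℝ L} {d₁ d₂ : ℕ} {e₁ : Module.Basis (Fin d₁) ℝ p₁}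
  {e₂ : Module.Basis (Fin d₂) ℝ p₂} (h : TwoSummands ρ D Q e₁ e₂)

include h

theorem le₁ : p₁ ≤ D.p := h.sup_eq ▸ le_sup_left

theorem le₂ : p₂ ≤ D.p := h.sup_eq ▸ le_sup_right

/-- Orthogonality of the summands is not assumed: it is Schur's lemma for `Q` itself and
inequivalent subspaces. -/
theorem form_eq_zero {X Y : L} (hX : X ∈ p₁) (hY : Y ∈ p₂) : Q.form X Y = 0 :=
  h.irr₁.form_eq_zero h.form_rep h.irr₂ h.inequiv h.on₂ Q.form (fun a X _ Y _ => h.form_rep a X Y)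
    X hX Y hY

theorem orthonormal_elim (i j : Fin d₁ ⊕ Fin d₂) :
    Q.form (Sum.elim (fun i => (e₁ i : L)) (fun i => (e₂ i : L)) i)
      (Sum.elim (fun i => (e₁ i : L)) (fun i => (e₂ i : L)) j) = if i = j then 1 else 0 := by
  rcases i with i | i <;> rcases j with j | j
  · simp [h.on₁ i j]
  · simp [h.form_eq_zero (e₁ i).2 (e₂ j).2]
  · simp [Q.symm (e₂ i), h.form_eq_zero (e₁ j).2 (e₂ i).2]
  · simp [h.on₂ i j]

/-- The orthonormal basis of `𝔭` formed by those of `𝔭₁` and `𝔭₂`. -/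
def basis : Module.Basis (Fin d₁ ⊕ Fin d₂) ℝ D.p :=
  Module.Basis.mk
    (v := fun i : Fin d₁ ⊕ Fin d₂ => (⟨Sum.elim (fun i => (e₁ i : L)) (fun i => (e₂ i : L)) i, by
      rcases i with i | i
      · exact h.le₁ (e₁ i).2
      · exact h.le₂ (e₂ i).2⟩ : D.p))
    (by
      rw [Fintype.linearIndependent_iff]
      intro c hc i
      have h1 := congrArg (fun X : D.p => Q.form (X : L)
        (Sum.elim (fun i => (e₁ i : L)) (fun i => (e₂ i : L)) i)) hc
      simp only [AddSubmonoidClass.coe_finsetSum, SetLike.val_smul, map_sum, map_smul,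
        LinearMap.sum_apply, LinearMap.smul_apply, h.orthonormal_elim] at h1
      simpa using h1)
    (by
      rintro ⟨X, hX⟩ -
      have hX' := hX
      rw [← h.sup_eq, Submodule.mem_sup] at hX'
      obtain ⟨Y, hY, Z, hZ, rfl⟩ := hX'
      have e : (⟨Y + Z, hX⟩ : D.p) = ∑ i, Q.form Y (e₁ i) • (⟨e₁ i, h.le₁ (e₁ i).2⟩ : D.p)
          + ∑ i, Q.form Z (e₂ i) • (⟨e₂ i, h.le₂ (e₂ i).2⟩ : D.p) := by
        apply Subtype.ext
        simp only [Submodule.coe_add, AddSubmonoidClass.coe_finsetSum, SetLike.val_smul]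
        rw [← IsOrthonormalBasis.form_sum h.on₁ hY, ← IsOrthonormalBasis.form_sum h.on₂ hZ]
      rw [e]
      exact Submodule.add_mem _
        (Submodule.sum_mem _ fun i _ => Submodule.smul_mem _ _ (Submodule.subset_span ⟨Sum.inl i, rfl⟩))
        (Submodule.sum_mem _ fun i _ => Submodule.smul_mem _ _ (Submodule.subset_span ⟨Sum.inr i, rfl⟩)))

theorem basis_inl (i : Fin d₁) : (h.basis (Sum.inl i) : L) = e₁ i := by
  simp [basis]

theorem basis_inr (i : Fin d₂) : (h.basis (Sum.inr i) : L) = e₂ i := by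
  simp [basis]

theorem orthonormal_basis (i j : Fin d₁ ⊕ Fin d₂) :
    Q.form (h.basis i : L) (h.basis j : L) = if i = j then 1 else 0 := by
  rw [← h.orthonormal_elim i j]
  simp [basis]

theorem pos₁ : 0 < d₁ := by
  rcases Nat.eq_zero_or_pos d₁ with h0 | h0
  · subst h0
    exact absurd (by
      rw [Submodule.eq_bot_iff]
      intro X hX
      rw [IsOrthonormalBasis.form_sum h.on₁ hX]; simp) h.irr₁.2.1
  · exact h0

theorem pos₂ : 0 < d₂ := by
  rcases Nat.eq_zero_or_pos d₂ with h0 | h0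
  · subst h0
    exact absurd (by
      rw [Submodule.eq_bot_iff]
      intro X hX
      rw [IsOrthonormalBasis.form_sum h.on₂ hX]; simp) h.irr₂.2.1
  · exact h0

/-- An invariant symmetric form on `𝔭` is diagonal. -/
theorem exists_weights (β : LinearMap.BilinForm ℝ L) (hβ : ∀ X Y, β X Y = β Y X)
    (hinv : ∀ a, ∀ X ∈ D.p, ∀ Y ∈ D.p, β (ρ a X) (ρ a Y) = β X Y) :
    ∃ x₁ x₂ : ℝ, ∀ i j, β (h.basis i) (h.basis j) = if i = j then weights d₁ d₂ x₁ x₂ i else 0 := by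
  obtain ⟨x₁, h₁⟩ := h.irr₁.exists_eq_mul h.form_rep h.on₁ β (fun X _ Y _ => hβ X Y)
    (fun a X hX Y hY => hinv a X (h.le₁ hX) Y (h.le₁ hY))
  obtain ⟨x₂, h₂⟩ := h.irr₂.exists_eq_mul h.form_rep h.on₂ β (fun X _ Y _ => hβ X Y)
    (fun a X hX Y hY => hinv a X (h.le₂ hX) Y (h.le₂ hY))
  have h₃ := h.irr₁.form_eq_zero h.form_rep h.irr₂ h.inequiv h.on₂ β
    (fun a X hX Y hY => hinv a X (h.le₁ hX) Y (h.le₂ hY))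
  refine ⟨x₁, x₂, fun i j => ?_⟩
  rcases i with i | i <;> rcases j with j | j
  · rw [h.basis_inl, h.basis_inl, h₁ _ (e₁ i).2 _ (e₁ j).2, h.on₁ i j]
    simp [weights]
  · rw [h.basis_inl, h.basis_inr, h₃ _ (e₁ i).2 _ (e₂ j).2]
    simp
  · rw [h.basis_inl, h.basis_inr, hβ, h₃ _ (e₁ j).2 _ (e₂ i).2]
    simp
  · rw [h.basis_inr, h.basis_inr, h₂ _ (e₂ i).2 _ (e₂ j).2, h.on₂ i j]
    simp [weights]

omit h in
theorem sum_diag {f : Fin d₁ ⊕ Fin d₂ → Fin d₁ ⊕ Fin d₂ → ℝ} {x₁ x₂ : ℝ}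
    (hf : ∀ i j, f i j = if i = j then weights d₁ d₂ x₁ x₂ i else 0) :
    ∑ i, f (Sum.inl i) (Sum.inl i) = d₁ * x₁ ∧ ∑ i, f (Sum.inr i) (Sum.inr i) = d₂ * x₂ := by
  simp [hf, weights]

/-- The `bracketForm`s are diagonal. -/
theorem bracketForm_basis {W W' : Submodule ℝ L}
    (hW : ∀ a, ∀ X ∈ W, ρ a X ∈ W) (hW' : ∀ a, ∀ X ∈ W', ρ a X ∈ W') {m n : ℕ}
    {e : Module.Basis (Fin m) ℝ W} {e' : Module.Basis (Fin n) ℝ W'}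
    (he : IsOrthonormalBasis Q e) (he' : IsOrthonormalBasis Q e') (i j : Fin d₁ ⊕ Fin d₂) :
    bracketForm Q e e' (h.basis i) (h.basis j) = if i = j then
      weights d₁ d₂ (structureConstant Q e₁ e e' / d₁) (structureConstant Q e₂ e e' / d₂) i
      else 0 := by
  obtain ⟨x₁, x₂, hx⟩ := h.exists_weights (bracketForm Q e e') (bracketForm_comm Q e e')
    (fun a X _ Y _ => bracketForm_rep h.form_rep h.rep_lie hW hW' he he' a X Y)
  -- Taking the trace over each summand identifies the two Schur multiples: `dᵢ` times the multiple
  -- is a structure constant.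
  obtain ⟨h1, h2⟩ := sum_diag hx
  simp only [h.basis_inl, h.basis_inr] at h1 h2
  rw [sum_bracketForm] at h1 h2
  have := h.pos₁
  have := h.pos₂
  rw [hx, h1, h2, mul_div_cancel_left₀ _ (by positivity), mul_div_cancel_left₀ _ (by positivity)]

theorem strConst_mul (i a b m : Fin d₁ ⊕ Fin d₂) :
    strConst Q h.basis i a m * strConst Q h.basis i b m
      = Q.form ⁅(h.basis a : L), (h.basis i : L)⁆ (h.basis m)
        * Q.form ⁅(h.basis b : L), (h.basis i : L)⁆ (h.basis m) := by
  rw [strConst_swap a i, strConst_swap b i]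
  simp only [strConst, neg_mul_neg]

/-- Block form of the quadratic sums of structure constants. -/
theorem sum_strConst_mul (w : Fin d₁ ⊕ Fin d₂ → Fin d₁ ⊕ Fin d₂ → ℝ) (w₁₁ w₁₂ w₂₁ w₂₂ : ℝ)
    (h₁₁ : ∀ i j, w (.inl i) (.inl j) = w₁₁) (h₁₂ : ∀ i j, w (.inl i) (.inr j) = w₁₂)
    (h₂₁ : ∀ i j, w (.inr i) (.inl j) = w₂₁) (h₂₂ : ∀ i j, w (.inr i) (.inr j) = w₂₂)
    (a b : Fin d₁ ⊕ Fin d₂) :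
    ∑ i, ∑ m, strConst Q h.basis i a m * strConst Q h.basis i b m * w i m
      = bracketForm Q e₁ e₁ (h.basis a) (h.basis b) * w₁₁
        + bracketForm Q e₁ e₂ (h.basis a) (h.basis b) * (w₁₂ + w₂₁)
        + bracketForm Q e₂ e₂ (h.basis a) (h.basis b) * w₂₂ := by
  rw [mul_add, ← add_assoc]
  nth_rw 2 [bracketForm_swap h.adapted e₁ e₂]
  simp only [h.strConst_mul, Fintype.sum_sum_type, h₁₁, h₁₂, h₂₁, h₂₂, h.basis_inl, h.basis_inr,
    bracketForm_apply, Finset.sum_mul, Finset.sum_add_distrib]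
  ring

/-- The constants `[111]/d₁, …` on the diagonal of the Ricci tensor. -/
def _root_.HRF.ricciWeight (d₁ b₁ c₁₁₁ c₁₁₂ c₁₂₂ y : ℝ) : ℝ :=
  1 / 2 * ((b₁ - c₁₁₁ / (2 * d₁) - c₁₂₂ / d₁) - c₁₁₂ / d₁ / y + c₁₂₂ / (2 * d₁) * y ^ 2)

theorem killingForm_rep (a : Γ) (X Y : L) :
    killingForm ℝ L (ρ a X) (ρ a Y) = killingForm ℝ L X Y := by
  let φ : L ≃ₗ⁅ℝ⁆ L :=
    { toFun := ρ a
      map_add' := map_add _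
      map_smul' := map_smul _
      map_lie' := h.rep_lie a _ _
      invFun := ρ a⁻¹
      left_inv := Representation.inv_apply_apply a
      right_inv := Representation.apply_inv_apply a }
  exact LieAlgebra.killingForm_of_equiv_apply φ X Y

theorem isotropyForm_nonneg (a : Fin d₁ ⊕ Fin d₂) : 0 ≤ isotropyForm Q h.basis a a := by
  refine Finset.sum_nonneg fun i _ => ?_
  by_cases h0 : (projK D ⁅(h.basis i : L), (h.basis a : L)⁆ : L) = 0
  · rw [h0]; simp
  · exact (Q.pos _ h0).le

variable [FiniteDimensional ℝ L] {b₁ b₂ : ℝ}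
    (hb₁ : ∀ X ∈ p₁, ∀ Y ∈ p₁, -killingForm ℝ L X Y = b₁ * Q.form X Y)
    (hb₂ : ∀ X ∈ p₂, ∀ Y ∈ p₂, -killingForm ℝ L X Y = b₂ * Q.form X Y)

include hb₁ hb₂

omit [FiniteDimensional ℝ L] in
theorem killingForm_eq (a b : Fin d₁ ⊕ Fin d₂) :
    -killingForm ℝ L (h.basis a) (h.basis b) = if a = b then weights d₁ d₂ b₁ b₂ a else 0 := by
  have hsymm : ∀ X Y, killingForm ℝ L X Y = killingForm ℝ L Y X := fun X Y =>
    LieModule.traceForm_comm ℝ L L X Y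
  have h₃ := h.irr₁.form_eq_zero h.form_rep h.irr₂ h.inequiv h.on₂ (killingForm ℝ L)
    (fun a X _ Y _ => h.killingForm_rep a X Y)
  rcases a with i | i <;> rcases b with j | j
  · rw [h.basis_inl, h.basis_inl, hb₁ _ (e₁ i).2 _ (e₁ j).2, h.on₁ i j]
    simp [weights]
  · rw [h.basis_inl, h.basis_inr, h₃ _ (e₁ i).2 _ (e₂ j).2]
    simp
  · rw [h.basis_inl, h.basis_inr, hsymm, h₃ _ (e₁ j).2 _ (e₂ i).2]
    simp
  · rw [h.basis_inr, h.basis_inr, hb₂ _ (e₂ i).2 _ (e₂ j).2, h.on₂ i j]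
    simp [weights]

/-- The Killing identity solved for the isotropy form. It removes 𝔨 from the Ricci formula in favour
of `b₁`, `b₂` and the brackets. -/
theorem isotropyForm_eq (a b : Fin d₁ ⊕ Fin d₂) :
    2 * isotropyForm Q h.basis a b = (if a = b then weights d₁ d₂ b₁ b₂ a else 0)
      - bracketForm Q e₁ e₁ (h.basis a) (h.basis b)
      - 2 * bracketForm Q e₁ e₂ (h.basis a) (h.basis b)
      - bracketForm Q e₂ e₂ (h.basis a) (h.basis b) := by
  have h1 := h.adapted.killingForm_basis h.orthonormal_basis a b
  have h2 := h.sum_strConst_mul (fun _ _ => 1) 1 1 1 1 (fun _ _ => rfl) (fun _ _ => rfl)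
    (fun _ _ => rfl) (fun _ _ => rfl) a b
  simp only [mul_one] at h2
  rw [h.killingForm_eq hb₁ hb₂, h2] at h1
  rw [h1]; ring

/-- The Ricci tensor of the metric `x₁ Q|𝔭₁ ⊕ x₂ Q|𝔭₂`. -/
theorem ricci_weights {g : ScalarProduct D.p} {x₁ x₂ : ℝ} (hx₁ : 0 < x₁) (hx₂ : 0 < x₂)
    (hg : IsDiagonal g h.basis (weights d₁ d₂ x₁ x₂)) (a b : Fin d₁ ⊕ Fin d₂) :
    ricci D g (h.basis a) (h.basis b) = if a = b then weights d₁ d₂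
      (ricciWeight d₁ b₁ (structureConstant Q e₁ e₁ e₁) (structureConstant Q e₁ e₁ e₂)
        (structureConstant Q e₁ e₂ e₂) (x₁ / x₂))
      (ricciWeight d₂ b₂ (structureConstant Q e₂ e₂ e₂) (structureConstant Q e₁ e₂ e₂)
        (structureConstant Q e₁ e₁ e₂) (x₂ / x₁)) a else 0 := by
  have hd₁ := h.pos₁
  have hd₂ := h.pos₂
  have hd₁' : (d₁ : ℝ) ≠ 0 := by positivity
  have hd₂' : (d₂ : ℝ) ≠ 0 := by positivity
  have hk := h.isotropyForm_eq hb₁ hb₂ a b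
  have F₁₁ := h.bracketForm_basis h.irr₁.1 h.irr₁.1 h.on₁ h.on₁ a b
  have F₁₂ := h.bracketForm_basis h.irr₁.1 h.irr₂.1 h.on₁ h.on₂ a b
  have F₂₂ := h.bracketForm_basis h.irr₂.1 h.irr₂.1 h.on₂ h.on₂ a b
  -- Total symmetry of [ijk] reduces [211] and [212] to [112] and [122].
  rw [structureConstant_swap Q e₂ e₁ e₁, structureConstant_swap' h.adapted e₁ e₂ e₁] at F₁₁
  rw [structureConstant_swap Q e₂ e₁ e₂] at F₁₂
  rw [F₁₁, F₁₂, F₂₂] at hk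
  rw [h.adapted.ricci_basis h.orthonormal_basis hg]
  have hw := fun w : ℝ → ℝ → ℝ => h.sum_strConst_mul (fun i m =>
    (1 / 2 * (weights d₁ d₂ x₁ x₂ i + weights d₁ d₂ x₁ x₂ b - weights d₁ d₂ x₁ x₂ m)
      / weights d₁ d₂ x₁ x₂ i - 1 / 4 * (weights d₁ d₂ x₁ x₂ m + weights d₁ d₂ x₁ x₂ b
      - weights d₁ d₂ x₁ x₂ i) * (weights d₁ d₂ x₁ x₂ i + weights d₁ d₂ x₁ x₂ m
      - weights d₁ d₂ x₁ x₂ a) / (weights d₁ d₂ x₁ x₂ m * weights d₁ d₂ x₁ x₂ i)))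
    (w x₁ x₁) (w x₁ x₂) (w x₂ x₁) (w x₂ x₂)
  have hw' := hw (fun xi xm => 1 / 2 * (xi + weights d₁ d₂ x₁ x₂ b - xm) / xi
    - 1 / 4 * (xm + weights d₁ d₂ x₁ x₂ b - xi) * (xi + xm - weights d₁ d₂ x₁ x₂ a) / (xm * xi))
    (fun _ _ => rfl) (fun _ _ => rfl) (fun _ _ => rfl) (fun _ _ => rfl) a b
  rw [hw', F₁₁, F₁₂, F₂₂]
  by_cases hab : a = b
  · subst hab
    simp only [if_true] at hk ⊢
    rcases a with a | a
    · simp only [weights, Sum.elim_inl] at hk ⊢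
      simp only [ricciWeight]
      field_simp at hk ⊢
      linear_combination (8 * x₁ * x₂ ^ 2) * hk
    · simp only [weights, Sum.elim_inr] at hk ⊢
      simp only [ricciWeight]
      field_simp at hk ⊢
      linear_combination (8 * x₂ * x₁ ^ 2) * hk
  · simp only [if_neg hab] at hk ⊢
    linarith

/-- This is A₁ ≥ 2B₁. The isotropy form is nonnegative, so b₁ ≥ ([111] + 2[112] + [122])/d₁, and A₁
subtracts only half of the term [111]/d₁. -/
theorem two_mul_le₁ : 2 * (structureConstant Q e₁ e₁ e₂ / d₁)
    ≤ b₁ - structureConstant Q e₁ e₁ e₁ / (2 * d₁) - structureConstant Q e₁ e₂ e₂ / d₁ := by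
  have hd := h.pos₁
  have hk := h.isotropyForm_eq hb₁ hb₂ (.inl ⟨0, hd⟩) (.inl ⟨0, hd⟩)
  have hn := h.isotropyForm_nonneg (.inl ⟨0, hd⟩)
  rw [h.bracketForm_basis h.irr₁.1 h.irr₁.1 h.on₁ h.on₁,
    h.bracketForm_basis h.irr₁.1 h.irr₂.1 h.on₁ h.on₂,
    h.bracketForm_basis h.irr₂.1 h.irr₂.1 h.on₂ h.on₂] at hk
  simp only [if_true, weights, Sum.elim_inl] at hk
  have h1 : 0 ≤ structureConstant Q e₁ e₁ e₁ / d₁ :=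
    div_nonneg (structureConstant_nonneg _ _ _ _) (by positivity)
  have h2 : structureConstant Q e₁ e₁ e₁ / (2 * d₁) = structureConstant Q e₁ e₁ e₁ / d₁ / 2 := by
    rw [div_div, mul_comm]
  rw [h2]; linarith

theorem two_mul_le₂ : 2 * (structureConstant Q e₁ e₂ e₂ / d₂)
    ≤ b₂ - structureConstant Q e₂ e₂ e₂ / (2 * d₂) - structureConstant Q e₁ e₁ e₂ / d₂ := by
  have hd := h.pos₂
  have hk := h.isotropyForm_eq hb₁ hb₂ (.inr ⟨0, hd⟩) (.inr ⟨0, hd⟩)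
  have hn := h.isotropyForm_nonneg (.inr ⟨0, hd⟩)
  rw [h.bracketForm_basis h.irr₁.1 h.irr₁.1 h.on₁ h.on₁,
    h.bracketForm_basis h.irr₁.1 h.irr₂.1 h.on₁ h.on₂,
    h.bracketForm_basis h.irr₂.1 h.irr₂.1 h.on₂ h.on₂] at hk
  simp only [if_true, weights, Sum.elim_inr] at hk
  rw [structureConstant_swap Q e₂ e₁ e₁, structureConstant_swap' h.adapted e₁ e₂ e₁,
    structureConstant_swap Q e₂ e₁ e₂] at hk
  have h1 : 0 ≤ structureConstant Q e₂ e₂ e₂ / d₂ :=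
    div_nonneg (structureConstant_nonneg _ _ _ _) (by positivity)
  have h2 : structureConstant Q e₂ e₂ e₂ / (2 * d₂) = structureConstant Q e₂ e₂ e₂ / d₂ / 2 := by
    rw [div_div, mul_comm]
  rw [h2]; linarith

end TwoSummands

end TwoSummands


/-! ### Maximality of the isotropy, and diagonal metrics -/

namespace TwoSummands

variable {L : Type*} [LieRing L] [LieAlgebra ℝ L] {Γ : Type*} [Group Γ]
  {ρ : Representation ℝ Γ L} {D : Decomposition L} {Q : ScalarProduct L}
  {p₁ p₂ : Submodule ℝ L} {d₁ d₂ : ℕ} {e₁ : Module.Basis (Fin d₁) ℝ p₁}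
  {e₂ : Module.Basis (Fin d₂) ℝ p₂} (h : TwoSummands ρ D Q e₁ e₂)

include h

theorem mem₁_of_orthogonal {X : L} (hX : X ∈ D.p) (h0 : ∀ Z ∈ p₂, Q.form X Z = 0) : X ∈ p₁ := by
  rw [← h.sup_eq, Submodule.mem_sup] at hX
  obtain ⟨Y, hY, Z, hZ, rfl⟩ := hX
  have h1 := h0 Z hZ
  rw [map_add, LinearMap.add_apply, h.form_eq_zero hY hZ, zero_add] at h1
  have h2 : Z = 0 := by
    by_contra hne
    exact (Q.pos Z hne).ne' h1
  rw [h2, add_zero]; exact hY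

/-- If `𝔨` is maximal then `[𝔭₁, 𝔭₁]` has a nonzero component in `𝔭₂`. -/
theorem structureConstant_pos
    (hmax : ∀ 𝔥 : LieSubalgebra ℝ L, D.k ≤ 𝔥 → (∀ a, ∀ X ∈ 𝔥, ρ a X ∈ 𝔥) → 𝔥 = D.k ∨ 𝔥 = ⊤)
    (hk : ∀ W ∈ D.k, ∀ X ∈ p₁, ⁅W, X⁆ ∈ p₁) : 0 < structureConstant Q e₁ e₁ e₂ := by
  refine lt_of_le_of_ne (structureConstant_nonneg Q e₁ e₁ e₂) fun h0 => ?_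
  have hz : ∀ i j k, Q.form ⁅(e₁ i : L), (e₁ j : L)⁆ (e₂ k) = 0 := by
    intro i j k
    have h1 := (Finset.sum_eq_zero_iff_of_nonneg fun i _ => Finset.sum_nonneg fun j _ =>
      Finset.sum_nonneg fun k _ => sq_nonneg _).1 h0.symm i (Finset.mem_univ _)
    have h2 := (Finset.sum_eq_zero_iff_of_nonneg fun j _ =>
      Finset.sum_nonneg fun k _ => sq_nonneg _).1 h1 j (Finset.mem_univ _)
    have h3 := (Finset.sum_eq_zero_iff_of_nonneg fun k _ => sq_nonneg _).1 h2 k (Finset.mem_univ _)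
    exact pow_eq_zero_iff two_ne_zero |>.1 h3
  have hz' : ∀ X ∈ p₁, ∀ Y ∈ p₁, ∀ Z ∈ p₂, Q.form ⁅X, Y⁆ Z = 0 := by
    intro X hX Y hY Z hZ
    rw [IsOrthonormalBasis.form_sum h.on₁ hX, IsOrthonormalBasis.form_sum h.on₁ hY,
      IsOrthonormalBasis.form_sum h.on₂ hZ]
    simp [sum_lie, lie_sum, hz]
  have hdec : ∀ X : L, (∀ Z ∈ p₂, Q.form X Z = 0) → ∃ W ∈ D.k, ∃ Y ∈ p₁, X = W + Y := by
    intro X hX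
    refine ⟨projK D X, (projK D X).2, projP D X, ?_, ?_⟩
    · refine h.mem₁_of_orthogonal (projP D X).2 fun Z hZ => ?_
      rw [h.adapted.form_projP_left X (h.le₂ hZ), hX Z hZ]
    · rw [add_comm, projP_add_projK]
  have hk2 : ∀ W ∈ D.k, ∀ Z ∈ p₂, Q.form W Z = 0 := fun W hW Z hZ =>
    h.adapted.orth W hW Z (h.le₂ hZ)
  -- The orthogonal complement of 𝔭₂, which equals 𝔨 ⊕ 𝔭₁. It is closed under brackets because [𝔭₁,
  -- 𝔭₁] has no 𝔭₂-component; it differs from 𝔨 as 𝔭₁ ≠ 0 and from 𝔤 as 𝔭₂ ≠ 0.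
  let 𝔥 : LieSubalgebra ℝ L :=
    { carrier := {X | ∀ Z ∈ p₂, Q.form X Z = 0}
      add_mem' := fun {X Y} hX hY Z hZ => by
        rw [map_add, LinearMap.add_apply, hX Z hZ, hY Z hZ, add_zero]
      zero_mem' := fun Z _ => by simp
      smul_mem' := fun r X hX Z hZ => by
        rw [map_smul, LinearMap.smul_apply, hX Z hZ, smul_zero]
      lie_mem' := fun {X Y} hX hY Z hZ => by
        obtain ⟨W, hW, X', hX', rfl⟩ := hdec X hX
        obtain ⟨W', hW', Y', hY', rfl⟩ := hdec Y hY
        have e1 : Q.form ⁅X', W'⁆ Z = 0 := by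
          rw [← lie_skew, map_neg, LinearMap.neg_apply, h.form_eq_zero (hk W' hW' X' hX') hZ,
            neg_zero]
        simp only [add_lie, lie_add, map_add, LinearMap.add_apply]
        rw [hk2 _ (D.k.lie_mem hW hW') Z hZ, h.form_eq_zero (hk W hW Y' hY') hZ, e1,
          hz' X' hX' Y' hY' Z hZ]
        simp }
  have h𝔥 : ∀ X, X ∈ 𝔥 ↔ ∀ Z ∈ p₂, Q.form X Z = 0 := fun X => Iff.rfl
  rcases hmax 𝔥 (fun W hW => hk2 W hW) (fun a X hX Z hZ => by
    rw [← Representation.apply_inv_apply (ρ := ρ) a Z, h.form_rep]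
    exact hX _ (h.irr₂.1 a⁻¹ Z hZ)) with h1 | h1
  · have hne := h.irr₁.2.1
    obtain ⟨X, hX, hX0⟩ := Submodule.exists_mem_ne_zero_of_ne_bot hne
    have h2 : X ∈ 𝔥 := fun Z hZ => h.form_eq_zero hX hZ
    rw [h1] at h2
    exact (Q.pos X hX0).ne' (h.adapted.orth X h2 X (h.le₁ hX))
  · have hne := h.irr₂.2.1
    obtain ⟨X, hX, hX0⟩ := Submodule.exists_mem_ne_zero_of_ne_bot hne
    have h2 : X ∈ 𝔥 := by rw [h1]; trivial
    exact (Q.pos X hX0).ne' ((h𝔥 X).1 h2 X hX)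

theorem repr_add₁ {X : D.p} {X₁ X₂ : L} (hX₁ : X₁ ∈ p₁) (hX₂ : X₂ ∈ p₂) (hX : (X : L) = X₁ + X₂) :
    (∀ i, h.basis.repr X (.inl i) = Q.form X₁ (e₁ i)) ∧
      ∀ i, h.basis.repr X (.inr i) = Q.form X₂ (e₂ i) := by
  refine ⟨fun i => ?_, fun i => ?_⟩
  · rw [repr_eq_form h.orthonormal_basis, h.basis_inl, hX, map_add, LinearMap.add_apply,
      Q.symm X₂, h.form_eq_zero (e₁ i).2 hX₂, add_zero]
  · rw [repr_eq_form h.orthonormal_basis, h.basis_inr, hX, map_add, LinearMap.add_apply,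
      h.form_eq_zero hX₁ (e₂ i).2, zero_add]

/-- Diagonal forms in terms of the decomposition `𝔭 = 𝔭₁ ⊕ 𝔭₂`. -/
theorem sum_weights (x₁ x₂ : ℝ) {X Y : D.p} {X₁ Y₁ X₂ Y₂ : L} (hX₁ : X₁ ∈ p₁) (hY₁ : Y₁ ∈ p₁)
    (hX₂ : X₂ ∈ p₂) (hY₂ : Y₂ ∈ p₂) (hX : (X : L) = X₁ + X₂) (hY : (Y : L) = Y₁ + Y₂) :
    ∑ i, weights d₁ d₂ x₁ x₂ i * (h.basis.repr X i * h.basis.repr Y i)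
      = x₁ * Q.form X₁ Y₁ + x₂ * Q.form X₂ Y₂ := by
  obtain ⟨a1, a2⟩ := h.repr_add₁ hX₁ hX₂ hX
  obtain ⟨b1, b2⟩ := h.repr_add₁ hY₁ hY₂ hY
  simp only [Fintype.sum_sum_type, a1, a2, b1, b2, weights, Sum.elim_inl, Sum.elim_inr]
  rw [← Finset.mul_sum, ← Finset.mul_sum, ← IsOrthonormalBasis.parseval h.on₁ hX₁,
    ← IsOrthonormalBasis.parseval h.on₂ hX₂]

omit h in
theorem _root_.HRF.bilin_eq_sum {ι V : Type*} [Fintype ι] [DecidableEq ι] [AddCommGroup V]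
    [Module ℝ V] (e : Module.Basis ι ℝ V) {w : ι → ℝ} {B : V → V → ℝ}
    (hB : ∀ X Y, B X Y = ∑ a, ∑ b, e.repr X a * e.repr Y b * B (e a) (e b))
    (hw : ∀ a b, B (e a) (e b) = if a = b then w a else 0) (X Y : V) :
    B X Y = ∑ i, w i * (e.repr X i * e.repr Y i) := by
  rw [hB]
  refine Finset.sum_congr rfl fun a _ => ?_
  simp [hw]; ring

omit h in
theorem _root_.HRF.form_bilin {ι V : Type*} [Fintype ι] [AddCommGroup V] [Module ℝ V]
    (B : LinearMap.BilinForm ℝ V) (e : Module.Basis ι ℝ V) (X Y : V) :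
    B X Y = ∑ a, ∑ b, e.repr X a * e.repr Y b * B (e a) (e b) := by
  conv_rhs => rw [Finset.sum_comm]
  conv_lhs => rw [← e.sum_repr X, ← e.sum_repr Y]
  simp only [map_sum, LinearMap.sum_apply, map_smul, LinearMap.smul_apply, smul_eq_mul]
  refine Finset.sum_congr rfl fun b _ => ?_
  rw [Finset.mul_sum]
  exact Finset.sum_congr rfl fun a _ => by ring

theorem isDiagonal_iff (g : ScalarProduct D.p) (x₁ x₂ : ℝ) :
    IsDiagonal g h.basis (weights d₁ d₂ x₁ x₂) ↔
      ∀ X Y : D.p, ∀ X₁ ∈ p₁, ∀ Y₁ ∈ p₁, ∀ X₂ ∈ p₂, ∀ Y₂ ∈ p₂,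
        (X : L) = X₁ + X₂ → (Y : L) = Y₁ + Y₂ →
          g.form X Y = x₁ * Q.form X₁ Y₁ + x₂ * Q.form X₂ Y₂ := by
  constructor
  · intro hg X Y X₁ hX₁ Y₁ hY₁ X₂ hX₂ Y₂ hY₂ hX hY
    rw [← h.sum_weights x₁ x₂ hX₁ hY₁ hX₂ hY₂ hX hY]
    exact bilin_eq_sum h.basis (form_bilin g.form h.basis) hg X Y
  · intro hg i j
    rcases i with i | i <;> rcases j with j | j
    · rw [hg _ _ _ (e₁ i).2 _ (e₁ j).2 0 p₂.zero_mem 0 p₂.zero_mem (by simp [h.basis_inl])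
        (by simp [h.basis_inl]), h.on₁ i j]
      simp [weights]
    · rw [hg _ _ _ (e₁ i).2 0 p₁.zero_mem 0 p₂.zero_mem _ (e₂ j).2 (by simp [h.basis_inl])
        (by simp [h.basis_inr])]
      simp
    · rw [hg _ _ 0 p₁.zero_mem _ (e₁ j).2 _ (e₂ i).2 0 p₂.zero_mem (by simp [h.basis_inr])
        (by simp [h.basis_inl])]
      simp
    · rw [hg _ _ 0 p₁.zero_mem 0 p₁.zero_mem _ (e₂ i).2 _ (e₂ j).2 (by simp [h.basis_inr])
        (by simp [h.basis_inr]), h.on₂ i j]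
      simp [weights]

/-- The metric `x₁ Q|𝔭₁ ⊕ x₂ Q|𝔭₂`. -/
def metric {x₁ x₂ : ℝ} (hx₁ : 0 < x₁) (hx₂ : 0 < x₂) : ScalarProduct D.p where
  form := ∑ i, weights d₁ d₂ x₁ x₂ i • (h.basis.coord i).smulRight (h.basis.coord i)
  symm X Y := by
    simp only [LinearMap.sum_apply, LinearMap.smul_apply, LinearMap.smulRight_apply, smul_eq_mul]
    exact Finset.sum_congr rfl fun i _ => by ring
  pos X hX := by
    have hw : ∀ i, 0 < weights d₁ d₂ x₁ x₂ i := by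
      rintro (i | i) <;> simpa [weights]
    simp only [LinearMap.sum_apply, LinearMap.smul_apply, LinearMap.smulRight_apply, smul_eq_mul]
    refine Finset.sum_pos' (fun i _ => mul_nonneg (hw i).le (mul_self_nonneg _)) ?_
    by_contra hn
    push Not at hn
    apply hX
    apply h.basis.repr.injective
    ext i
    have h1 := hn i (Finset.mem_univ _)
    have h2 : h.basis.coord i X * h.basis.coord i X = 0 := by
      refine le_antisymm ?_ (mul_self_nonneg _)
      by_contra h3
      push Not at h3
      exact absurd (mul_pos (hw i) h3) (not_lt.2 h1)
    simpa using h2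

theorem metric_isDiagonal {x₁ x₂ : ℝ} (hx₁ : 0 < x₁) (hx₂ : 0 < x₂) :
    IsDiagonal (h.metric hx₁ hx₂) h.basis (weights d₁ d₂ x₁ x₂) := by
  intro i j
  have h1 : (h.metric hx₁ hx₂).form (h.basis i) (h.basis j) = ∑ c, weights d₁ d₂ x₁ x₂ c *
      (h.basis.coord c (h.basis i) * h.basis.coord c (h.basis j)) := by
    simp only [metric, LinearMap.sum_apply, LinearMap.smul_apply, LinearMap.smulRight_apply,
      smul_eq_mul]
  rw [h1, Finset.sum_eq_single i]
  · simp [Finsupp.single_apply, eq_comm]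
  · intro c _ hc
    simp [Finsupp.single_apply, hc.symm]
  · simp

theorem metric_form_rep {x₁ x₂ : ℝ} {g : ScalarProduct D.p}
    (hg : IsDiagonal g h.basis (weights d₁ d₂ x₁ x₂)) (a : Γ)
    (X Y X' Y' : D.p) (hX : (X' : L) = ρ a X) (hY : (Y' : L) = ρ a Y) :
    g.form X' Y' = g.form X Y := by
  have hg' := (h.isDiagonal_iff _ x₁ x₂).1 hg
  have hd : ∀ X : D.p, ∃ X₁ ∈ p₁, ∃ X₂ ∈ p₂, X₁ + X₂ = (X : L) := fun X => by
    have : (X : L) ∈ p₁ ⊔ p₂ := by rw [h.sup_eq]; exact X.2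
    rwa [Submodule.mem_sup] at this
  obtain ⟨X₁, hX₁, X₂, hX₂, eX⟩ := hd X
  obtain ⟨Y₁, hY₁, Y₂, hY₂, eY⟩ := hd Y
  rw [hg' X Y X₁ hX₁ Y₁ hY₁ X₂ hX₂ Y₂ hY₂ eX.symm eY.symm,
    hg' X' Y' _ (h.irr₁.1 a X₁ hX₁) _ (h.irr₁.1 a Y₁ hY₁) _ (h.irr₂.1 a X₂ hX₂) _
      (h.irr₂.1 a Y₂ hY₂) (by rw [hX, ← eX, map_add]) (by rw [hY, ← eY, map_add]),
    h.form_rep, h.form_rep]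

/-- Every invariant scalar product is diagonal with positive weights. -/
theorem exists_isDiagonal (g : ScalarProduct D.p) (hinv : ∀ a, ∀ X Y X' Y' : D.p,
    (X' : L) = ρ a X → (Y' : L) = ρ a Y → g.form X' Y' = g.form X Y) :
    ∃ x₁ x₂ : ℝ, 0 < x₁ ∧ 0 < x₂ ∧ IsDiagonal g h.basis (weights d₁ d₂ x₁ x₂) := by
  have hmem : ∀ a, ∀ X ∈ D.p, ρ a X ∈ D.p := by
    intro a X hX
    rw [← h.sup_eq, Submodule.mem_sup] at hX ⊢
    obtain ⟨Y, hY, Z, hZ, rfl⟩ := hX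
    exact ⟨_, h.irr₁.1 a Y hY, _, h.irr₂.1 a Z hZ, (map_add _ _ _).symm⟩
  have hP : ∀ X (hX : X ∈ D.p), projP D X = ⟨X, hX⟩ := fun X hX => Subtype.ext (projP_of_mem hX)
  -- The form lives on 𝔭 while Schur's lemma is stated on the whole algebra, so it is extended by
  -- zero through the projection.
  obtain ⟨x₁, x₂, hx⟩ := h.exists_weights (g.form.compl₁₂ (projP D) (projP D))
    (fun X Y => g.symm _ _) (fun a X hX Y hY => by
      simp only [LinearMap.compl₁₂_apply]
      rw [hP X hX, hP Y hY, hP _ (hmem a X hX), hP _ (hmem a Y hY)]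
      exact hinv a _ _ _ _ rfl rfl)
  have hd : IsDiagonal g h.basis (weights d₁ d₂ x₁ x₂) := by
    intro i j
    rw [← hx i j]
    simp only [LinearMap.compl₁₂_apply]
    rw [hP _ (h.basis i).2, hP _ (h.basis j).2]
  refine ⟨x₁, x₂, ?_, ?_, hd⟩
  · exact hd.pos (.inl ⟨0, h.pos₁⟩)
  · exact hd.pos (.inr ⟨0, h.pos₂⟩)

end TwoSummands


/-! ### A planar flow governed by the ratio of its coordinates -/

/-- `x₁' = -f₁(x₁ / x₂)`, `x₂' = -f₂(x₂ / x₁)` on `J`, with `x₁, x₂ > 0`. -/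
structure IsRatioFlow (f₁ f₂ : ℝ → ℝ) (J : Set ℝ) (x₁ x₂ : ℝ → ℝ) : Prop where
  pos₁ : ∀ t ∈ J, 0 < x₁ t
  pos₂ : ∀ t ∈ J, 0 < x₂ t
  deriv₁ : ∀ t ∈ J, HasDerivWithinAt x₁ (-f₁ (x₁ t / x₂ t)) J t
  deriv₂ : ∀ t ∈ J, HasDerivWithinAt x₂ (-f₂ (x₂ t / x₁ t)) J t

/-- The ratio `y = x₁ / x₂` satisfies `y' = q(y) / x₂` with `q(y) = y f₂(1 / y) - f₁(y)`. -/
def ratioField (f₁ f₂ : ℝ → ℝ) (y : ℝ) : ℝ := y * f₂ y⁻¹ - f₁ y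

theorem exists_antideriv {φ : ℝ → ℝ} {a b y₀ : ℝ} (hφ : ContinuousOn φ (Ioo a b))
    (hy₀ : y₀ ∈ Ioo a b) (c : ℝ) :
    ∃ P : ℝ → ℝ, P y₀ = c ∧ ∀ y ∈ Ioo a b, HasDerivAt P (φ y) y := by
  refine ⟨fun y => c + ∫ u in y₀..y, φ u, by simp, fun y hy => ?_⟩
  refine HasDerivAt.const_add c (intervalIntegral.integral_hasDerivAt_right ?_ ?_ ?_)
  · refine (hφ.mono ?_).intervalIntegrable
    exact ordConnected_Ioo.uIcc_subset hy₀ hy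
  · exact hφ.stronglyMeasurableAtFilter isOpen_Ioo y hy
  · exact hφ.continuousAt (isOpen_Ioo.mem_nhds hy)

/-- Reparametrization of an open interval by a function with positive derivative. -/
theorem exists_inverse_of_deriv_pos {τ τ' : ℝ → ℝ} {a b : ℝ}
    (hτ : ∀ y ∈ Ioo a b, HasDerivAt τ (τ' y) y) (hpos : ∀ y ∈ Ioo a b, 0 < τ' y) :
    IsOpen (τ '' Ioo a b) ∧ (τ '' Ioo a b).OrdConnected ∧
      ∃ η : ℝ → ℝ, (∀ y ∈ Ioo a b, η (τ y) = y) ∧ StrictMonoOn η (τ '' Ioo a b) ∧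
        ∀ y ∈ Ioo a b, HasDerivAt η (τ' y)⁻¹ (τ y) := by
  have hcont : ContinuousOn τ (Ioo a b) := fun y hy => (hτ y hy).continuousAt.continuousWithinAt
  have hmono : StrictMonoOn τ (Ioo a b) := by
    refine strictMonoOn_of_deriv_pos (convex_Ioo a b) hcont fun y hy => ?_
    rw [interior_Ioo] at hy
    rw [(hτ y hy).deriv]
    exact hpos y hy
  have hconn : (τ '' Ioo a b).OrdConnected :=
    (isPreconnected_Ioo.image τ hcont).ordConnected
  have hopen : IsOpen (τ '' Ioo a b) := by
    rw [isOpen_iff_mem_nhds]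
    rintro _ ⟨y, hy, rfl⟩
    obtain ⟨u, hu, huy⟩ := exists_between hy.1
    obtain ⟨v, hyv, hv⟩ := exists_between hy.2
    have hu' : u ∈ Ioo a b := ⟨hu, huy.trans hy.2⟩
    have hv' : v ∈ Ioo a b := ⟨hy.1.trans hyv, hv⟩
    exact mem_of_superset (Icc_mem_nhds (hmono hu' hy huy) (hmono hy hv' hyv))
      (hconn.out (mem_image_of_mem τ hu') (mem_image_of_mem τ hv'))
  have hinv : ∀ y ∈ Ioo a b, Function.invFunOn τ (Ioo a b) (τ y) = y := fun y hy =>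
    hmono.injOn.leftInvOn_invFunOn hy
  have hη : StrictMonoOn (Function.invFunOn τ (Ioo a b)) (τ '' Ioo a b) := by
    rintro _ ⟨y, hy, rfl⟩ _ ⟨z, hz, rfl⟩ hyz
    rw [hinv y hy, hinv z hz]
    exact (hmono.lt_iff_lt hy hz).1 hyz
  refine ⟨hopen, hconn, _, hinv, hη, fun y hy => ?_⟩
  have hmem : τ '' Ioo a b ∈ 𝓝 (τ y) := hopen.mem_nhds (mem_image_of_mem τ hy)
  refine HasDerivAt.of_local_left_inverse ?_ (by rw [hinv y hy]; exact hτ y hy)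
    (hpos y hy).ne' ?_
  · refine hη.continuousAt_of_image_mem_nhds hmem ?_
    rw [hinv y hy]
    refine mem_of_superset (Ioo_mem_nhds hy.1 hy.2) fun z hz => ?_
    exact ⟨τ z, mem_image_of_mem τ hz, hinv z hz⟩
  · filter_upwards [hmem]
    rintro _ ⟨z, hz, rfl⟩
    rw [hinv z hz]

namespace IsRatioFlow

variable {f₁ f₂ x₁ x₂ : ℝ → ℝ} {J : Set ℝ}

theorem swap (h : IsRatioFlow f₁ f₂ J x₁ x₂) : IsRatioFlow f₂ f₁ J x₂ x₁ :=
  ⟨h.pos₂, h.pos₁, h.deriv₂, h.deriv₁⟩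

theorem mono (h : IsRatioFlow f₁ f₂ J x₁ x₂) {J' : Set ℝ} (hJ : J' ⊆ J) :
    IsRatioFlow f₁ f₂ J' x₁ x₂ :=
  ⟨fun t ht => h.pos₁ t (hJ ht), fun t ht => h.pos₂ t (hJ ht),
    fun t ht => (h.deriv₁ t (hJ ht)).mono hJ, fun t ht => (h.deriv₂ t (hJ ht)).mono hJ⟩

theorem ratio_pos (h : IsRatioFlow f₁ f₂ J x₁ x₂) {t : ℝ} (ht : t ∈ J) : 0 < x₁ t / x₂ t :=
  div_pos (h.pos₁ t ht) (h.pos₂ t ht)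

theorem deriv_ratio (h : IsRatioFlow f₁ f₂ J x₁ x₂) {t : ℝ} (ht : t ∈ J) :
    HasDerivWithinAt (fun s => x₁ s / x₂ s) (ratioField f₁ f₂ (x₁ t / x₂ t) / x₂ t) J t := by
  have h2 := (h.pos₂ t ht).ne'
  refine ((h.deriv₁ t ht).div (h.deriv₂ t ht) h2).congr_deriv ?_
  rw [ratioField, inv_div]
  field_simp
  ring

/-- The flow whose ratio sweeps out an interval on which the ratio field is positive. -/
theorem exists_of_ratioField_pos {lo r y₀ a : ℝ} (hf₁ : ContinuousOn f₁ (Ioi 0))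
    (hf₂ : ContinuousOn f₂ (Ioi 0)) (hlo : 0 ≤ lo) (hy₀ : y₀ ∈ Ioo lo r) (ha : 0 < a)
    (hq : ∀ y ∈ Ioo lo r, 0 < ratioField f₁ f₂ y) :
    ∃ (J : Set ℝ) (x₁ x₂ : ℝ → ℝ), IsOpen J ∧ J.OrdConnected ∧ 0 ∈ J ∧
      IsRatioFlow f₁ f₂ J x₁ x₂ ∧ x₁ 0 = y₀ * a ∧ x₂ 0 = a ∧
      StrictMonoOn (fun t => x₁ t / x₂ t) J ∧ (fun t => x₁ t / x₂ t) '' J = Ioo lo r := by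
  have hpos : ∀ y ∈ Ioo lo r, 0 < y := fun y hy => hlo.trans_lt hy.1
  have hg : ContinuousOn (fun y : ℝ => f₂ y⁻¹) (Ioo lo r) := by
    refine hf₂.comp (continuousOn_inv₀.mono fun y hy => (hpos y hy).ne') fun y hy => ?_
    exact inv_pos.2 (hpos y hy)
  have hqc : ContinuousOn (ratioField f₁ f₂) (Ioo lo r) :=
    (continuousOn_id.mul hg).sub (hf₁.mono hpos)
  -- `X` below is x₂ as a function of the ratio: dividing x₂' by y' gives d log x₂/dy =
  -- -f₂(1/y)/q(y).
  obtain ⟨P, hP0, hP⟩ := exists_antideriv (hg.div hqc fun y hy => (hq y hy).ne') hy₀ 0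
  set X : ℝ → ℝ := fun y => a * Real.exp (-P y) with hX
  have hXpos : ∀ y, 0 < X y := fun y => mul_pos ha (Real.exp_pos _)
  have hXd : ∀ y ∈ Ioo lo r, HasDerivAt X (-(f₂ y⁻¹ / ratioField f₁ f₂ y) * X y) y := by
    intro y hy
    refine ((hP y hy).neg.exp.const_mul a).congr_deriv ?_
    simp only [hX, Pi.div_apply, Pi.neg_apply]; ring
  have hXc : ContinuousOn X (Ioo lo r) := fun y hy =>
    (hXd y hy).continuousAt.continuousWithinAt
  -- Time as a function of the ratio, from dt/dy = x₂/q(y) > 0. Its inverse η is the ratio as a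
  -- function of time, and x₁ = η x₂.
  obtain ⟨τ, hτ0, hτ⟩ := exists_antideriv (hXc.div hqc fun y hy => (hq y hy).ne') hy₀ 0
  have hτpos : ∀ y ∈ Ioo lo r, 0 < (X / ratioField f₁ f₂) y := fun y hy =>
    div_pos (hXpos y) (hq y hy)
  obtain ⟨hopen, hconn, η, hinv, hη, hηd⟩ := exists_inverse_of_deriv_pos hτ hτpos
  have h0 : (0 : ℝ) ∈ τ '' Ioo lo r := ⟨y₀, hy₀, hτ0⟩
  have hη0 : η 0 = y₀ := by rw [← hτ0, hinv y₀ hy₀]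
  have hratio : (fun t => η t * X (η t) / X (η t)) = η := by
    funext t
    exact mul_div_cancel_right₀ _ (hXpos _).ne'
  have hX0 : X y₀ = a := by simp [hX, hP0]
  refine ⟨τ '' Ioo lo r, fun t => η t * X (η t), fun t => X (η t), hopen, hconn, h0,
    ⟨?_, fun t _ => hXpos _, ?_, ?_⟩, by simp only [hη0, hX0], by simp only [hη0, hX0], ?_, ?_⟩
  · rintro _ ⟨y, hy, rfl⟩
    rw [hinv y hy]
    exact mul_pos (hpos y hy) (hXpos y)
  · rintro _ ⟨y, hy, rfl⟩
    have h1 : HasDerivAt X (-(f₂ y⁻¹ / ratioField f₁ f₂ y) * X y) (η (τ y)) := by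
      rw [hinv y hy]; exact hXd y hy
    refine HasDerivAt.hasDerivWithinAt ?_
    refine ((hηd y hy).mul (h1.comp (τ y) (hηd y hy))).congr_deriv ?_
    have hq' := (hq y hy).ne'
    have hX' := (hXpos y).ne'
    simp only [Function.comp, hinv y hy, Pi.div_apply]
    rw [mul_div_cancel_right₀ _ hX']
    field_simp
    rw [ratioField]; ring_nf
  · rintro _ ⟨y, hy, rfl⟩
    have h1 : HasDerivAt X (-(f₂ y⁻¹ / ratioField f₁ f₂ y) * X y) (η (τ y)) := by
      rw [hinv y hy]; exact hXd y hy
    refine HasDerivAt.hasDerivWithinAt ?_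
    refine (h1.comp (τ y) (hηd y hy)).congr_deriv ?_
    have hq' := (hq y hy).ne'
    have hX' := (hXpos y).ne'
    have hy' := (hpos y hy).ne'
    simp only [hinv y hy, Pi.div_apply]
    rw [show X y / (y * X y) = y⁻¹ by field_simp]
    field_simp
  · rw [hratio]; exact hη
  · rw [hratio]
    ext y
    constructor
    · rintro ⟨_, ⟨z, hz, rfl⟩, rfl⟩
      rw [hinv z hz]; exact hz
    · exact fun hy => ⟨τ y, mem_image_of_mem τ hy, hinv y hy⟩

end IsRatioFlow


/-! ### Uniqueness, maximality and obstruction to ancient solutions -/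

namespace IsRatioFlow

variable {f₁ f₂ x₁ x₂ z₁ z₂ : ℝ → ℝ} {J : Set ℝ}

/-- The vector field of the flow. -/
def field (f₁ f₂ : ℝ → ℝ) (p : ℝ × ℝ) : ℝ × ℝ := (-f₁ (p.1 / p.2), -f₂ (p.2 / p.1))

theorem locallyLipschitzOn_field (hf₁ : ContDiffOn ℝ 1 f₁ (Ioi 0))
    (hf₂ : ContDiffOn ℝ 1 f₂ (Ioi 0)) :
    LocallyLipschitzOn (Ioi (0 : ℝ) ×ˢ Ioi (0 : ℝ)) (field f₁ f₂) := by
  refine ContDiffOn.locallyLipschitzOn ((convex_Ioi 0).prod (convex_Ioi 0)) ?_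
  have h1 : ContDiffOn ℝ 1 (fun p : ℝ × ℝ => p.1 / p.2) (Ioi (0 : ℝ) ×ˢ Ioi (0 : ℝ)) :=
    contDiffOn_fst.div contDiffOn_snd fun p hp => (mem_Ioi.1 hp.2).ne'
  have h2 : ContDiffOn ℝ 1 (fun p : ℝ × ℝ => p.2 / p.1) (Ioi (0 : ℝ) ×ˢ Ioi (0 : ℝ)) :=
    contDiffOn_snd.div contDiffOn_fst fun p hp => (mem_Ioi.1 hp.1).ne'
  exact ((hf₁.comp h1 fun p hp => mem_Ioi.2 (div_pos hp.1 hp.2)).neg).prodMk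
    ((hf₂.comp h2 fun p hp => mem_Ioi.2 (div_pos hp.2 hp.1)).neg)

theorem hasDerivWithinAt (h : IsRatioFlow f₁ f₂ J x₁ x₂) {t : ℝ} (ht : t ∈ J) :
    HasDerivWithinAt (fun s => (x₁ s, x₂ s)) (field f₁ f₂ (x₁ t, x₂ t)) J t :=
  (h.deriv₁ t ht).prodMk (h.deriv₂ t ht)

theorem continuousOn (h : IsRatioFlow f₁ f₂ J x₁ x₂) :
    ContinuousOn (fun s => (x₁ s, x₂ s)) J := fun _ ht => (h.hasDerivWithinAt ht).continuousWithinAt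

/-- Solutions with equal values at `0` agree. -/
theorem eqOn (hf₁ : ContDiffOn ℝ 1 f₁ (Ioi 0)) (hf₂ : ContDiffOn ℝ 1 f₂ (Ioi 0))
    (hJ : J.OrdConnected) (h0 : (0 : ℝ) ∈ J) (h : IsRatioFlow f₁ f₂ J x₁ x₂)
    (h' : IsRatioFlow f₁ f₂ J z₁ z₂) (e₁ : x₁ 0 = z₁ 0) (e₂ : x₂ 0 = z₂ 0) {t : ℝ} (ht : t ∈ J) :
    x₁ t = z₁ t ∧ x₂ t = z₂ t := by
  have main : ∀ a b, a ≤ b → Icc a b ⊆ J → (a = 0 ∨ b = 0) →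
      EqOn (fun s => (x₁ s, x₂ s)) (fun s => (z₁ s, z₂ s)) (Icc a b) := by
    intro a b hab hsub h0
    have hc := h.continuousOn.mono hsub
    have hc' := h'.continuousOn.mono hsub
    -- A compact subset of the open quadrant containing both trajectories, on which the field has
    -- one Lipschitz constant.
    set S := (fun s => (x₁ s, x₂ s)) '' Icc a b ∪ (fun s => (z₁ s, z₂ s)) '' Icc a b
    have hS : IsCompact S := (isCompact_Icc.image_of_continuousOn hc).union
      (isCompact_Icc.image_of_continuousOn hc')
    have hSU : S ⊆ Ioi (0 : ℝ) ×ˢ Ioi (0 : ℝ) := by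
      rintro _ (⟨s, hs, rfl⟩ | ⟨s, hs, rfl⟩)
      · exact ⟨h.pos₁ s (hsub hs), h.pos₂ s (hsub hs)⟩
      · exact ⟨h'.pos₁ s (hsub hs), h'.pos₂ s (hsub hs)⟩
    obtain ⟨C, hC⟩ :=
      ((locallyLipschitzOn_field hf₁ hf₂).mono hSU).exists_lipschitzOnWith_of_compact hS
    have hm : ∀ s ∈ Icc a b, (x₁ s, x₂ s) ∈ S := fun s hs => Or.inl ⟨s, hs, rfl⟩
    have hm' : ∀ s ∈ Icc a b, (z₁ s, z₂ s) ∈ S := fun s hs => Or.inr ⟨s, hs, rfl⟩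
    rcases h0 with rfl | rfl
    · have hd : ∀ s ∈ Ico 0 b, J ∈ 𝓝[≥] s := fun s hs =>
        mem_of_superset (Icc_mem_nhdsGE hs.2) ((Icc_subset_Icc_left hs.1).trans hsub)
      refine ODE_solution_unique_of_mem_Icc_right (v := fun _ => field f₁ f₂) (s := fun _ => S)
        (fun _ _ => hC) hc (fun s hs => ?_) (fun s hs => hm s (Ico_subset_Icc_self hs)) hc'
        (fun s hs => ?_) (fun s hs => hm' s (Ico_subset_Icc_self hs)) (by simp [e₁, e₂])
      · exact (h.hasDerivWithinAt (hsub (Ico_subset_Icc_self hs))).mono_of_mem_nhdsWithin (hd s hs)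
      · exact (h'.hasDerivWithinAt (hsub (Ico_subset_Icc_self hs))).mono_of_mem_nhdsWithin (hd s hs)
    · have hd : ∀ s ∈ Ioc a 0, J ∈ 𝓝[≤] s := fun s hs =>
        mem_of_superset (Icc_mem_nhdsLE hs.1) ((Icc_subset_Icc_right hs.2).trans hsub)
      refine ODE_solution_unique_of_mem_Icc_left (v := fun _ => field f₁ f₂) (s := fun _ => S)
        (fun _ _ => hC) hc (fun s hs => ?_) (fun s hs => hm s (Ioc_subset_Icc_self hs)) hc'
        (fun s hs => ?_) (fun s hs => hm' s (Ioc_subset_Icc_self hs)) (by simp [e₁, e₂])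
      · exact (h.hasDerivWithinAt (hsub (Ioc_subset_Icc_self hs))).mono_of_mem_nhdsWithin (hd s hs)
      · exact (h'.hasDerivWithinAt (hsub (Ioc_subset_Icc_self hs))).mono_of_mem_nhdsWithin (hd s hs)
  have hp : (x₁ t, x₂ t) = (z₁ t, z₂ t) := by
    rcases le_total 0 t with h1 | h1
    · exact main 0 t h1 (hJ.out h0 ht) (Or.inl rfl) (right_mem_Icc.2 h1)
    · exact main t 0 h1 (hJ.out ht h0) (Or.inr rfl) (left_mem_Icc.2 h1)
  exact Prod.ext_iff.1 hp

/-- A solution does not extend beyond a time at which another one collapses. -/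
theorem subset_Iio (hf₁ : ContDiffOn ℝ 1 f₁ (Ioi 0)) (hf₂ : ContDiffOn ℝ 1 f₂ (Ioi 0)) {T : ℝ}
    (hT : 0 < T) (h : IsRatioFlow f₁ f₂ (Ico 0 T) x₁ x₂) (hx : Tendsto x₂ (𝓝[<] T) (𝓝 0))
    (hJ : J.OrdConnected) (h0 : (0 : ℝ) ∈ J) (h' : IsRatioFlow f₁ f₂ J z₁ z₂) (e₁ : x₁ 0 = z₁ 0)
    (e₂ : x₂ 0 = z₂ 0) : J ⊆ Iio T := by
  intro t ht
  by_contra hlt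
  -- If the other solution were defined at T, continuity would make its second coordinate zero
  -- there, against positivity.
  have hTJ : T ∈ J := hJ.out h0 ht ⟨hT.le, not_lt.1 hlt⟩
  have hsub : Ico 0 T ⊆ J := Ico_subset_Icc_self.trans (hJ.out h0 hTJ)
  have hnhds : Ico 0 T ∈ 𝓝[<] T := Ico_mem_nhdsLT hT
  have h1 : Tendsto z₂ (𝓝[<] T) (𝓝 (z₂ T)) :=
    ((h'.deriv₂ T hTJ).continuousWithinAt.mono hsub).tendsto.mono_left
      (nhdsWithin_le_of_mem hnhds)
  have h2 : Tendsto z₂ (𝓝[<] T) (𝓝 0) := by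
    refine hx.congr' ?_
    filter_upwards [hnhds] with s hs
    exact (eqOn hf₁ hf₂ ordConnected_Ico (left_mem_Ico.2 hT) h (h'.mono hsub) e₁ e₂ hs).2
  exact (h'.pos₂ T hTJ).ne' (tendsto_nhds_unique h1 h2)

/-- Backwards in time the ratio stays below its initial value where the ratio field is positive,
and it would become negative in finite time if its rate is bounded below. -/
theorem not_ancient (hm₁ : MonotoneOn f₁ (Ioi 0)) {y₀ δ T : ℝ} (hT : 0 < T) (hδ : 0 < δ)
    (hq : ∀ y ∈ Ioc 0 y₀, δ ≤ y * ratioField f₁ f₂ y) (h0 : x₁ 0 / x₂ 0 = y₀) :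
    ¬ IsRatioFlow f₁ f₂ (Iio T) x₁ x₂ := by
  intro h
  -- The ratio in reversed time `s = -t`.
  set w : ℝ → ℝ := fun s => x₁ (-s) / x₂ (-s) with hw
  have hmem : ∀ s : ℝ, 0 ≤ s → -s ∈ Iio T := fun s hs => (neg_nonpos.2 hs).trans_lt hT
  have hpos : ∀ s, 0 ≤ s → 0 < w s := fun s hs => h.ratio_pos (hmem s hs)
  have hd : ∀ s : ℝ, 0 ≤ s → HasDerivAt w (-(ratioField f₁ f₂ (w s) / x₂ (-s))) s := by
    intro s hs
    have h1 := ((h.deriv_ratio (hmem s hs)).hasDerivAt (Iio_mem_nhds (hmem s hs))).comp s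
      (hasDerivAt_neg s)
    exact h1.congr_deriv (mul_neg_one _)
  have hd₁ : ∀ s : ℝ, 0 ≤ s → HasDerivAt (fun s => x₁ (-s)) (f₁ (w s)) s := by
    intro s hs
    have h1 := ((h.deriv₁ _ (hmem s hs)).hasDerivAt (Iio_mem_nhds (hmem s hs))).comp s
      (hasDerivAt_neg s)
    exact h1.congr_deriv (by rw [mul_neg_one, neg_neg])
  have hqpos : ∀ y ∈ Ioc 0 y₀, 0 < ratioField f₁ f₂ y := fun y hy =>
    pos_of_mul_pos_right (hδ.trans_le (hq y hy)) hy.1.le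
  have hw0 : w 0 = y₀ := by simp [hw, h0]
  have hy₀ : 0 < y₀ := hw0 ▸ hpos 0 le_rfl
  have hle : ∀ s, 0 ≤ s → w s ≤ y₀ := by
    intro s hs
    refine image_le_of_deriv_right_lt_deriv_boundary (B := fun _ => y₀) (B' := fun _ => 0) (a := 0)
      (f' := fun s => -(ratioField f₁ f₂ (w s) / x₂ (-s)))
      (fun u hu => (hd u hu.1).continuousAt.continuousWithinAt)
      (fun u hu => (hd u hu.1).hasDerivWithinAt) hw0.le (fun u => hasDerivAt_const u y₀) ?_
      (right_mem_Icc.2 hs)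
    intro u hu hwu
    rw [hwu]
    exact neg_lt_zero.2 (div_pos (hqpos y₀ ⟨hy₀, le_rfl⟩) (h.pos₂ _ (hmem u hu.1)))
  -- As w ≤ y₀ and f₁ is monotone, f₁(w) ≤ `M`, so x₁ grows at most linearly backwards; the maximum
  -- with 1 only ensures `M > 0`.
  set M := max (f₁ y₀) 1
  have hM : 0 < M := lt_of_lt_of_le one_pos (le_max_right _ _)
  set X := x₁ (-0 : ℝ) with hX
  have hXpos : 0 < X := h.pos₁ _ (hmem 0 le_rfl)
  have hbd : ∀ s, 0 ≤ s → x₁ (-s) ≤ X + M * s := by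
    intro s hs
    refine image_le_of_deriv_right_le_deriv_boundary (B := fun s => X + M * s) (B' := fun _ => M)
      (a := 0) (f := fun s => x₁ (-s)) (f' := fun s => f₁ (w s))
      (fun u hu => (hd₁ u hu.1).continuousAt.continuousWithinAt)
      (fun u hu => (hd₁ u hu.1).hasDerivWithinAt) (by simp [hX]) (by fun_prop)
      (fun u _ => ?_) ?_ (right_mem_Icc.2 hs)
    · exact (((hasDerivAt_id u).const_mul M).const_add X).hasDerivWithinAt.congr_deriv (mul_one M)
    · intro u hu
      exact (hm₁ (hpos u hu.1) hy₀ (hle u hu.1)).trans (le_max_left _ _)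
  have hXM : ∀ s, 0 ≤ s → 0 < X + M * s := fun s hs => by positivity
  -- Since q(w)/x₂ = w q(w)/x₁ ≥ δ/(X + M s), integration gives a logarithmic bound, which
  -- eventually contradicts w > 0.
  have hwle : ∀ s, 0 ≤ s → w s ≤ y₀ + δ / M * Real.log X - δ / M * Real.log (X + M * s) := by
    intro s hs
    refine image_le_of_deriv_right_le_deriv_boundary
      (B := fun s => y₀ + δ / M * Real.log X - δ / M * Real.log (X + M * s))
      (B' := fun s => -(δ / M * (M / (X + M * s)))) (a := 0)
      (f' := fun s => -(ratioField f₁ f₂ (w s) / x₂ (-s)))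
      (fun u hu => (hd u hu.1).continuousAt.continuousWithinAt)
      (fun u hu => (hd u hu.1).hasDerivWithinAt) (by simp [hw0]) ?_ ?_ ?_ (right_mem_Icc.2 hs)
    · refine continuousOn_const.sub (continuousOn_const.mul (ContinuousOn.log (by fun_prop) ?_))
      exact fun u hu => (hXM u hu.1).ne'
    · intro u hu
      have h1 : HasDerivAt (fun s => X + M * s) M u :=
        (((hasDerivAt_id u).const_mul M).const_add X).congr_deriv (mul_one M)
      exact (((h1.log (hXM u hu.1).ne').const_mul _).const_sub _).hasDerivWithinAt
    · intro u hu
      have hp1 := h.pos₁ _ (hmem u hu.1)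
      have hp2 := h.pos₂ _ (hmem u hu.1)
      have e1 : δ / M * (M / (X + M * u)) = δ / (X + M * u) := by field_simp
      have e2 : ratioField f₁ f₂ (w u) / x₂ (-u) = w u * ratioField f₁ f₂ (w u) / x₁ (-u) := by
        simp only [hw]; field_simp
      rw [e1, e2, neg_le_neg_iff]
      have h3 := hq (w u) ⟨hpos u hu.1, hle u hu.1⟩
      exact div_le_div₀ (hδ.le.trans h3) h3 hp1 (hbd u hu.1)
  have hlim : Tendsto (fun s => δ / M * Real.log (X + M * s)) atTop atTop := by
    refine Tendsto.const_mul_atTop (div_pos hδ hM) (Real.tendsto_log_atTop.comp ?_)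
    exact tendsto_atTop_add_const_left _ _ (tendsto_id.const_mul_atTop hM)
  obtain ⟨s, hs, hs0⟩ := ((hlim.eventually_ge_atTop (y₀ + δ / M * Real.log X)).and
    (eventually_ge_atTop 0)).exists
  linarith [hpos s hs0, hwle s hs0]

end IsRatioFlow


/-! ### Asymptotics of a flow whose ratio sweeps out an interval -/

theorem antitoneOn_of_hasDerivAt_nonpos {f f' : ℝ → ℝ} {J : Set ℝ} (hJ : J.OrdConnected)
    (hf : ∀ t ∈ J, HasDerivAt f (f' t) t) (hf' : ∀ t ∈ J, f' t ≤ 0) : AntitoneOn f J := by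
  refine antitoneOn_of_deriv_nonpos hJ.convex
    (fun t ht => (hf t ht).continuousAt.continuousWithinAt)
    (fun t ht => (hf t (interior_subset ht)).differentiableAt.differentiableWithinAt)
    fun t ht => ?_
  rw [(hf t (interior_subset ht)).deriv]
  exact hf' t (interior_subset ht)

theorem exists_abs_le_mul_of_differentiableAt {g : ℝ → ℝ} {p : ℝ} (hg : DifferentiableAt ℝ g p)
    (hp : g p = 0) : ∃ L > 0, ∀ᶠ y in 𝓝 p, |g y| ≤ L * |y - p| := by
  obtain ⟨L, hL, h⟩ := hg.isBigO_sub.exists_pos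
  refine ⟨L, hL, h.bound.mono fun y hy => ?_⟩
  simpa [hp] using hy

/-- Near -∞ the function f(t) - l t has arbitrarily small derivative, so by the mean value
inequality it is o(|t|). -/
theorem tendsto_div_atBot_of_hasDerivAt {f f' : ℝ → ℝ} {l T : ℝ}
    (hf : ∀ t < T, HasDerivAt f (f' t) t) (hl : Tendsto f' atBot (𝓝 l)) :
    Tendsto (fun t => f t / t) atBot (𝓝 l) := by
  rw [Metric.tendsto_nhds]
  intro ε hε
  have h1 : ∀ᶠ t in atBot, dist (f' t) l < ε / 2 := Metric.tendsto_nhds.1 hl _ (half_pos hε)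
  obtain ⟨t₁, ht₁⟩ := eventually_atBot.1 (h1.and ((eventually_lt_atBot T).and
    (eventually_lt_atBot 0)))
  have h0 := (ht₁ t₁ le_rfl).2.2
  have h2 : ∀ t ≤ t₁, |f t - l * t| ≤ |f t₁ - l * t₁| + ε / 2 * |t - t₁| := by
    intro t ht
    have h3 := (convex_Iic t₁).norm_image_sub_le_of_norm_hasDerivWithin_le (𝕜 := ℝ)
      (f := fun s => f s - l * s) (f' := fun s => f' s - l) (C := ε / 2)
      (fun s hs => (((hf s (ht₁ s hs).2.1).sub
        ((hasDerivAt_id s).const_mul l)).congr_deriv (by rw [mul_one])).hasDerivWithinAt)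
      (fun s hs => (ht₁ s hs).1.le) (mem_Iic.2 le_rfl) (mem_Iic.2 ht)
    have h4 := abs_sub_abs_le_abs_sub (f t - l * t) (f t₁ - l * t₁)
    simp only [Real.norm_eq_abs] at h3
    linarith
  have h5 : ∀ᶠ t : ℝ in atBot, t < -(|f t₁ - l * t₁| / (ε / 2)) := eventually_lt_atBot _
  filter_upwards [h5, eventually_le_atBot t₁] with t h5 ht
  have ht0 : t < 0 := ht.trans_lt h0
  rw [Real.dist_eq, show f t / t - l = (f t - l * t) / t by field_simp [ht0.ne], abs_div,
    div_lt_iff₀ (abs_pos.2 ht0.ne), abs_of_neg ht0]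
  have h6 := h2 t ht
  rw [abs_of_nonpos (sub_nonpos.2 ht)] at h6
  have h7 : |f t₁ - l * t₁| < ε / 2 * (-t) := by
    rw [← div_lt_iff₀' (half_pos hε)]; linarith
  nlinarith

/-- A ratio flow on an open interval whose ratio increases from `lo` to `r`. -/
structure IsSweep (f₁ f₂ : ℝ → ℝ) (lo r : ℝ) (J : Set ℝ) (x₁ x₂ : ℝ → ℝ) : Prop where
  isOpen : IsOpen J
  ordConnected : J.OrdConnected
  zero_mem : 0 ∈ J
  flow : IsRatioFlow f₁ f₂ J x₁ x₂
  strictMonoOn : StrictMonoOn (fun t => x₁ t / x₂ t) J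
  image_eq : (fun t => x₁ t / x₂ t) '' J = Ioo lo r

/-- A ratio flow on `J ⊇ [0, T)` starting at `(a₁, a₂)` which shrinks to zero at time `T`, at least
linearly in `T - t`, while its ratio stays bounded away from `0` and `∞` and tends to `r`. -/
structure IsCollapse (f₁ f₂ : ℝ → ℝ) (J : Set ℝ) (T r a₁ a₂ : ℝ) (x₁ x₂ : ℝ → ℝ) : Prop where
  time_pos : 0 < T
  flow : IsRatioFlow f₁ f₂ J x₁ x₂
  init₁ : x₁ 0 = a₁
  init₂ : x₂ 0 = a₂
  tendsto₁ : Tendsto x₁ (𝓝[<] T) (𝓝 0)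
  tendsto₂ : Tendsto x₂ (𝓝[<] T) (𝓝 0)
  ratio : Tendsto (fun t => x₁ t / x₂ t) (𝓝[<] T) (𝓝 r)
  lower : ∃ c > 0, ∀ t ∈ Ico 0 T, c * (T - t) ≤ x₁ t ∧ c * (T - t) ≤ x₂ t
  bounds : ∃ m M, 0 < m ∧ ∀ t ∈ Ico 0 T, x₁ t / x₂ t ∈ Icc m M

theorem IsCollapse.swap {f₁ f₂ : ℝ → ℝ} {J : Set ℝ} {T r a₁ a₂ : ℝ} {x₁ x₂ : ℝ → ℝ}
    (h : IsCollapse f₁ f₂ J T r a₁ a₂ x₁ x₂) (hr : r ≠ 0) :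
    IsCollapse f₂ f₁ J T r⁻¹ a₂ a₁ x₂ x₁ where
  time_pos := h.time_pos
  flow := h.flow.swap
  init₁ := h.init₂
  init₂ := h.init₁
  tendsto₁ := h.tendsto₂
  tendsto₂ := h.tendsto₁
  ratio := by simpa only [inv_div] using h.ratio.inv₀ hr
  lower := by
    obtain ⟨c, hc, h⟩ := h.lower
    exact ⟨c, hc, fun t ht => (h t ht).symm⟩
  bounds := by
    obtain ⟨m, M, hm, h'⟩ := h.bounds
    refine ⟨M⁻¹, m⁻¹, ?_, fun t ht => ?_⟩
    · exact inv_pos.2 (hm.trans_le (nonempty_Icc.1 ⟨_, h' 0 (left_mem_Ico.2 h.time_pos)⟩))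
    · have h1 := h' t ht
      have hp := hm.trans_le h1.1
      rw [← inv_div]
      exact ⟨inv_anti₀ hp h1.2, inv_anti₀ hm h1.1⟩

namespace IsSweep

variable {f₁ f₂ x₁ x₂ : ℝ → ℝ} {J : Set ℝ} {lo r : ℝ}

variable (h : IsSweep f₁ f₂ lo r J x₁ x₂)
include h

theorem mem_Ioo {t : ℝ} (ht : t ∈ J) : x₁ t / x₂ t ∈ Ioo lo r :=
  h.image_eq ▸ mem_image_of_mem _ ht

theorem exists_eq {y : ℝ} (hy : y ∈ Ioo lo r) : ∃ t ∈ J, x₁ t / x₂ t = y := by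
  rw [← h.image_eq] at hy
  exact hy

theorem hasDerivAt₂ {t : ℝ} (ht : t ∈ J) : HasDerivAt x₂ (-f₂ (x₁ t / x₂ t)⁻¹) t := by
  rw [inv_div]
  exact (h.flow.deriv₂ t ht).hasDerivAt (h.isOpen.mem_nhds ht)

theorem hasDerivAt_ratio {t : ℝ} (ht : t ∈ J) :
    HasDerivAt (fun s => x₁ s / x₂ s) (ratioField f₁ f₂ (x₁ t / x₂ t) / x₂ t) t :=
  (h.flow.deriv_ratio ht).hasDerivAt (h.isOpen.mem_nhds ht)

theorem field_ge (hm₂ : MonotoneOn f₂ (Ioi 0)) (hr : 0 < r) {t : ℝ} (ht : t ∈ J) :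
    f₂ r⁻¹ ≤ f₂ (x₁ t / x₂ t)⁻¹ := by
  have hp := h.flow.ratio_pos ht
  exact hm₂ (inv_pos.2 hr) (inv_pos.2 hp) (inv_anti₀ hp (h.mem_Ioo ht).2.le)

theorem field_le (hm₂ : MonotoneOn f₂ (Ioi 0)) (hlo : 0 < lo) {t : ℝ} (ht : t ∈ J) :
    f₂ (x₁ t / x₂ t)⁻¹ ≤ f₂ lo⁻¹ := by
  have hp := h.flow.ratio_pos ht
  exact hm₂ (inv_pos.2 hp) (inv_pos.2 hlo) (inv_anti₀ hlo (h.mem_Ioo ht).1.le)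

/-- The speed of x₂ is at least f₂(1/r), because y < r and f₂ is increasing. Finiteness of the final
time and the linear lower bound on x₂ both come from this. -/
theorem antitoneOn_add (hm₂ : MonotoneOn f₂ (Ioi 0)) (hr : 0 < r) :
    AntitoneOn (fun t => x₂ t + f₂ r⁻¹ * t) J := by
  refine antitoneOn_of_hasDerivAt_nonpos h.ordConnected
    (fun t ht => (h.hasDerivAt₂ ht).add ((hasDerivAt_id t).const_mul _)) fun t ht => ?_
  linarith [h.field_ge hm₂ hr ht]

theorem lt_csSup {t : ℝ} (hb : BddAbove J) (ht : t ∈ J) : t < sSup J := by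
  have hn : ∀ᶠ u in 𝓝[>] t, u ∈ J := nhdsWithin_le_nhds (h.isOpen.mem_nhds ht)
  obtain ⟨u, hu, htu⟩ := (hn.and self_mem_nhdsWithin).exists
  exact lt_of_lt_of_le htu (le_csSup hb hu)

theorem bddAbove (hm₂ : MonotoneOn f₂ (Ioi 0)) (hr : 0 < r) (hf : 0 < f₂ r⁻¹) : BddAbove J := by
  refine ⟨max 0 (x₂ 0 / f₂ r⁻¹), fun t ht => ?_⟩
  rcases le_total t 0 with h0 | h0
  · exact le_max_of_le_left h0
  · refine le_max_of_le_right ?_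
    have h1 := h.antitoneOn_add hm₂ hr h.zero_mem ht h0
    simp only [mul_zero, add_zero] at h1
    rw [le_div_iff₀' hf]
    linarith [h.flow.pos₂ t ht]

theorem Ico_subset {t : ℝ} (ht : t ∈ J) : Ico t (sSup J) ⊆ J := by
  intro s hs
  obtain ⟨u, hu, hsu⟩ := exists_lt_of_lt_csSup ⟨t, ht⟩ hs.2
  exact h.ordConnected.out ht hu ⟨hs.1, hsu.le⟩

theorem mem_nhdsLT (hb : BddAbove J) {t : ℝ} (ht : t ∈ J) : J ∩ Ioi t ∈ 𝓝[<] (sSup J) := by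
  refine mem_of_superset (Ioo_mem_nhdsLT (h.lt_csSup hb ht)) fun s hs => ?_
  exact ⟨h.Ico_subset ht ⟨hs.1.le, hs.2⟩, hs.1⟩

theorem tendsto_ratio (hb : BddAbove J) :
    Tendsto (fun t => x₁ t / x₂ t) (𝓝[<] (sSup J)) (𝓝 r) := by
  have h0 := h.mem_nhdsLT hb h.zero_mem
  have hlr : lo < r := (h.mem_Ioo h.zero_mem).1.trans (h.mem_Ioo h.zero_mem).2
  rw [tendsto_order]
  refine ⟨fun u hu => ?_, fun u hu => ?_⟩
  · obtain ⟨v, hv1, hv2⟩ := exists_between (max_lt hu hlr)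
    obtain ⟨t, ht, rfl⟩ := h.exists_eq ⟨(le_max_right _ _).trans_lt hv1, hv2⟩
    filter_upwards [h.mem_nhdsLT hb ht] with s hs
    exact ((le_max_left _ _).trans_lt hv1).trans (h.strictMonoOn ht hs.1 hs.2)
  · filter_upwards [h0] with s hs
    exact (h.mem_Ioo hs.1).2.trans hu

/-- x₂ loses at least f₂(1/r) per unit time and stays positive up to the final time, so enough must
be left at time `t`. -/
theorem mul_sub_le (hm₂ : MonotoneOn f₂ (Ioi 0)) (hr : 0 < r) (hf : 0 < f₂ r⁻¹) {t : ℝ}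
    (ht : t ∈ J) : f₂ r⁻¹ * (sSup J - t) ≤ x₂ t := by
  have hb := h.bddAbove hm₂ hr hf
  have h1 : sSup J ≤ t + x₂ t / f₂ r⁻¹ := by
    refine csSup_le ⟨t, ht⟩ fun s hs => ?_
    rcases le_total s t with hst | hst
    · exact hst.trans (le_add_of_nonneg_right (div_nonneg (h.flow.pos₂ t ht).le hf.le))
    · have h2 := h.antitoneOn_add hm₂ hr ht hs hst
      simp only at h2
      rw [← sub_le_iff_le_add', le_div_iff₀' hf]
      linarith [h.flow.pos₂ s hs]
  rw [← sub_le_iff_le_add', le_div_iff₀' hf] at h1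
  exact h1

/-- Near its zero r the ratio field satisfies q(y) ≤ L(r - y), so log(r - y) decreases at rate at
most L/x₂ while log x₂ decreases at rate at least f₂(1/r)/x₂. As y → r the former tends to -∞, and
it drags log x₂ along. -/
theorem tendsto_zero (hm₂ : MonotoneOn f₂ (Ioi 0)) (hr : 0 < r) (hf : 0 < f₂ r⁻¹)
    (hd : DifferentiableAt ℝ (ratioField f₁ f₂) r) (hqr : ratioField f₁ f₂ r = 0) :
    Tendsto x₂ (𝓝[<] (sSup J)) (𝓝 0) := by
  have hb := h.bddAbove hm₂ hr hf
  obtain ⟨L, hL, hq⟩ := exists_abs_le_mul_of_differentiableAt hd hqr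
  have hlr : lo < r := (h.mem_Ioo h.zero_mem).1.trans (h.mem_Ioo h.zero_mem).2
  obtain ⟨y', hy', hsub⟩ := (mem_nhdsLT_iff_exists_Ioo_subset' hlr).1 (nhdsWithin_le_nhds hq)
  obtain ⟨y, hy1, hy2⟩ := exists_between (max_lt hlr hy')
  obtain ⟨t, ht, hty⟩ := h.exists_eq ⟨(le_max_left _ _).trans_lt hy1, hy2⟩
  have hy1' : y' < x₁ t / x₂ t := hty ▸ (le_max_right _ _).trans_lt hy1
  -- The quotient of the two rates, for which log x₂ - k log(r - y) is nonincreasing.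
  set k := f₂ r⁻¹ / L
  have hk : 0 < k := div_pos hf hL
  have hanti : AntitoneOn (fun s => Real.log (x₂ s) - k * Real.log (r - x₁ s / x₂ s))
      (J ∩ Ici t) := by
    refine antitoneOn_of_hasDerivAt_nonpos (h.ordConnected.inter ordConnected_Ici)
      (fun s hs => ((h.hasDerivAt₂ hs.1).log (h.flow.pos₂ s hs.1).ne').sub
        ((((h.hasDerivAt_ratio hs.1).const_sub r).log
          (sub_pos.2 (h.mem_Ioo hs.1).2).ne').const_mul k)) fun s hs => ?_
    have hp := h.flow.pos₂ s hs.1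
    have hry := sub_pos.2 (h.mem_Ioo hs.1).2
    have h1 := h.field_ge hm₂ hr hs.1
    have h2 : |ratioField f₁ f₂ (x₁ s / x₂ s)| ≤ L * |x₁ s / x₂ s - r| :=
      hsub ⟨hy1'.trans_le (h.strictMonoOn.monotoneOn ht hs.1 hs.2), (h.mem_Ioo hs.1).2⟩
    rw [abs_sub_comm, abs_of_pos hry] at h2
    have h3 : k * (ratioField f₁ f₂ (x₁ s / x₂ s) / (r - x₁ s / x₂ s)) ≤ f₂ r⁻¹ := by
      have : ratioField f₁ f₂ (x₁ s / x₂ s) / (r - x₁ s / x₂ s) ≤ L := by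
        rw [div_le_iff₀ hry]; exact (le_abs_self _).trans h2
      calc _ ≤ k * L := by gcongr
        _ = _ := by simp only [k]; field_simp
    have e : -f₂ (x₁ s / x₂ s)⁻¹ / x₂ s
        - k * (-(ratioField f₁ f₂ (x₁ s / x₂ s) / x₂ s) / (r - x₁ s / x₂ s))
        = (k * (ratioField f₁ f₂ (x₁ s / x₂ s) / (r - x₁ s / x₂ s))
          - f₂ (x₁ s / x₂ s)⁻¹) / x₂ s := by
      have := hry.ne'
      generalize r - x₁ s / x₂ s = w at *
      field_simp
      ring
    rw [e]
    exact div_nonpos_of_nonpos_of_nonneg (by linarith) hp.le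
  have hlog : Tendsto (fun s => Real.log (x₂ s)) (𝓝[<] (sSup J)) atBot := by
    have h1 : Tendsto (fun s => r - x₁ s / x₂ s) (𝓝[<] (sSup J)) (𝓝[>] 0) := by
      refine tendsto_nhdsWithin_iff.2 ⟨?_, ?_⟩
      · simpa using (h.tendsto_ratio hb).const_sub r
      · filter_upwards [h.mem_nhdsLT hb h.zero_mem] with s hs
        exact sub_pos.2 (h.mem_Ioo hs.1).2
    refine tendsto_atBot_mono' _ ?_ (tendsto_atBot_add_const_left _
      (Real.log (x₂ t) - k * Real.log (r - x₁ t / x₂ t))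
      ((Real.tendsto_log_nhdsGT_zero.comp h1).const_mul_atBot hk))
    filter_upwards [h.mem_nhdsLT hb ht] with s hs
    have h2 := hanti ⟨ht, mem_Ici.2 le_rfl⟩ ⟨hs.1, mem_Ici.2 (mem_Ioi.1 hs.2).le⟩ (mem_Ioi.1 hs.2).le
    simp only [Function.comp] at h2 ⊢
    linarith
  refine (Real.tendsto_exp_atBot.comp hlog).congr' ?_
  filter_upwards [h.mem_nhdsLT hb h.zero_mem] with s hs
  exact Real.exp_log (h.flow.pos₂ s hs.1)

/-- Everything about x₁ follows from x₁ = y x₂ with y between its initial value and r. The set `J'`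
is free so as to serve both for [0, T) and for (-∞, T). -/
theorem isCollapse {J' : Set ℝ} (hJ' : J' ⊆ J) (hm₂ : MonotoneOn f₂ (Ioi 0)) (hlo : 0 ≤ lo)
    (hf : 0 < f₂ r⁻¹)
    (hd : DifferentiableAt ℝ (ratioField f₁ f₂) r) (hqr : ratioField f₁ f₂ r = 0) :
    IsCollapse f₁ f₂ J' (sSup J) r (x₁ 0) (x₂ 0) x₁ x₂ := by
  have hr : 0 < r := hlo.trans_lt ((h.mem_Ioo h.zero_mem).1.trans (h.mem_Ioo h.zero_mem).2)
  have hb := h.bddAbove hm₂ hr hf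
  have hsub := h.Ico_subset h.zero_mem
  have h2 := h.tendsto_zero hm₂ hr hf hd hqr
  have hrat := h.tendsto_ratio hb
  have hm : 0 < x₁ 0 / x₂ 0 := h.flow.ratio_pos h.zero_mem
  have hbd : ∀ t ∈ Ico 0 (sSup J), x₁ t / x₂ t ∈ Icc (x₁ 0 / x₂ 0) r := fun t ht =>
    ⟨h.strictMonoOn.monotoneOn h.zero_mem (hsub ht) ht.1, (h.mem_Ioo (hsub ht)).2.le⟩
  have hmul : ∀ t ∈ J, x₁ t / x₂ t * x₂ t = x₁ t := fun t ht =>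
    div_mul_cancel₀ _ (h.flow.pos₂ t ht).ne'
  refine ⟨h.lt_csSup hb h.zero_mem, h.flow.mono hJ', rfl, rfl, ?_, h2, hrat,
    ⟨min (x₁ 0 / x₂ 0) 1 * f₂ r⁻¹, by positivity, fun t ht => ?_⟩, ⟨_, r, hm, hbd⟩⟩
  · have h3 := hrat.mul h2
    rw [mul_zero] at h3
    refine h3.congr' ?_
    filter_upwards [h.mem_nhdsLT hb h.zero_mem] with s hs
    exact hmul s hs.1
  · have h3 := h.mul_sub_le hm₂ hr hf (hsub ht)
    have hp := h.flow.pos₂ t (hsub ht)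
    have hmin : 0 < min (x₁ 0 / x₂ 0) 1 := lt_min hm one_pos
    rw [mul_assoc]
    refine ⟨?_, ?_⟩
    · rw [← hmul t (hsub ht)]
      exact mul_le_mul ((min_le_left _ _).trans (hbd t ht).1) h3
        (mul_nonneg hf.le (sub_nonneg.2 ht.2.le)) (hm.le.trans (hbd t ht).1)
    · calc _ ≤ 1 * x₂ t := mul_le_mul (min_le_right _ _) h3
            (mul_nonneg hf.le (sub_nonneg.2 ht.2.le)) one_pos.le
        _ = _ := one_mul _

/-- If the lower end of the range of the ratio is a zero of the ratio field, the flow is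
ancient. -/
theorem not_bddBelow (hm₂ : MonotoneOn f₂ (Ioi 0)) (hlo : 0 < lo) (hf : 0 < f₂ r⁻¹)
    (hd : DifferentiableAt ℝ (ratioField f₁ f₂) lo) (hql : ratioField f₁ f₂ lo = 0) :
    ¬ BddBelow J := by
  intro ⟨m, hmJ⟩
  have hlr : lo < r := (h.mem_Ioo h.zero_mem).1.trans (h.mem_Ioo h.zero_mem).2
  have hr : 0 < r := hlo.trans hlr
  obtain ⟨L, hL, hq⟩ := exists_abs_le_mul_of_differentiableAt hd hql
  obtain ⟨y', hy', hsub⟩ := (mem_nhdsGT_iff_exists_Ioo_subset' hlr).1 (nhdsWithin_le_nhds hq)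
  obtain ⟨y, hy1, hy2⟩ := exists_between (lt_min hlr hy')
  obtain ⟨t, ht, hty⟩ := h.exists_eq ⟨hy1, hy2.trans_le (min_le_left _ _)⟩
  have hy1' : x₁ t / x₂ t < y' := hty ▸ hy2.trans_le (min_le_right _ _)
  -- With this constant log x₂ + k log(y - lo) is nonincreasing in time, so x₂ must blow up
  -- backwards as y → lo.
  set k := f₂ r⁻¹ / L
  have hk : 0 < k := div_pos hf hL
  have hanti : AntitoneOn (fun s => Real.log (x₂ s) + k * Real.log (x₁ s / x₂ s - lo))
      (J ∩ Iic t) := by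
    refine antitoneOn_of_hasDerivAt_nonpos (h.ordConnected.inter ordConnected_Iic)
      (fun s hs => ((h.hasDerivAt₂ hs.1).log (h.flow.pos₂ s hs.1).ne').add
        ((((h.hasDerivAt_ratio hs.1).sub_const lo).log
          (sub_pos.2 (h.mem_Ioo hs.1).1).ne').const_mul k)) fun s hs => ?_
    have hp := h.flow.pos₂ s hs.1
    have hry := sub_pos.2 (h.mem_Ioo hs.1).1
    have h1 := h.field_ge hm₂ hr hs.1
    have h2 : |ratioField f₁ f₂ (x₁ s / x₂ s)| ≤ L * |x₁ s / x₂ s - lo| :=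
      hsub ⟨(h.mem_Ioo hs.1).1, (h.strictMonoOn.monotoneOn hs.1 ht hs.2).trans_lt hy1'⟩
    rw [abs_of_pos hry] at h2
    have h3 : k * (ratioField f₁ f₂ (x₁ s / x₂ s) / (x₁ s / x₂ s - lo)) ≤ f₂ r⁻¹ := by
      have : ratioField f₁ f₂ (x₁ s / x₂ s) / (x₁ s / x₂ s - lo) ≤ L := by
        rw [div_le_iff₀ hry]; exact (le_abs_self _).trans h2
      calc _ ≤ k * L := by gcongr
        _ = _ := by simp only [k]; field_simp
    have e : -f₂ (x₁ s / x₂ s)⁻¹ / x₂ s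
        + k * (ratioField f₁ f₂ (x₁ s / x₂ s) / x₂ s / (x₁ s / x₂ s - lo))
        = (k * (ratioField f₁ f₂ (x₁ s / x₂ s) / (x₁ s / x₂ s - lo))
          - f₂ (x₁ s / x₂ s)⁻¹) / x₂ s := by
      have := hry.ne'
      generalize x₁ s / x₂ s - lo = w at *
      field_simp
      ring
    rw [e]
    exact div_nonpos_of_nonpos_of_nonneg (by linarith) hp.le
  -- The speed of x₂ is at most f₂(1/lo), so on a time interval bounded below by `m` x₂ would stay
  -- bounded; a ratio close enough to `lo` contradicts this.
  have hup : ∀ s ∈ J, s ≤ t → x₂ s ≤ x₂ t + f₂ lo⁻¹ * (t - m) := by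
    have hmono : AntitoneOn (fun s => -(x₂ s + f₂ lo⁻¹ * s)) J := by
      refine antitoneOn_of_hasDerivAt_nonpos h.ordConnected
        (fun t ht => ((h.hasDerivAt₂ ht).add ((hasDerivAt_id t).const_mul _)).neg) fun t ht => ?_
      linarith [h.field_le hm₂ hlo ht]
    intro s hs hst
    have h1 := hmono hs ht hst
    simp only at h1
    have h2 : f₂ lo⁻¹ * (t - s) ≤ f₂ lo⁻¹ * (t - m) := by
      have := hmJ hs
      have hf' : 0 ≤ f₂ lo⁻¹ :=
        hf.le.trans (hm₂ (inv_pos.2 hr) (inv_pos.2 hlo) (inv_anti₀ hlo hlr.le))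
      gcongr
    linarith
  set c₀ := Real.log (x₂ t) + k * Real.log (x₁ t / x₂ t - lo) with hc₀
  set M := x₂ t + f₂ lo⁻¹ * (t - m)
  have hev : ∀ᶠ y in 𝓝[>] lo, k * Real.log (y - lo) < c₀ - Real.log M := by
    have h1 : Tendsto (fun y => y - lo) (𝓝[>] lo) (𝓝[>] 0) := by
      refine tendsto_nhdsWithin_iff.2 ⟨?_, ?_⟩
      · have : Tendsto (fun y : ℝ => y - lo) (𝓝 lo) (𝓝 (lo - lo)) :=
          tendsto_id.sub_const lo
        rw [sub_self] at this
        exact this.mono_left nhdsWithin_le_nhds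
      · filter_upwards [self_mem_nhdsWithin] with y hy
        exact mem_Ioi.2 (sub_pos.2 (mem_Ioi.1 hy))
    exact ((Real.tendsto_log_nhdsGT_zero.comp h1).const_mul_atBot hk).eventually_lt_atBot _
  obtain ⟨y₁, hy₁, hy₁m⟩ := (hev.and (Ioo_mem_nhdsGT (h.mem_Ioo ht).1)).exists
  obtain ⟨s, hs, hsy⟩ := h.exists_eq ⟨hy₁m.1, hy₁m.2.trans (h.mem_Ioo ht).2⟩
  have hst : s ≤ t := by
    by_contra hlt
    have := h.strictMonoOn ht hs (not_le.1 hlt)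
    simp only [hsy] at this
    exact this.not_gt hy₁m.2
  have h1 := hanti ⟨hs, mem_Iic.2 hst⟩ ⟨ht, mem_Iic.2 le_rfl⟩ hst
  have h2 := Real.log_le_log (h.flow.pos₂ s hs) (hup s hs hst)
  simp only [hsy] at h1
  linarith

theorem eq_Iio (hb : BddAbove J) (hb' : ¬ BddBelow J) : J = Iio (sSup J) := by
  refine Subset.antisymm (fun t ht => h.lt_csSup hb ht) fun t ht => ?_
  obtain ⟨s, hs, hst⟩ := not_bddBelow_iff.1 hb' t
  exact h.Ico_subset hs ⟨hst.le, ht⟩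

theorem tendsto_ratio_atBot (hb' : ¬ BddBelow J) (hb : BddAbove J) :
    Tendsto (fun t => x₁ t / x₂ t) atBot (𝓝 lo) := by
  have hJ := h.eq_Iio hb hb'
  have hlr : lo < r := (h.mem_Ioo h.zero_mem).1.trans (h.mem_Ioo h.zero_mem).2
  have hmem : ∀ᶠ t in atBot, t ∈ J := by
    rw [hJ]; exact eventually_lt_atBot _
  rw [tendsto_order]
  refine ⟨fun u hu => ?_, fun u hu => ?_⟩
  · filter_upwards [hmem] with s hs
    exact hu.trans (h.mem_Ioo hs).1
  · obtain ⟨v, hv1, hv2⟩ := exists_between (lt_min hu hlr)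
    obtain ⟨t, ht, rfl⟩ := h.exists_eq ⟨hv1, hv2.trans_le (min_le_right _ _)⟩
    filter_upwards [hmem, eventually_lt_atBot t] with s hs hst
    exact (h.strictMonoOn hs ht hst).trans (hv2.trans_le (min_le_left _ _))

/-- As t → -∞ the ratio tends to `lo`, so x₂' tends to -f₂(1/lo), and x₂ is asymptotically linear
with that slope. -/
theorem tendsto_div_abs (hb' : ¬ BddBelow J) (hb : BddAbove J) (hlo : 0 < lo)
    (hf₂ : ContinuousOn f₂ (Ioi 0)) :
    Tendsto (fun t => x₂ t / |t|) atBot (𝓝 (f₂ lo⁻¹)) := by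
  have hJ := h.eq_Iio hb hb'
  have h1 : Tendsto (fun t => -f₂ (x₁ t / x₂ t)⁻¹) atBot (𝓝 (-f₂ lo⁻¹)) := by
    refine Tendsto.neg ((hf₂.continuousAt (Ioi_mem_nhds (inv_pos.2 hlo))).tendsto.comp ?_)
    exact (h.tendsto_ratio_atBot hb' hb).inv₀ hlo.ne'
  have h2 := (tendsto_div_atBot_of_hasDerivAt (f := x₂) (T := sSup J)
    (fun t ht => h.hasDerivAt₂ (hJ ▸ ht)) h1).neg
  rw [neg_neg] at h2
  refine h2.congr' ?_
  filter_upwards [eventually_lt_atBot 0] with t ht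
  rw [abs_of_neg ht, div_neg]

end IsSweep


/-! ### Ratio fields with a simple and a double zero -/

theorem ratioField_swap {f₁ f₂ : ℝ → ℝ} {z : ℝ} (hz : z ≠ 0) :
    ratioField f₂ f₁ z = -(z * ratioField f₁ f₂ z⁻¹) := by
  simp only [ratioField, inv_inv]
  field_simp
  ring

/-- Data for a ratio flow whose ratio field has a simple zero `y₁` and a double zero `y₂`. -/
structure DoubleRootFlow (f₁ f₂ : ℝ → ℝ) (a y₁ y₂ : ℝ) : Prop where
  contDiffOn₁ : ContDiffOn ℝ 1 f₁ (Ioi 0)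
  contDiffOn₂ : ContDiffOn ℝ 1 f₂ (Ioi 0)
  mono₁ : MonotoneOn f₁ (Ioi 0)
  mono₂ : MonotoneOn f₂ (Ioi 0)
  pos : 0 < a
  pos₁ : 0 < y₁
  pos₂ : 0 < y₂
  field_eq : ∀ y, 0 < y → y * ratioField f₁ f₂ y = a * ((y₁ - y) * (y - y₂) ^ 2)
  field₁_pos : ∀ y, y = y₁ ∨ y = y₂ → 0 < f₁ y
  field₂_pos : ∀ y, y = y₁ ∨ y = y₂ → 0 < f₂ y⁻¹

namespace DoubleRootFlow

variable {f₁ f₂ : ℝ → ℝ} {a y₁ y₂ y₀ r a₁ a₂ : ℝ}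

/-- Under y = 1/z the factored cubic becomes, up to a factor -z³ absorbed by the transformation of
the ratio field, the one with inverse roots and leading factor a y₁ y₂². Simple and double root keep
their roles while the order of the roots is reversed. -/
theorem swap (h : DoubleRootFlow f₁ f₂ a y₁ y₂) :
    DoubleRootFlow f₂ f₁ (a * y₁ * y₂ ^ 2) y₁⁻¹ y₂⁻¹ where
  contDiffOn₁ := h.contDiffOn₂
  contDiffOn₂ := h.contDiffOn₁
  mono₁ := h.mono₂
  mono₂ := h.mono₁
  pos := mul_pos (mul_pos h.pos h.pos₁) (pow_pos h.pos₂ 2)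
  pos₁ := inv_pos.2 h.pos₁
  pos₂ := inv_pos.2 h.pos₂
  field_eq z hz := by
    have h1 := h.field_eq z⁻¹ (inv_pos.2 hz)
    have hy₁ := h.pos₁.ne'
    have hy₂ := h.pos₂.ne'
    rw [inv_mul_eq_iff_eq_mul₀ hz.ne'] at h1
    rw [ratioField_swap hz.ne', h1]
    field_simp
    ring
  field₁_pos y hy := by
    rcases hy with rfl | rfl
    · exact h.field₂_pos _ (Or.inl rfl)
    · exact h.field₂_pos _ (Or.inr rfl)
  field₂_pos y hy := by
    rcases hy with rfl | rfl
    · exact h.field₁_pos _ (Or.inl (inv_inv _))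
    · exact h.field₁_pos _ (Or.inr (inv_inv _))

variable (h : DoubleRootFlow f₁ f₂ a y₁ y₂)
include h

theorem ratioField_pos {y : ℝ} (hy : 0 < y) (hy₁ : y < y₁) (hy₂ : y ≠ y₂) :
    0 < ratioField f₁ f₂ y := by
  have h1 : 0 < y * ratioField f₁ f₂ y := by
    rw [h.field_eq y hy]
    exact mul_pos h.pos (mul_pos (sub_pos.2 hy₁) (sq_pos_of_ne_zero (sub_ne_zero.2 hy₂)))
  exact pos_of_mul_pos_right h1 hy.le

theorem root_pos (hr : r = y₁ ∨ r = y₂) : 0 < r := by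
  rcases hr with rfl | rfl
  exacts [h.pos₁, h.pos₂]

theorem ratioField_root (hr : r = y₁ ∨ r = y₂) : ratioField f₁ f₂ r = 0 := by
  have h1 := h.field_eq r (h.root_pos hr)
  have h2 : (y₁ - r) * (r - y₂) ^ 2 = 0 := by
    rcases hr with rfl | rfl <;> simp
  rw [h2, mul_zero] at h1
  exact (mul_eq_zero.1 h1).resolve_left (h.root_pos hr).ne'

theorem differentiableAt_ratioField {y : ℝ} (hy : 0 < y) :
    DifferentiableAt ℝ (ratioField f₁ f₂) y := by
  have h1 : DifferentiableAt ℝ f₁ y :=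
    (h.contDiffOn₁.contDiffAt (Ioi_mem_nhds hy)).differentiableAt one_ne_zero
  have h2 : DifferentiableAt ℝ f₂ y⁻¹ :=
    (h.contDiffOn₂.contDiffAt (Ioi_mem_nhds (inv_pos.2 hy))).differentiableAt one_ne_zero
  exact (differentiableAt_id.mul (h2.comp y (differentiableAt_inv hy.ne'))).sub h1

theorem exists_sweep {lo : ℝ} (hlo : 0 ≤ lo) (hy₀ : y₀ ∈ Ioo lo r) (ha₂ : 0 < a₂)
    (hr₁ : r ≤ y₁) (hne : ∀ y ∈ Ioo lo r, y ≠ y₂) :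
    ∃ (J : Set ℝ) (x₁ x₂ : ℝ → ℝ), IsSweep f₁ f₂ lo r J x₁ x₂ ∧ x₁ 0 = y₀ * a₂ ∧ x₂ 0 = a₂ := by
  obtain ⟨J, x₁, x₂, k1, k2, k3, k4, k5, k6, k7, k8⟩ :=
    IsRatioFlow.exists_of_ratioField_pos h.contDiffOn₁.continuousOn h.contDiffOn₂.continuousOn hlo
      hy₀ ha₂ fun y hy => h.ratioField_pos (hlo.trans_lt hy.1) (hy.2.trans_le hr₁) (hne y hy)
  exact ⟨J, x₁, x₂, ⟨k1, k2, k3, k4, k7, k8⟩, k5, k6⟩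

/-- Below both roots the ratio increases to the smaller one. -/
theorem exists_collapse_below (ha₁ : 0 < a₁) (ha₂ : 0 < a₂) (hr : r = y₁ ∨ r = y₂)
    (hr₁ : r ≤ y₁) (hr₂ : r ≤ y₂) (hlt : a₁ / a₂ < r) :
    ∃ (T : ℝ) (x₁ x₂ : ℝ → ℝ), IsCollapse f₁ f₂ (Ico 0 T) T r a₁ a₂ x₁ x₂ := by
  obtain ⟨J, x₁, x₂, hs, e₁, e₂⟩ := h.exists_sweep le_rfl ⟨div_pos ha₁ ha₂, hlt⟩ ha₂ hr₁
    fun y hy => (hy.2.trans_le hr₂).ne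
  rw [div_mul_cancel₀ _ ha₂.ne'] at e₁
  have := hs.isCollapse (hs.Ico_subset hs.zero_mem) h.mono₂ le_rfl
    (h.field₂_pos r hr) (h.differentiableAt_ratioField (h.root_pos hr)) (h.ratioField_root hr)
  rw [e₁, e₂] at this
  exact ⟨_, x₁, x₂, this⟩

theorem not_ancient_below {T : ℝ} (hT : 0 < T) {x₁ x₂ : ℝ → ℝ} (hlt₁ : x₁ 0 / x₂ 0 < y₁)
    (hlt₂ : x₁ 0 / x₂ 0 < y₂) : ¬ IsRatioFlow f₁ f₂ (Iio T) x₁ x₂ := by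
  refine IsRatioFlow.not_ancient h.mono₁ hT (y₀ := x₁ 0 / x₂ 0)
    -- The value of the cubic at the initial ratio: both factors only grow as y decreases from there
    -- to 0.
    (δ := a * ((y₁ - x₁ 0 / x₂ 0) * (y₂ - x₁ 0 / x₂ 0) ^ 2)) ?_ (fun y hy => ?_) rfl
  · exact mul_pos h.pos (mul_pos (sub_pos.2 hlt₁) (pow_pos (sub_pos.2 hlt₂) 2))
  · rw [h.field_eq y hy.1]
    have h1 := hy.2
    have h2 := h.pos.le
    have h3 := sub_pos.2 hlt₁
    have h4 := sub_pos.2 hlt₂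
    rw [show (y - y₂) ^ 2 = (y₂ - y) ^ 2 by ring]
    have h5 : 0 ≤ y₁ - y := by linarith
    gcongr

/-- Above both roots the ratio decreases to the larger one. -/
theorem exists_collapse_above (ha₁ : 0 < a₁) (ha₂ : 0 < a₂) (hr : r = y₁ ∨ r = y₂)
    (hr₁ : y₁ ≤ r) (hr₂ : y₂ ≤ r) (hlt : r < a₁ / a₂) :
    ∃ (T : ℝ) (x₁ x₂ : ℝ → ℝ), IsCollapse f₁ f₂ (Ico 0 T) T r a₁ a₂ x₁ x₂ := by
  have hrp := h.root_pos hr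
  obtain ⟨T, x₂, x₁, hc⟩ := h.swap.exists_collapse_below (r := r⁻¹) ha₂ ha₁
    (hr.imp (congrArg _) (congrArg _)) (inv_anti₀ h.pos₁ hr₁) (inv_anti₀ h.pos₂ hr₂)
    (by rw [← inv_div]; exact inv_strictAnti₀ hrp hlt)
  have := hc.swap (inv_ne_zero hrp.ne')
  rw [inv_inv] at this
  exact ⟨T, x₁, x₂, this⟩

theorem not_ancient_above {T : ℝ} (hT : 0 < T) {x₁ x₂ : ℝ → ℝ} (hlt₁ : y₁ < x₁ 0 / x₂ 0)
    (hlt₂ : y₂ < x₁ 0 / x₂ 0) : ¬ IsRatioFlow f₁ f₂ (Iio T) x₁ x₂ := by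
  intro hx
  refine h.swap.not_ancient_below hT ?_ ?_ hx.swap
  · rw [← inv_div]; exact inv_strictAnti₀ h.pos₁ hlt₁
  · rw [← inv_div]; exact inv_strictAnti₀ h.pos₂ hlt₂

/-- The case y₂ < y₁: the field is positive between the roots and vanishes at both, so the sweep of
(y₂, y₁) collapses at one end and is infinitely long at the other. -/
theorem exists_ancient_of_lt (ha₂ : 0 < a₂) (hlt₁ : a₁ / a₂ < y₁) (hlt₂ : y₂ < a₁ / a₂) :
    ∃ (T : ℝ) (x₁ x₂ : ℝ → ℝ), IsCollapse f₁ f₂ (Iio T) T y₁ a₁ a₂ x₁ x₂ ∧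
      Tendsto (fun t => x₁ t / x₂ t) atBot (𝓝 y₂) ∧
      ∃ ℓ > 0, Tendsto (fun t => x₂ t / |t|) atBot (𝓝 ℓ) := by
  obtain ⟨J, x₁, x₂, hs, e₁, e₂⟩ := h.exists_sweep h.pos₂.le ⟨hlt₂, hlt₁⟩ ha₂ le_rfl
    fun y hy => hy.1.ne'
  rw [div_mul_cancel₀ _ ha₂.ne'] at e₁
  have hf := h.field₂_pos y₁ (Or.inl rfl)
  have hb := hs.bddAbove h.mono₂ h.pos₁ hf
  have hb' := hs.not_bddBelow h.mono₂ h.pos₂ hf (h.differentiableAt_ratioField h.pos₂)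
    (h.ratioField_root (Or.inr rfl))
  have hc := hs.isCollapse (hs.eq_Iio hb hb').symm.subset h.mono₂ h.pos₂.le hf
    (h.differentiableAt_ratioField h.pos₁) (h.ratioField_root (Or.inl rfl))
  rw [e₁, e₂] at hc
  exact ⟨_, x₁, x₂, hc, hs.tendsto_ratio_atBot hb' hb, _, h.field₂_pos y₂ (Or.inr rfl),
    hs.tendsto_div_abs hb' hb h.pos₂ h.contDiffOn₂.continuousOn⟩

/-- Between the roots the flow is ancient and goes from the double root to the simple one. -/
theorem exists_ancient (ha₁ : 0 < a₁) (ha₂ : 0 < a₂) (hmin : min y₁ y₂ < a₁ / a₂)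
    (hmax : a₁ / a₂ < max y₁ y₂) :
    ∃ (T : ℝ) (x₁ x₂ : ℝ → ℝ), IsCollapse f₁ f₂ (Iio T) T y₁ a₁ a₂ x₁ x₂ ∧
      Tendsto (fun t => x₁ t / x₂ t) atBot (𝓝 y₂) ∧
      ∃ ℓ > 0, Tendsto (fun t => x₂ t / |t|) atBot (𝓝 ℓ) := by
  rcases le_total y₂ y₁ with hle | hle
  · rw [min_eq_right hle] at hmin
    rw [max_eq_left hle] at hmax
    exact h.exists_ancient_of_lt ha₂ hmax hmin
  · rw [min_eq_left hle] at hmin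
    rw [max_eq_right hle] at hmax
    obtain ⟨T, x₂, x₁, hc, hr, ℓ, hℓ, hx⟩ := h.swap.exists_ancient_of_lt (a₁ := a₂) ha₁
      (by rw [← inv_div]; exact inv_strictAnti₀ h.pos₁ hmin)
      (by rw [← inv_div]; exact inv_strictAnti₀ (div_pos ha₁ ha₂) hmax)
    have hc' := hc.swap (inv_ne_zero h.pos₁.ne')
    rw [inv_inv] at hc'
    -- After the exchange ℓ is the limit of x₁/|t|; multiplying by x₂/x₁ → 1/y₂ gives that of
    -- x₂/|t|.
    refine ⟨T, x₁, x₂, hc', ?_, y₂⁻¹ * ℓ, mul_pos (inv_pos.2 h.pos₂) hℓ, ?_⟩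
    · simpa only [inv_div, inv_inv] using hr.inv₀ (inv_ne_zero h.pos₂.ne')
    · refine (hr.mul hx).congr' ?_
      filter_upwards [eventually_lt_atBot T] with t ht
      have := (hc'.flow.pos₁ t ht).ne'
      field_simp

end DoubleRootFlow



/-! ### Roots of the Einstein cubic and signs of the Ricci weights -/

/-- Three roots counted with multiplicity force degree exactly 3 and a complete splitting. -/
theorem eval_eq_of_roots_eq {p : Polynomial ℝ} {y₁ y₂ y₃ : ℝ} (hp : p.natDegree ≤ 3)
    (hr : p.roots = {y₁, y₂, y₃}) (y : ℝ) :
    p.eval y = p.coeff 3 * ((y - y₁) * (y - y₂) * (y - y₃)) ∧ p.coeff 3 ≠ 0 := by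
  have hcard : Multiset.card p.roots = 3 := by rw [hr]; rfl
  have hdeg : p.natDegree = 3 := le_antisymm hp (hcard ▸ p.card_roots')
  have hlead : p.leadingCoeff = p.coeff 3 := by rw [Polynomial.leadingCoeff, hdeg]
  refine ⟨?_, ?_⟩
  · have h1 := Polynomial.C_leadingCoeff_mul_prod_multiset_X_sub_C (hcard.trans hdeg.symm)
    conv_lhs => rw [← h1, hr, hlead]
    simp [mul_assoc]
  · rw [← hlead, Polynomial.leadingCoeff_ne_zero]
    rintro rfl
    simp at hdeg

theorem contDiffOn_ricciWeight (d b c₁₁₁ c₁₁₂ c₁₂₂ : ℝ) :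
    ContDiffOn ℝ 1 (fun y => 2 * ricciWeight d b c₁₁₁ c₁₁₂ c₁₂₂ y) (Ioi 0) := by
  intro y hy
  have hy' : y ≠ 0 := (mem_Ioi.1 hy).ne'
  simp only [ricciWeight]
  have h1 : ContDiffAt ℝ 1 (fun y : ℝ => c₁₁₂ / d / y) y := contDiffAt_const.div contDiffAt_id hy'
  exact ContDiffAt.contDiffWithinAt (by fun_prop)

theorem monotoneOn_ricciWeight {d b c₁₁₁ c₁₁₂ c₁₂₂ : ℝ} (hd : 0 < d) (h₁ : 0 ≤ c₁₁₂)
    (h₂ : 0 ≤ c₁₂₂) : MonotoneOn (fun y => 2 * ricciWeight d b c₁₁₁ c₁₁₂ c₁₂₂ y) (Ioi 0) := by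
  intro y hy z hz hyz
  have hy' : 0 < y := hy
  have h3 : c₁₁₂ / d / z ≤ c₁₁₂ / d / y := by gcongr
  have h4 : c₁₂₂ / (2 * d) * y ^ 2 ≤ c₁₂₂ / (2 * d) * z ^ 2 := by gcongr
  simp only [ricciWeight]
  linarith

/-- For y ≥ 1/2 the negative term satisfies B/y ≤ 2B ≤ A, and the quadratic term is strictly
positive. -/
theorem ricciWeight_pos {d b c₁₁₁ c₁₁₂ c₁₂₂ y : ℝ} (hd : 0 < d) (h₁ : 0 ≤ c₁₁₂)
    (h₂ : 0 < c₁₂₂) (hA : 2 * (c₁₁₂ / d) ≤ b - c₁₁₁ / (2 * d) - c₁₂₂ / d) (hy : 1 / 2 ≤ y) :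
    0 < 2 * ricciWeight d b c₁₁₁ c₁₁₂ c₁₂₂ y := by
  have hy' : 0 < y := by linarith
  have h3 : c₁₁₂ / d / y ≤ c₁₁₂ / d / (1 / 2) := by gcongr
  have h4 : 0 < c₁₂₂ / (2 * d) * y ^ 2 := by positivity
  simp only [ricciWeight]
  linarith

/-- The ratio flow of two Ricci weights whose cubic has a simple and a double root. -/
theorem exists_doubleRootFlow {d₁ d₂ b₁ b₂ c₁₁₁ c₁₁₂ c₁₂₂ c₂₂₂ y₁ y₂ : ℝ} (hd₁ : 0 < d₁)
    (hd₂ : 0 < d₂) (h₁₁₂ : 0 < c₁₁₂) (h₁₂₂ : 0 ≤ c₁₂₂)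
    (hA₁ : 2 * (c₁₁₂ / d₁) ≤ b₁ - c₁₁₁ / (2 * d₁) - c₁₂₂ / d₁)
    (hA₂ : 2 * (c₁₂₂ / d₂) ≤ b₂ - c₂₂₂ / (2 * d₂) - c₁₁₂ / d₂)
    (hroots : (einsteinCubic d₁ d₂ b₁ b₂ c₁₁₁ c₁₁₂ c₁₂₂ c₂₂₂).roots = {y₁, y₂, y₂}) :
    ∃ a, DoubleRootFlow (fun y => 2 * ricciWeight d₁ b₁ c₁₁₁ c₁₁₂ c₁₂₂ y)
      (fun y => 2 * ricciWeight d₂ b₂ c₂₂₂ c₁₂₂ c₁₁₂ y) a y₁ y₂ := by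
  set p := einsteinCubic d₁ d₂ b₁ b₂ c₁₁₁ c₁₁₂ c₁₂₂ c₂₂₂ with hp
  set a := c₁₂₂ / d₂ + c₁₂₂ / (2 * d₁) with ha
  have hcoeff : p.coeff 3 = -a := by
    simp only [hp, einsteinCubic, Polynomial.coeff_add, Polynomial.coeff_sub,
      Polynomial.coeff_C_mul, Polynomial.coeff_X_pow, Polynomial.coeff_X, Polynomial.coeff_C]
    norm_num [ha]
  have hdeg : p.natDegree ≤ 3 := by
    rw [hp, einsteinCubic]; compute_degree
  have heval : ∀ y, p.eval y = a * ((y₁ - y) * (y - y₂) ^ 2) := fun y => by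
    rw [(eval_eq_of_roots_eq hdeg hroots y).1, hcoeff]; ring
  -- Maximality gives only [112] > 0. That [122] > 0 comes from the cubic having three roots:
  -- otherwise its leading coefficient would vanish.
  have ha0 : a ≠ 0 := fun h0 =>
    (eval_eq_of_roots_eq hdeg hroots 0).2 (by rw [hcoeff, h0, neg_zero])
  have hapos : 0 < a := lt_of_le_of_ne (by positivity) ha0.symm
  have h122 : 0 < c₁₂₂ := by
    refine lt_of_le_of_ne h₁₂₂ fun h0 => ha0 ?_
    rw [ha, ← h0]; simp
  have hexp : ∀ y, p.eval y = -a * y ^ 3 + (b₂ - c₂₂₂ / (2 * d₂) - c₁₁₂ / d₂) * y ^ 2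
      - (b₁ - c₁₁₁ / (2 * d₁) - c₁₂₂ / d₁) * y + (c₁₁₂ / d₁ + c₁₁₂ / (2 * d₂)) := fun y => by
    simp [hp, einsteinCubic, ha]
  have hB₁ : 0 < c₁₁₂ / d₁ := by positivity
  have hB₂ : 0 < c₁₂₂ / d₂ := by positivity
  have hC₂ : 0 < c₁₁₂ / (2 * d₂) := by positivity
  -- For y ≤ 0 every term of the cubic is nonnegative and its constant term is positive, so no such
  -- y is a root.
  have hpos : ∀ y, p.eval y = 0 → 0 < y := by
    intro y hy
    by_contra hle
    have hle' : 0 ≤ -y := by linarith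
    rw [hexp] at hy
    have h1 : 0 ≤ a * (-y) ^ 3 := by positivity
    have h2 : 0 ≤ (b₂ - c₂₂₂ / (2 * d₂) - c₁₁₂ / d₂) * y ^ 2 :=
      mul_nonneg (by linarith) (sq_nonneg y)
    have h3 : 0 ≤ (b₁ - c₁₁₁ / (2 * d₁) - c₁₂₂ / d₁) * (-y) := mul_nonneg (by linarith) hle'
    nlinarith
  have hfield : ∀ y, 0 < y → y * ratioField (fun y => 2 * ricciWeight d₁ b₁ c₁₁₁ c₁₁₂ c₁₂₂ y)
      (fun y => 2 * ricciWeight d₂ b₂ c₂₂₂ c₁₂₂ c₁₁₂ y) y = p.eval y := by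
    intro y hy
    rw [hexp, ha]
    simp only [ratioField, ricciWeight]
    field_simp
    ring
  have hroot : ∀ y, y = y₁ ∨ y = y₂ → p.eval y = 0 := by
    rintro y (rfl | rfl) <;> rw [heval] <;> simp
  have hq : ∀ y, y = y₁ ∨ y = y₂ → y * (2 * ricciWeight d₂ b₂ c₂₂₂ c₁₂₂ c₁₁₂ y⁻¹)
      = 2 * ricciWeight d₁ b₁ c₁₁₁ c₁₁₂ c₁₂₂ y := by
    intro y hy
    have hyp := hpos y (hroot y hy)
    have h1 := hfield y hyp
    rw [hroot y hy] at h1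
    exact sub_eq_zero.1 ((mul_eq_zero.1 h1).resolve_left hyp.ne')
  -- At a root f₁(y) = y f₂(1/y), so one positive speed suffices: f₁ is positive if y ≥ 1/2, and f₂
  -- is if y ≤ 1/2, because then 1/y ≥ 2.
  have hw : ∀ y, y = y₁ ∨ y = y₂ → 0 < 2 * ricciWeight d₁ b₁ c₁₁₁ c₁₁₂ c₁₂₂ y := by
    intro y hy
    rcases le_total (1 / 2) y with h1 | h1
    · exact ricciWeight_pos hd₁ h₁₁₂.le h122 hA₁ h1
    · have hyp := hpos y (hroot y hy)
      rw [← hq y hy]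
      refine mul_pos hyp (ricciWeight_pos hd₂ h₁₂₂ h₁₁₂ hA₂ ?_)
      rw [le_inv_comm₀ (by norm_num) hyp]
      norm_num
      linarith
  exact ⟨a, contDiffOn_ricciWeight _ _ _ _ _, contDiffOn_ricciWeight _ _ _ _ _,
    monotoneOn_ricciWeight hd₁ h₁₁₂.le h₁₂₂, monotoneOn_ricciWeight hd₂ h₁₂₂ h₁₁₂.le, hapos,
    hpos _ (hroot _ (Or.inl rfl)), hpos _ (hroot _ (Or.inr rfl)),
    fun y hy => (hfield y hy).trans (heval y), hw, fun y hy =>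
      pos_of_mul_pos_right ((hq y hy).symm ▸ hw y hy) (hpos y (hroot y hy)).le⟩


/-! ### The Ricci flow as a ratio flow, and curvature along it -/

namespace TwoSummands

variable {L : Type*} [LieRing L] [LieAlgebra ℝ L] {Γ : Type*} [Group Γ]
  {ρ : Representation ℝ Γ L} {D : Decomposition L} {Q : ScalarProduct L}
  {p₁ p₂ : Submodule ℝ L} {d₁ d₂ : ℕ} {e₁ : Module.Basis (Fin d₁) ℝ p₁}
  {e₂ : Module.Basis (Fin d₂) ℝ p₂}

/-- The speed of `x₁` under the Ricci flow, as a function of `x₁ / x₂`. -/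
def speed₁ (Q : ScalarProduct L) (e₁ : Module.Basis (Fin d₁) ℝ p₁)
    (e₂ : Module.Basis (Fin d₂) ℝ p₂) (b₁ y : ℝ) : ℝ :=
  2 * ricciWeight d₁ b₁ (structureConstant Q e₁ e₁ e₁) (structureConstant Q e₁ e₁ e₂)
    (structureConstant Q e₁ e₂ e₂) y

/-- The speed of `x₂` under the Ricci flow, as a function of `x₂ / x₁`. -/
def speed₂ (Q : ScalarProduct L) (e₁ : Module.Basis (Fin d₁) ℝ p₁)
    (e₂ : Module.Basis (Fin d₂) ℝ p₂) (b₂ y : ℝ) : ℝ :=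
  2 * ricciWeight d₂ b₂ (structureConstant Q e₂ e₂ e₂) (structureConstant Q e₁ e₂ e₂)
    (structureConstant Q e₁ e₁ e₂) y

variable [FiniteDimensional ℝ L] (h : TwoSummands ρ D Q e₁ e₂)

include h

/-- The curvature norm as a function of the ratio, for `x₂ = 1`. -/
def curvProfile (y : ℝ) : ℝ :=
  curvNormCoeff (strConst Q h.basis) (isotropyConst Q h.basis) (weights d₁ d₂ y 1)

/-- Rescaling to x₂ = 1 separates the curvature norm into a function of the ratio and the factor
1/x₂; this reduces the type I estimates to the size of x₂. -/
theorem curvatureNorm_eq_div {g : ScalarProduct D.p} {x₁ x₂ : ℝ} (hx₂ : 0 < x₂)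
    (hg : IsDiagonal g h.basis (weights d₁ d₂ x₁ x₂)) :
    curvatureNorm D g = h.curvProfile (x₁ / x₂) / x₂ := by
  rw [h.adapted.curvatureNorm_eq h.orthonormal_basis hg, curvProfile, ← curvNormCoeff_smul _ _ _ hx₂]
  congr 1
  funext i
  rcases i with i | i <;> simp [weights, mul_div_cancel₀, hx₂.ne']

theorem continuousOn_curvProfile : ContinuousOn h.curvProfile (Ioi 0) := by
  refine continuousOn_curvNormCoeff _ _ ?_ ?_
  · rintro (i | i)
    · exact continuousOn_id
    · exact continuousOn_const
  · rintro y hy (i | i)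
    · exact (mem_Ioi.1 hy).ne'
    · exact one_ne_zero

theorem curvProfile_nonneg (y : ℝ) : 0 ≤ h.curvProfile y := Real.sqrt_nonneg _

theorem isDiagonal_weights {g : ScalarProduct D.p} {x₁ x₂ z₁ z₂ : ℝ}
    (hx : IsDiagonal g h.basis (weights d₁ d₂ x₁ x₂))
    (hz : IsDiagonal g h.basis (weights d₁ d₂ z₁ z₂)) : x₁ = z₁ ∧ x₂ = z₂ := by
  have h1 : ∀ i, weights d₁ d₂ x₁ x₂ i = weights d₁ d₂ z₁ z₂ i := fun i => by
    have h2 := hz i i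
    rw [hx i i, if_pos rfl, if_pos rfl] at h2
    exact h2
  exact ⟨h1 (.inl ⟨0, h.pos₁⟩), h1 (.inr ⟨0, h.pos₂⟩)⟩

variable {b₁ b₂ : ℝ} (hb₁ : ∀ X ∈ p₁, ∀ Y ∈ p₁, -killingForm ℝ L X Y = b₁ * Q.form X Y)
  (hb₂ : ∀ X ∈ p₂, ∀ Y ∈ p₂, -killingForm ℝ L X Y = b₂ * Q.form X Y)

include hb₁ hb₂

theorem two_mul_ricci {g : ScalarProduct D.p} {x₁ x₂ : ℝ} (hx₁ : 0 < x₁) (hx₂ : 0 < x₂)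
    (hg : IsDiagonal g h.basis (weights d₁ d₂ x₁ x₂)) (X Y : D.p) :
    2 * ricci D g X Y = ∑ i, weights d₁ d₂ (speed₁ Q e₁ e₂ b₁ (x₁ / x₂))
      (speed₂ Q e₁ e₂ b₂ (x₂ / x₁)) i * (h.basis.repr X i * h.basis.repr Y i) := by
  rw [bilin_eq_sum h.basis (ricci_bilin g h.basis) (h.ricci_weights hb₁ hb₂ hx₁ hx₂ hg) X Y,
    Finset.mul_sum]
  refine Finset.sum_congr rfl fun i _ => ?_
  rcases i with i | i <;> simp only [weights, speed₁, speed₂, Sum.elim_inl, Sum.elim_inr] <;> ring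

/-- A diagonal metric is Einstein if and only if its ratio is a zero of the ratio field. -/
theorem einstein_iff {g : ScalarProduct D.p} {x₁ x₂ : ℝ} (hx₁ : 0 < x₁) (hx₂ : 0 < x₂)
    (hg : IsDiagonal g h.basis (weights d₁ d₂ x₁ x₂)) :
    (∃ c : ℝ, ∀ X Y : D.p, ricci D g X Y = c * g.form X Y) ↔
      ratioField (speed₁ Q e₁ e₂ b₁) (speed₂ Q e₁ e₂ b₂) (x₁ / x₂) = 0 := by
  have hR := h.two_mul_ricci hb₁ hb₂ hx₁ hx₂ hg
  have hF := bilin_eq_sum h.basis (form_bilin g.form h.basis) hg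
  rw [ratioField, inv_div, sub_eq_zero]
  constructor
  · rintro ⟨c, hc⟩
    have hi : ∀ i, weights d₁ d₂ (speed₁ Q e₁ e₂ b₁ (x₁ / x₂)) (speed₂ Q e₁ e₂ b₂ (x₂ / x₁)) i
        = 2 * c * weights d₁ d₂ x₁ x₂ i := by
      intro i
      have h1 := hR (h.basis i) (h.basis i)
      rw [hc, hg i i, if_pos rfl, Finset.sum_eq_single i (fun j _ hj => by
        simp [hj.symm]) (by simp)] at h1
      simp only [Module.Basis.repr_self, Finsupp.single_eq_same, mul_one] at h1
      linarith
    have h1 := hi (.inl ⟨0, h.pos₁⟩)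
    have h2 := hi (.inr ⟨0, h.pos₂⟩)
    simp only [weights, Sum.elim_inl, Sum.elim_inr] at h1 h2
    rw [h1, h2]
    field_simp
  · intro h1
    -- The Einstein constant as read off on 𝔭₂; vanishing of the ratio field says that 𝔭₁ gives the
    -- same value.
    refine ⟨speed₂ Q e₁ e₂ b₂ (x₂ / x₁) / (2 * x₂), fun X Y => ?_⟩
    have h2 := hR X Y
    rw [hF X Y, Finset.mul_sum]
    rw [show ricci D g X Y = (2 * ricci D g X Y) / 2 by ring, h2, Finset.sum_div]
    refine Finset.sum_congr rfl fun i _ => ?_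
    rcases i with i | i <;> simp only [weights, Sum.elim_inl, Sum.elim_inr]
    · rw [← h1]; field_simp
    · field_simp

/-- A flat metric is Ricci flat, but the Ricci tensor on 𝔭₁ is half the speed, which is positive. -/
theorem curvProfile_pos {y : ℝ} (hy : 0 < y) (hs : 0 < speed₁ Q e₁ e₂ b₁ y) :
    0 < h.curvProfile y := by
  refine lt_of_le_of_ne (h.curvProfile_nonneg y) fun h0 => ?_
  have hg := h.metric_isDiagonal hy one_pos
  have h1 := h.two_mul_ricci hb₁ hb₂ hy one_pos hg (h.basis (.inl ⟨0, h.pos₁⟩))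
    (h.basis (.inl ⟨0, h.pos₁⟩))
  rw [h.adapted.ricci_eq_zero_of_curvatureNorm h.orthonormal_basis hg h0.symm,
    Finset.sum_eq_single (.inl ⟨0, h.pos₁⟩) (fun j _ hj => by
        simp [hj.symm]) (by simp)] at h1
  simp only [Module.Basis.repr_self, Finsupp.single_eq_same, mul_one, weights, Sum.elim_inl,
    div_one, mul_zero] at h1
  exact hs.ne h1

/-- The homogeneous Ricci flow is a ratio flow of the weights. -/
theorem ricciFlow_iff {J : Set ℝ} {g : ℝ → ScalarProduct D.p} {x₁ x₂ : ℝ → ℝ}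
    (hx₁ : ∀ t ∈ J, 0 < x₁ t) (hx₂ : ∀ t ∈ J, 0 < x₂ t)
    (hg : ∀ t ∈ J, IsDiagonal (g t) h.basis (weights d₁ d₂ (x₁ t) (x₂ t))) :
    (∀ t ∈ J, ∀ X Y : D.p,
      HasDerivWithinAt (fun s => (g s).form X Y) (-2 * ricci D (g t) X Y) J t) ↔
      IsRatioFlow (speed₁ Q e₁ e₂ b₁) (speed₂ Q e₁ e₂ b₂) J x₁ x₂ := by
  have hR := fun t ht => h.two_mul_ricci hb₁ hb₂ (hx₁ t ht) (hx₂ t ht) (hg t ht)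
  constructor
  · intro hf
    have hi : ∀ i, ∀ t ∈ J, HasDerivWithinAt (fun s => weights d₁ d₂ (x₁ s) (x₂ s) i)
        (-weights d₁ d₂ (speed₁ Q e₁ e₂ b₁ (x₁ t / x₂ t)) (speed₂ Q e₁ e₂ b₂ (x₂ t / x₁ t)) i)
        J t := by
      intro i t ht
      have h1 := hR t ht (h.basis i) (h.basis i)
      rw [Finset.sum_eq_single i (fun j _ hj => by
        simp [hj.symm]) (by simp)] at h1
      simp only [Module.Basis.repr_self, Finsupp.single_eq_same, mul_one] at h1
      rw [← h1, ← neg_mul]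
      have hF : ∀ s ∈ J, weights d₁ d₂ (x₁ s) (x₂ s) i = (g s).form (h.basis i) (h.basis i) :=
        fun s hs => by rw [hg s hs i i, if_pos rfl]
      exact (hf t ht _ _).congr hF (hF t ht)
    exact ⟨hx₁, hx₂, hi (.inl ⟨0, h.pos₁⟩), hi (.inr ⟨0, h.pos₂⟩)⟩
  · intro hf t ht X Y
    have hF : ∀ s ∈ J, (g s).form X Y
        = ∑ i, weights d₁ d₂ (x₁ s) (x₂ s) i * (h.basis.repr X i * h.basis.repr Y i) :=
      fun s hs => bilin_eq_sum h.basis (form_bilin (g s).form h.basis) (hg s hs) X Y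
    refine HasDerivWithinAt.congr ?_ hF (hF t ht)
    rw [neg_mul, hR t ht, ← Finset.sum_neg_distrib]
    refine HasDerivWithinAt.fun_sum fun i _ => ?_
    rw [← neg_mul]
    refine HasDerivWithinAt.mul_const ?_ _
    rcases i with i | i
    · exact hf.deriv₁ t ht
    · exact hf.deriv₂ t ht

omit hb₁ hb₂ in
/-- Collapsing metrics tend to zero. -/
theorem tendsto_form {f₁ f₂ : ℝ → ℝ} {J : Set ℝ} {T r a₁ a₂ : ℝ} {x₁ x₂ : ℝ → ℝ}
    {g : ℝ → ScalarProduct D.p} (hc : IsCollapse f₁ f₂ J T r a₁ a₂ x₁ x₂)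
    (hg : ∀ t ∈ Ico 0 T, IsDiagonal (g t) h.basis (weights d₁ d₂ (x₁ t) (x₂ t))) (X Y : D.p) :
    Tendsto (fun t => (g t).form X Y) (𝓝[<] T) (𝓝 0) := by
  have h1 : Tendsto (fun t => ∑ i, weights d₁ d₂ (x₁ t) (x₂ t) i *
      (h.basis.repr X i * h.basis.repr Y i)) (𝓝[<] T)
      (𝓝 (∑ i : Fin d₁ ⊕ Fin d₂, 0 * (h.basis.repr X i * h.basis.repr Y i))) := by
    refine tendsto_finsetSum _ fun i _ => Tendsto.mul_const _ ?_
    rcases i with i | i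
    · exact hc.tendsto₁
    · exact hc.tendsto₂
  simp only [zero_mul, Finset.sum_const_zero] at h1
  refine h1.congr' ?_
  filter_upwards [Ico_mem_nhdsLT hc.time_pos] with t ht
  exact (bilin_eq_sum h.basis (form_bilin (g t).form h.basis) (hg t ht) X Y).symm

/-- Along collapsing metrics the curvature blows up. -/
theorem not_bddAbove_curvatureNorm {f₂ : ℝ → ℝ} {J : Set ℝ} {T r a₁ a₂ : ℝ} {x₁ x₂ : ℝ → ℝ}
    {g : ℝ → ScalarProduct D.p} (hJ : Ico 0 T ⊆ J)
    (hc : IsCollapse (speed₁ Q e₁ e₂ b₁) f₂ J T r a₁ a₂ x₁ x₂)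
    (hg : ∀ t ∈ Ico 0 T, IsDiagonal (g t) h.basis (weights d₁ d₂ (x₁ t) (x₂ t))) (hr : 0 < r)
    (hs : 0 < speed₁ Q e₁ e₂ b₁ r) :
    ¬ BddAbove ((fun t => curvatureNorm D (g t)) '' Ico 0 T) := by
  have hT := Ico_mem_nhdsLT hc.time_pos
  have h1 : Tendsto (fun t => h.curvProfile (x₁ t / x₂ t)) (𝓝[<] T) (𝓝 (h.curvProfile r)) :=
    (h.continuousOn_curvProfile.continuousAt (Ioi_mem_nhds hr)).tendsto.comp hc.ratio
  have h2 : Tendsto (fun t => (x₂ t)⁻¹) (𝓝[<] T) atTop := by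
    refine tendsto_inv_nhdsGT_zero.comp (tendsto_nhdsWithin_iff.2 ⟨hc.tendsto₂, ?_⟩)
    filter_upwards [hT] with t ht
    exact hc.flow.pos₂ t (hJ ht)
  have h3 := h1.pos_mul_atTop (h.curvProfile_pos hb₁ hb₂ hr hs) h2
  rintro ⟨M, hM⟩
  obtain ⟨t, ht, htT⟩ := ((h3.eventually_gt_atTop M).and hT).exists
  have h4 := hM (mem_image_of_mem _ htT)
  simp only [h.curvatureNorm_eq_div (hc.flow.pos₂ t (hJ htT)) (hg t htT), div_eq_mul_inv] at h4
  exact h4.not_gt ht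

omit hb₁ hb₂ in
/-- Along collapsing metrics the curvature grows at most like `1 / (T - t)`. -/
theorem bddAbove_mul_curvatureNorm {f₁ f₂ : ℝ → ℝ} {J : Set ℝ} {T r a₁ a₂ : ℝ} {x₁ x₂ : ℝ → ℝ}
    {g : ℝ → ScalarProduct D.p} (hJ : Ico 0 T ⊆ J)
    (hc : IsCollapse f₁ f₂ J T r a₁ a₂ x₁ x₂)
    (hg : ∀ t ∈ Ico 0 T, IsDiagonal (g t) h.basis (weights d₁ d₂ (x₁ t) (x₂ t))) :
    BddAbove ((fun t => (T - t) * curvatureNorm D (g t)) '' Ico 0 T) := by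
  obtain ⟨c, hc0, hlow⟩ := hc.lower
  obtain ⟨m, M, hm, hbd⟩ := hc.bounds
  obtain ⟨N, hN⟩ := isCompact_Icc.bddAbove_image
    (h.continuousOn_curvProfile.mono fun y (hy : y ∈ Icc m M) => hm.trans_le hy.1)
  refine ⟨c⁻¹ * N, ?_⟩
  rintro _ ⟨t, ht, rfl⟩
  have hx := hc.flow.pos₂ t (hJ ht)
  have hN' : h.curvProfile (x₁ t / x₂ t) ≤ N := hN (mem_image_of_mem _ (hbd t ht))
  have h0 := h.curvProfile_nonneg (x₁ t / x₂ t)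
  have h1 : (T - t) / x₂ t ≤ c⁻¹ := by
    rw [div_le_iff₀ hx, ← div_eq_inv_mul, le_div_iff₀' hc0]
    exact (hlow t ht).2
  have h2 : 0 ≤ c⁻¹ := by positivity
  simp only [h.curvatureNorm_eq_div hx (hg t ht)]
  calc _ = (T - t) / x₂ t * h.curvProfile (x₁ t / x₂ t) := by ring
    _ ≤ c⁻¹ * N := mul_le_mul h1 hN' h0 h2

omit hb₁ hb₂ in
theorem tendsto_abs_mul_curvatureNorm {J : Set ℝ} {x₁ x₂ : ℝ → ℝ} {lo ℓ : ℝ}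
    {g : ℝ → ScalarProduct D.p} (hJ : J ∈ atBot) (hpos : ∀ t ∈ J, 0 < x₂ t)
    (hg : ∀ t ∈ J, IsDiagonal (g t) h.basis (weights d₁ d₂ (x₁ t) (x₂ t))) (hlo : 0 < lo)
    (hℓ : ℓ ≠ 0) (hr : Tendsto (fun t => x₁ t / x₂ t) atBot (𝓝 lo))
    (hx : Tendsto (fun t => x₂ t / |t|) atBot (𝓝 ℓ)) :
    Tendsto (fun t => |t| * curvatureNorm D (g t)) atBot (𝓝 (ℓ⁻¹ * h.curvProfile lo)) := by
  have h1 : Tendsto (fun t => h.curvProfile (x₁ t / x₂ t)) atBot (𝓝 (h.curvProfile lo)) :=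
    (h.continuousOn_curvProfile.continuousAt (Ioi_mem_nhds hlo)).tendsto.comp hr
  refine ((hx.inv₀ hℓ).mul h1).congr' ?_
  filter_upwards [hJ] with t ht
  rw [h.curvatureNorm_eq_div (hpos t ht) (hg t ht), inv_div]
  ring

end TwoSummands


/-! ### Back to the homogeneous space: invariant metrics and their Ricci flow -/

section Homogeneous

variable {E : Type*} [NormedAddCommGroup E] [NormedSpace ℝ E] [FiniteDimensional ℝ E]
  [CompleteSpace E] {H : Type*} [TopologicalSpace H] {I : ModelWithCorners ℝ E H}
  [I.Boundaryless] {G : Type*} [TopologicalSpace G] [ChartedSpace H G] [Group G] [LieGroup I ∞ G]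
  {K : Subgroup G}

variable (I K) in
/-- The adjoint representation of `K` on the Lie algebra of `G`. -/
def adRep : Representation ℝ K (GroupLieAlgebra I G) where
  toFun a := (Ad I (a : G) : GroupLieAlgebra I G →ₗ[ℝ] GroupLieAlgebra I G)
  map_one' := by
    ext X
    exact Ad_one X
  map_mul' a b := by
    ext X
    exact Ad_mul (a : G) b X

theorem AdInvariant.adRep {V : Submodule ℝ (GroupLieAlgebra I G)} :
    AdInvariant I K V ↔ ∀ a, ∀ X ∈ V, adRep I K a X ∈ V :=
  ⟨fun h a => h a a.2, fun h a ha => h ⟨a, ha⟩⟩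

theorem AdIrreducible.repIrreducible {V : Submodule ℝ (GroupLieAlgebra I G)}
    (h : AdIrreducible I K V) : RepIrreducible (adRep I K) V :=
  ⟨AdInvariant.adRep.1 h.1, h.2.1, fun U hU hinv => h.2.2 U hU (AdInvariant.adRep.2 hinv)⟩

theorem adEquivalent_of_repEquivalent {V W : Submodule ℝ (GroupLieAlgebra I G)}
    (h : RepEquivalent (adRep I K) V W) : AdEquivalent I K V W := by
  obtain ⟨φ, hφ⟩ := h
  exact ⟨φ, fun a ha => hφ ⟨a, ha⟩⟩

variable {Q : ScalarProduct (GroupLieAlgebra I G)} {D : Decomposition (GroupLieAlgebra I G)}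
  {p₁ p₂ : Submodule ℝ (GroupLieAlgebra I G)} {d₁ d₂ : ℕ} {e₁ : Module.Basis (Fin d₁) ℝ p₁}
  {e₂ : Module.Basis (Fin d₂) ℝ p₂}

namespace TwoSummands

variable (h : TwoSummands (adRep I K) D Q e₁ e₂)

include h

theorem hasRatio_iff (g : InvariantMetric I K D) (y : ℝ) :
    HasRatio Q p₁ p₂ g y ↔ ∃ x₁ x₂ : ℝ, 0 < x₁ ∧ 0 < x₂ ∧ y = x₁ / x₂ ∧
      IsDiagonal g.toScalarProduct h.basis (weights d₁ d₂ x₁ x₂) := by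
  simp only [HasRatio, h.isDiagonal_iff]

theorem exists_isDiagonal_invariant (g : InvariantMetric I K D) : ∃ x₁ x₂ : ℝ, 0 < x₁ ∧ 0 < x₂ ∧
    IsDiagonal g.toScalarProduct h.basis (weights d₁ d₂ x₁ x₂) :=
  h.exists_isDiagonal g.toScalarProduct fun a => g.invariant a a.2

theorem hasRatio_unique {g : InvariantMetric I K D} {y z : ℝ} (hy : HasRatio Q p₁ p₂ g y)
    (hz : HasRatio Q p₁ p₂ g z) : y = z := by
  obtain ⟨x₁, x₂, _, _, rfl, hx⟩ := (h.hasRatio_iff g y).1 hy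
  obtain ⟨z₁, z₂, _, _, rfl, hz'⟩ := (h.hasRatio_iff g z).1 hz
  obtain ⟨rfl, rfl⟩ := h.isDiagonal_weights hx hz'
  rfl

theorem exists_weights_family (g : ℝ → InvariantMetric I K D) : ∃ x₁ x₂ : ℝ → ℝ,
    (∀ t, 0 < x₁ t) ∧ (∀ t, 0 < x₂ t) ∧
      ∀ t, IsDiagonal (g t).toScalarProduct h.basis (weights d₁ d₂ (x₁ t) (x₂ t)) := by
  choose x₁ x₂ h₁ h₂ hx using fun t => h.exists_isDiagonal_invariant (g t)
  exact ⟨x₁, x₂, h₁, h₂, hx⟩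

/-- The invariant metric `x₁ Q|𝔭₁ ⊕ x₂ Q|𝔭₂`. -/
def invariantMetric {x₁ x₂ : ℝ} (hx₁ : 0 < x₁) (hx₂ : 0 < x₂) : InvariantMetric I K D where
  toScalarProduct := h.metric hx₁ hx₂
  invariant a ha := h.metric_form_rep (h.metric_isDiagonal hx₁ hx₂) ⟨a, ha⟩

theorem exists_family (x₁ x₂ : ℝ → ℝ) : ∃ g : ℝ → InvariantMetric I K D, ∀ t, 0 < x₁ t → 0 < x₂ t →
    IsDiagonal (g t).toScalarProduct h.basis (weights d₁ d₂ (x₁ t) (x₂ t)) := by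
  -- At times when the weights are not both positive, the metric with weights 1, 1 is an arbitrary
  -- default.
  refine ⟨fun t => if ht : 0 < x₁ t ∧ 0 < x₂ t then h.invariantMetric ht.1 ht.2
    else h.invariantMetric one_pos one_pos, fun t h₁ h₂ => ?_⟩
  simp only [dif_pos (And.intro h₁ h₂)]
  exact h.metric_isDiagonal h₁ h₂

omit h in
theorem eq_of_isDiagonal {ι : Type*} [DecidableEq ι] {g g' : InvariantMetric I K D}
    {e : Module.Basis ι ℝ D.p} {w : ι → ℝ} (hg : IsDiagonal g.toScalarProduct e w)
    (hg' : IsDiagonal g'.toScalarProduct e w) : g = g' := by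
  ext1
  exact e.ext fun i => e.ext fun j => (hg i j).trans (hg' i j).symm

variable {b₁ b₂ : ℝ}
  (hb₁ : ∀ X ∈ p₁, ∀ Y ∈ p₁, -killingForm ℝ (GroupLieAlgebra I G) X Y = b₁ * Q.form X Y)
  (hb₂ : ∀ X ∈ p₂, ∀ Y ∈ p₂, -killingForm ℝ (GroupLieAlgebra I G) X Y = b₂ * Q.form X Y)

include hb₁ hb₂

theorem isEinstein_iff {a y₁ y₂ : ℝ}
    (hd : DoubleRootFlow (speed₁ Q e₁ e₂ b₁) (speed₂ Q e₁ e₂ b₂) a y₁ y₂)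
    (g : InvariantMetric I K D) :
    IsEinstein g ↔ HasRatio Q p₁ p₂ g y₁ ∨ HasRatio Q p₁ p₂ g y₂ := by
  obtain ⟨x₁, x₂, hx₁, hx₂, hg⟩ := h.exists_isDiagonal_invariant g
  have hrat : HasRatio Q p₁ p₂ g (x₁ / x₂) := (h.hasRatio_iff g _).2 ⟨x₁, x₂, hx₁, hx₂, rfl, hg⟩
  rw [IsEinstein, h.einstein_iff hb₁ hb₂ hx₁ hx₂ hg]
  constructor
  · intro h0
    have h1 := hd.field_eq _ (div_pos hx₁ hx₂)
    rw [h0, mul_zero, eq_comm, mul_eq_zero, mul_eq_zero] at h1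
    rcases h1.resolve_left hd.pos.ne' with h2 | h2
    · left; rwa [← sub_eq_zero.1 h2] at hrat
    · right; rwa [sub_eq_zero.1 (pow_eq_zero_iff two_ne_zero |>.1 h2)] at hrat
  · rintro (h1 | h1)
    · exact hd.ratioField_root (Or.inl (h.hasRatio_unique hrat h1))
    · exact hd.ratioField_root (Or.inr (h.hasRatio_unique hrat h1))

theorem isRatioFlow_of_isHRFOn {J : Set ℝ} {g : ℝ → InvariantMetric I K D} (hg : IsHRFOn J g) :
    ∃ x₁ x₂ : ℝ → ℝ, IsRatioFlow (speed₁ Q e₁ e₂ b₁) (speed₂ Q e₁ e₂ b₂) J x₁ x₂ ∧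
      ∀ t, IsDiagonal (g t).toScalarProduct h.basis (weights d₁ d₂ (x₁ t) (x₂ t)) := by
  obtain ⟨x₁, x₂, hx₁, hx₂, hx⟩ := h.exists_weights_family g
  exact ⟨x₁, x₂, (h.ricciFlow_iff hb₁ hb₂ (fun t _ => hx₁ t) (fun t _ => hx₂ t)
    (fun t _ => hx t)).1 hg, hx⟩

/-- Uniqueness and maximality of a collapsing solution. -/
theorem eqOn_of_isCollapse {a y₁ y₂ T r a₁ a₂ : ℝ} {J J' : Set ℝ} {x₁ x₂ : ℝ → ℝ}
    {g g' : ℝ → InvariantMetric I K D} {g₀ : InvariantMetric I K D}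
    (hd : DoubleRootFlow (speed₁ Q e₁ e₂ b₁) (speed₂ Q e₁ e₂ b₂) a y₁ y₂)
    (hc : IsCollapse (speed₁ Q e₁ e₂ b₁) (speed₂ Q e₁ e₂ b₂) J T r a₁ a₂ x₁ x₂)
    (hJ : Ico 0 T ⊆ J) (hJc : J.OrdConnected)
    (hg : ∀ t ∈ J, IsDiagonal (g t).toScalarProduct h.basis (weights d₁ d₂ (x₁ t) (x₂ t)))
    (hg₀ : IsDiagonal g₀.toScalarProduct h.basis (weights d₁ d₂ a₁ a₂))
    (hJ' : J'.OrdConnected) (h0 : (0 : ℝ) ∈ J') (hg' : IsHRFOn J' g') (hg'0 : g' 0 = g₀) :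
    J' ⊆ Iio T ∧ EqOn g' g (J' ∩ J) := by
  obtain ⟨z₁, z₂, hz, hzd⟩ := h.isRatioFlow_of_isHRFOn hb₁ hb₂ hg'
  obtain ⟨e₁, e₂⟩ := h.isDiagonal_weights hg₀ (hg'0 ▸ hzd 0)
  rw [← hc.init₁] at e₁
  rw [← hc.init₂] at e₂
  refine ⟨IsRatioFlow.subset_Iio hd.contDiffOn₁ hd.contDiffOn₂ hc.time_pos (hc.flow.mono hJ)
    hc.tendsto₂ hJ' h0 hz e₁ e₂, fun t ht => ?_⟩
  obtain ⟨h1, h2⟩ := IsRatioFlow.eqOn hd.contDiffOn₁ hd.contDiffOn₂ (hJ'.inter hJc)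
    ⟨h0, hJ (left_mem_Ico.2 hc.time_pos)⟩ (hc.flow.mono inter_subset_right)
    (hz.mono inter_subset_left) e₁ e₂ ht
  have h3 := hzd t
  rw [← h1, ← h2] at h3
  exact eq_of_isDiagonal h3 (hg t ht.2)

/-- A collapsing ratio flow gives a solution of the homogeneous Ricci flow that shrinks to a point
in a type I singularity. -/
theorem exists_flow_of_isCollapse {T r a₁ a₂ : ℝ} {J : Set ℝ} {x₁ x₂ : ℝ → ℝ}
    {g₀ : InvariantMetric I K D}
    (hc : IsCollapse (speed₁ Q e₁ e₂ b₁) (speed₂ Q e₁ e₂ b₂) J T r a₁ a₂ x₁ x₂)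
    (hJ : Ico 0 T ⊆ J) (hg₀ : IsDiagonal g₀.toScalarProduct h.basis (weights d₁ d₂ a₁ a₂))
    (hr : 0 < r) (hs : 0 < speed₁ Q e₁ e₂ b₁ r) :
    ∃ g : ℝ → InvariantMetric I K D, IsHRFOn J g ∧ g 0 = g₀ ∧ IsTypeISingularity T g ∧
      ShrinksToPoint T g ∧ RatioTendsto Q p₁ p₂ J g (𝓝[<] T) r ∧
      (∀ t ∈ J, IsDiagonal (g t).toScalarProduct h.basis (weights d₁ d₂ (x₁ t) (x₂ t))) ∧
      ∀ t ∈ J, HasRatio Q p₁ p₂ (g t) (x₁ t / x₂ t) := by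
  obtain ⟨g, hg⟩ := h.exists_family x₁ x₂
  have hgJ : ∀ t ∈ J, IsDiagonal (g t).toScalarProduct h.basis (weights d₁ d₂ (x₁ t) (x₂ t)) :=
    fun t ht => hg t (hc.flow.pos₁ t ht) (hc.flow.pos₂ t ht)
  have hgT := fun t ht => hgJ t (hJ ht)
  have hrat : ∀ t ∈ J, HasRatio Q p₁ p₂ (g t) (x₁ t / x₂ t) := fun t ht =>
    (h.hasRatio_iff _ _).2 ⟨_, _, hc.flow.pos₁ t ht, hc.flow.pos₂ t ht, rfl, hgJ t ht⟩
  have h0 := hgJ 0 (hJ (left_mem_Ico.2 hc.time_pos))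
  rw [hc.init₁, hc.init₂] at h0
  exact ⟨g, (h.ricciFlow_iff hb₁ hb₂ hc.flow.pos₁ hc.flow.pos₂ hgJ).2 hc.flow,
    eq_of_isDiagonal h0 hg₀,
    ⟨h.not_bddAbove_curvatureNorm hb₁ hb₂ hJ hc hgT hr hs, h.bddAbove_mul_curvatureNorm hJ hc hgT⟩,
    h.tendsto_form hc hgT, ⟨_, hrat, hc.ratio⟩, hgJ, hrat⟩

theorem exists_maximal_of_isCollapse {a y₁ y₂ T r a₁ a₂ : ℝ} {x₁ x₂ : ℝ → ℝ}
    {g₀ : InvariantMetric I K D}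
    (hd : DoubleRootFlow (speed₁ Q e₁ e₂ b₁) (speed₂ Q e₁ e₂ b₂) a y₁ y₂)
    (hc : IsCollapse (speed₁ Q e₁ e₂ b₁) (speed₂ Q e₁ e₂ b₂) (Ico 0 T) T r a₁ a₂ x₁ x₂)
    (hg₀ : IsDiagonal g₀.toScalarProduct h.basis (weights d₁ d₂ a₁ a₂)) (hr : r = y₁ ∨ r = y₂) :
    ∃ (T : ℝ) (g : ℝ → InvariantMetric I K D), IsMaximalHRF g₀ T g ∧
      IsTypeISingularity T g ∧ ShrinksToPoint T g ∧
      RatioTendsto Q p₁ p₂ (Ico 0 T) g (𝓝[<] T) r := by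
  obtain ⟨g, h1, h2, h3, h4, h5, h6, _⟩ := h.exists_flow_of_isCollapse hb₁ hb₂ hc Subset.rfl hg₀
    (hd.root_pos hr) (hd.field₁_pos r hr)
  refine ⟨T, g, ⟨hc.time_pos, h1, h2, fun T' g' hg' hg'0 => ?_⟩, h3, h4, h5⟩
  -- For T' ≤ 0 the interval [0, T') is empty and does not contain 0, so the uniqueness argument is
  -- needed only for T' > 0.
  rcases le_or_gt T' 0 with hT' | hT'
  · rw [Ico_eq_empty hT'.not_gt]
    exact ⟨hT'.trans hc.time_pos.le, eqOn_empty _ _⟩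
  · obtain ⟨k1, k2⟩ := h.eqOn_of_isCollapse hb₁ hb₂ hd hc Subset.rfl ordConnected_Ico h6 hg₀
      ordConnected_Ico (left_mem_Ico.2 hT') hg' hg'0
    have hle : T' ≤ T := by
      by_contra hlt
      exact lt_irrefl T (k1 ⟨hc.time_pos.le, not_le.1 hlt⟩)
    exact ⟨hle, k2.mono (subset_inter Subset.rfl (Ico_subset_Ico_right hle))⟩

theorem exists_maximalAncient {a y₁ y₂ a₁ a₂ : ℝ} {g₀ : InvariantMetric I K D}
    (hd : DoubleRootFlow (speed₁ Q e₁ e₂ b₁) (speed₂ Q e₁ e₂ b₂) a y₁ y₂)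
    (ha₁ : 0 < a₁) (ha₂ : 0 < a₂) (hmin : min y₁ y₂ < a₁ / a₂) (hmax : a₁ / a₂ < max y₁ y₂)
    (hg₀ : IsDiagonal g₀.toScalarProduct h.basis (weights d₁ d₂ a₁ a₂)) :
    ∃ (T : ℝ) (g : ℝ → InvariantMetric I K D), IsMaximalAncientHRF g₀ T g ∧
      IsTypeIAncient g ∧ IsTypeISingularity T g ∧ ShrinksToPoint T g ∧
      RatioTendsto Q p₁ p₂ (Iio T) g atBot y₂ ∧ RatioTendsto Q p₁ p₂ (Iio T) g (𝓝[<] T) y₁ := by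
  obtain ⟨T, x₁, x₂, hc, hbot, ℓ, hℓ, hx⟩ := hd.exists_ancient ha₁ ha₂ hmin hmax
  have hsub : Ico 0 T ⊆ Iio T := fun t ht => ht.2
  obtain ⟨g, h1, h2, h3, h4, h5, h6, h7⟩ := h.exists_flow_of_isCollapse hb₁ hb₂ hc hsub hg₀
    hd.pos₁ (hd.field₁_pos y₁ (Or.inl rfl))
  refine ⟨T, g, ⟨⟨hc.time_pos, h1, h2⟩, fun J' g' hJ' h0 hg' hg'0 => ?_⟩,
    ⟨_, h.tendsto_abs_mul_curvatureNorm (Iio_mem_atBot T) hc.flow.pos₂ h6 hd.pos₂ hℓ.ne' hbot hx⟩,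
    h3, h4, ⟨_, h7, hbot⟩, h5⟩
  obtain ⟨k1, k2⟩ := h.eqOn_of_isCollapse hb₁ hb₂ hd hc hsub ordConnected_Iio h6 hg₀ hJ' h0 hg' hg'0
  exact ⟨k1, k2.mono (subset_inter Subset.rfl k1)⟩

theorem not_isAncientHRF {a y₁ y₂ a₁ a₂ : ℝ} {g₀ : InvariantMetric I K D}
    (hd : DoubleRootFlow (speed₁ Q e₁ e₂ b₁) (speed₂ Q e₁ e₂ b₂) a y₁ y₂)
    (hy : a₁ / a₂ < min y₁ y₂ ∨ max y₁ y₂ < a₁ / a₂)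
    (hg₀ : IsDiagonal g₀.toScalarProduct h.basis (weights d₁ d₂ a₁ a₂)) :
    ¬ ∃ (T : ℝ) (g : ℝ → InvariantMetric I K D), IsAncientHRF g₀ T g := by
  rintro ⟨T, g, hT, hg, hg0⟩
  obtain ⟨x₁, x₂, hx, hxd⟩ := h.isRatioFlow_of_isHRFOn hb₁ hb₂ hg
  obtain ⟨rfl, rfl⟩ := h.isDiagonal_weights hg₀ (hg0 ▸ hxd 0)
  rcases hy with hy | hy
  · exact hd.not_ancient_below hT (lt_min_iff.1 hy).1 (lt_min_iff.1 hy).2 hx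
  · exact hd.not_ancient_above hT (max_lt_iff.1 hy).1 (max_lt_iff.1 hy).2 hx

end TwoSummands

end Homogeneous

end HRF

end

theorem mainTheorem9
    {E : Type*} [NormedAddCommGroup E] [NormedSpace ℝ E] [FiniteDimensional ℝ E] [CompleteSpace E]
    {H : Type*} [TopologicalSpace H] (I : ModelWithCorners ℝ E H) [I.Boundaryless]
    {G : Type*} [TopologicalSpace G] [ChartedSpace H G] [Group G] [LieGroup I ∞ G]
    [T2Space G] [CompactSpace G]
    -- the compact, connected, effective homogeneous space `G / K`
    (K : Subgroup G) (hK : IsClosed (K : Set G)) [ConnectedSpace (G ⧸ K)] [FaithfulSMul G (G ⧸ K)]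
    -- a bi-invariant scalar product on the Lie algebra of `G`
    (Q : ScalarProduct (GroupLieAlgebra I G))
    (hQ : ∀ (a : G) (X Y : GroupLieAlgebra I G), Q.form (Ad I a X) (Ad I a Y) = Q.form X Y)
    -- `𝔤 = 𝔨 ⊕ 𝔭`, where `𝔨` is the Lie algebra of `K` and `𝔭` is `Q`-orthogonal to `𝔨`
    (D : Decomposition (GroupLieAlgebra I G))
    (hk : ∀ X : GroupLieAlgebra I G, X ∈ D.k ↔ IsTangentTo I K X)
    (hp : ∀ X ∈ D.k, ∀ Y ∈ D.p, Q.form X Y = 0)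
    (hmax : IsMaximalIsotropy I K D.k)
    -- `𝔭 = 𝔭₁ ⊕ 𝔭₂` with inequivalent irreducible summands
    (p₁ p₂ : Submodule ℝ (GroupLieAlgebra I G)) (hdisj : p₁ ⊓ p₂ = ⊥) (hsum : p₁ ⊔ p₂ = D.p)
    (hirr₁ : AdIrreducible I K p₁) (hirr₂ : AdIrreducible I K p₂)
    (hineq : ¬ AdEquivalent I K p₁ p₂)
    -- the constants `bᵢ`, defined by `-B|𝔭ᵢ = bᵢ Q|𝔭ᵢ` with `B` the Killing form
    (b₁ b₂ : ℝ)
    (hb₁ : ∀ X ∈ p₁, ∀ Y ∈ p₁, -killingForm ℝ (GroupLieAlgebra I G) X Y = b₁ * Q.form X Y)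
    (hb₂ : ∀ X ∈ p₂, ∀ Y ∈ p₂, -killingForm ℝ (GroupLieAlgebra I G) X Y = b₂ * Q.form X Y)
    -- orthonormal bases of the summands, of dimensions `dᵢ`
    {d₁ d₂ : ℕ} (e₁ : Module.Basis (Fin d₁) ℝ p₁) (e₂ : Module.Basis (Fin d₂) ℝ p₂)
    (he₁ : IsOrthonormalBasis Q e₁) (he₂ : IsOrthonormalBasis Q e₂)
    -- the cubic has a simple root `y₁` and a double root `y₂`
    (y₁ y₂ : ℝ) (hy : y₁ ≠ y₂)
    (hroots : (einsteinCubic d₁ d₂ b₁ b₂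
        (structureConstant Q e₁ e₁ e₁) (structureConstant Q e₁ e₁ e₂)
        (structureConstant Q e₁ e₂ e₂) (structureConstant Q e₂ e₂ e₂)).roots = {y₁, y₂, y₂}) :
    -- every invariant metric has the form `x₁ Q|𝔭₁ ⊕ x₂ Q|𝔭₂`, and the Einstein metrics are
    -- exactly those with `x₁ / x₂ = y₁` or `x₁ / x₂ = y₂`
    (∀ g : InvariantMetric I K D, ∃ y, HasRatio Q p₁ p₂ g y) ∧
    (∀ g : InvariantMetric I K D,
      IsEinstein g ↔ HasRatio Q p₁ p₂ g y₁ ∨ HasRatio Q p₁ p₂ g y₂) ∧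
    (∃ g : InvariantMetric I K D, HasRatio Q p₁ p₂ g y₁) ∧
    (∃ g : InvariantMetric I K D, HasRatio Q p₁ p₂ g y₂) ∧
    ∀ (g₀ : InvariantMetric I K D) (y₀ : ℝ), HasRatio Q p₁ p₂ g₀ y₀ →
      -- below both roots
      (y₀ < min y₁ y₂ →
        (∃ (T : ℝ) (g : ℝ → InvariantMetric I K D), IsMaximalHRF g₀ T g ∧
          IsTypeISingularity T g ∧ ShrinksToPoint T g ∧
          RatioTendsto Q p₁ p₂ (Ico 0 T) g (𝓝[<] T) (min y₁ y₂)) ∧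
        ¬ ∃ (T : ℝ) (g : ℝ → InvariantMetric I K D), IsAncientHRF g₀ T g) ∧
      -- between the two roots
      (min y₁ y₂ < y₀ → y₀ < max y₁ y₂ →
        ∃ (T : ℝ) (g : ℝ → InvariantMetric I K D), IsMaximalAncientHRF g₀ T g ∧
          IsTypeIAncient g ∧ IsTypeISingularity T g ∧ ShrinksToPoint T g ∧
          RatioTendsto Q p₁ p₂ (Iio T) g atBot y₂ ∧
          RatioTendsto Q p₁ p₂ (Iio T) g (𝓝[<] T) y₁) ∧
      -- above both roots
      (max y₁ y₂ < y₀ →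
        (∃ (T : ℝ) (g : ℝ → InvariantMetric I K D), IsMaximalHRF g₀ T g ∧
          IsTypeISingularity T g ∧ ShrinksToPoint T g ∧
          RatioTendsto Q p₁ p₂ (Ico 0 T) g (𝓝[<] T) (max y₁ y₂)) ∧
        ¬ ∃ (T : ℝ) (g : ℝ → InvariantMetric I K D), IsAncientHRF g₀ T g) := by
  have hdata : TwoSummands (adRep I K) D Q e₁ e₂ :=
    { adapted := ⟨Q.form_lie_of_Ad_invariant hQ, hp⟩
      form_rep := fun a => hQ a
      rep_lie := fun a => Ad_lie (a : G)
      sup_eq := hsum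
      irr₁ := hirr₁.repIrreducible
      irr₂ := hirr₂.repIrreducible
      inequiv := fun h => hineq (adEquivalent_of_repEquivalent h)
      on₁ := he₁
      on₂ := he₂ }
  -- Maximality of K enters only here.
  have h112 : 0 < structureConstant Q e₁ e₁ e₂ := by
    refine hdata.structureConstant_pos (fun 𝔥 hle hinv => hmax 𝔥 hle (AdInvariant.adRep.2 hinv)) ?_
    exact fun W hW X hX => hirr₁.1.lie_mem ((hk W).1 hW) hX
  obtain ⟨a, hd⟩ := exists_doubleRootFlow (Nat.cast_pos.2 hdata.pos₁) (Nat.cast_pos.2 hdata.pos₂)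
    h112 (structureConstant_nonneg Q e₁ e₂ e₂) (hdata.two_mul_le₁ hb₁ hb₂)
    (hdata.two_mul_le₂ hb₁ hb₂) hroots
  have hex : ∀ y, 0 < y → ∃ g : InvariantMetric I K D, HasRatio Q p₁ p₂ g y := fun y hy =>
    ⟨hdata.invariantMetric hy one_pos, (hdata.hasRatio_iff _ y).2
      ⟨y, 1, hy, one_pos, (div_one y).symm, hdata.metric_isDiagonal hy one_pos⟩⟩
  refine ⟨fun g => ?_, hdata.isEinstein_iff hb₁ hb₂ hd, hex y₁ hd.pos₁, hex y₂ hd.pos₂,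
    fun g₀ y₀ hg₀ => ?_⟩
  · obtain ⟨x₁, x₂, hx₁, hx₂, hg⟩ := hdata.exists_isDiagonal_invariant g
    exact ⟨_, (hdata.hasRatio_iff g _).2 ⟨x₁, x₂, hx₁, hx₂, rfl, hg⟩⟩
  · obtain ⟨x₁, x₂, hx₁, hx₂, rfl, hg⟩ := (hdata.hasRatio_iff g₀ y₀).1 hg₀
    refine ⟨fun hlt => ⟨?_, hdata.not_isAncientHRF hb₁ hb₂ hd (Or.inl hlt) hg⟩,
      fun hmin hlt => hdata.exists_maximalAncient hb₁ hb₂ hd hx₁ hx₂ hmin hlt hg,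
      fun hlt => ⟨?_, hdata.not_isAncientHRF hb₁ hb₂ hd (Or.inr hlt) hg⟩⟩
    · obtain ⟨T, z₁, z₂, hc⟩ := hd.exists_collapse_below hx₁ hx₂ (min_choice y₁ y₂)
        (min_le_left _ _) (min_le_right _ _) hlt
      exact hdata.exists_maximal_of_isCollapse hb₁ hb₂ hd hc hg (min_choice y₁ y₂)
    · obtain ⟨T, z₁, z₂, hc⟩ := hd.exists_collapse_above hx₁ hx₂ (max_choice y₁ y₂)
        (le_max_left _ _) (le_max_right _ _) hlt
      exact hdata.exists_maximal_of_isCollapse hb₁ hb₂ hd hc hg (max_choice y₁ y₂)
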